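/- **Setting.** Let $G$ be a Lie group with Lie algebra $\mathfrak g$ and let $Q$ be a smooth manifold (Hausdorff, paracompact, finite-dimensional; components of different dimensions are allowed) on which $G$ acts smoothly and properly, with a single orbit type: all isotropy groups $G_q$, $q\in Q$, are conjugate within $G$ to one subgroup $H$. Then the orbit space $Q/G$ is a smooth manifold, with the smooth structure for which the projection $\pi:Q\to Q/G$ is a submersion. Write $\zeta_q:\mathfrak g\to T_qQ$, $X\mapsto\zeta_X(q)=\frac{d}{dt}|_0\exp(tX).q$, and $\mathfrak g_q=\ker\zeta_q$ for the isotropy Lie algebra. Let $A\in\Omega^1(Q;\mathfrak g)$ be a generalized principal connection form, i.e. a smooth $G$-equivariant $\mathfrak g$-valued one-form with $\zeta\circ A\circ\zeta=\zeta$. Let $\mathrm{Hor}_q$ be the kernel of $T_qQ\xrightarrow{A_q}\mathfrak g\to\mathfrak g/\mathfrak g_q$; then $T_q\pi|\mathrm{Hor}_q$ is a linear isomorphism onto $T_{\pi(q)}(Q/G)$. Let $C_q:T_{\pi(q)}(Q/G)\to\mathrm{Hor}_q\subseteq T_qQ$ be its inverse (horizontal lift), $C_q^*:T_q^*Q\to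 T^*_{\pi(q)}(Q/G)$ the dual map, and $\mu:T^*Q\to\mathfrak g^*$, $\langle\mu(q,p),X\rangle=\langle p,\zeta_X(q)\rangle$, the momentum map. $G$ acts on $TQ$ and $T^*Q$ by the lifted actions, on $\bigsqcup_q\mathfrak g/\mathfrak g_q$ by $g.(q,X+\mathfrak g_q)=(g.q,\mathrm{Ad}(g)X+\mathfrak g_{g.q})$, on $\bigsqcup_q\mathrm{Ann}\,\mathfrak g_q$ by $g.(q,\lambda)=(g.q,\mathrm{Ad}^*(g)\lambda)$, and on $$\mathcal W:=(Q\times_{Q/G}T^*(Q/G))\times_Q\bigsqcup_{q}\mathrm{Ann}\,\mathfrak g_q$$ by $g.(q,\eta,\lambda)=(g.q,\eta,\mathrm{Ad}^*(g)\lambda)$. An orbit space $X/G$ is decomposed into the orbit type strata $X_{(L)}/G$, where $X_{(L)}$ is the set of points whose isotropy group is conjugate to $L$. A function on $X/G$, or on a subset $Z$ of it such as a stratum, is smooth if its pull-back to $X$, or to the part of $X$ over $Z$, is (locally the restriction of) a smooth function. The fibre product $T(Q/G)\times_{Q/G}(\bigsqcup_q\mathfrak g/\mathfrak g_q)/G$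 has the strata $T(Q/G)\times_{Q/G}(\bigsqcup_q\mathfrak g/\mathfrak g_q)_{(L)}/G$, and $W:=T^*(Q/G)\times_{Q/G}(\bigsqcup_q\mathrm{Ann}\,\mathfrak g_q)/G$ has the strata $T^*(Q/G)\times_{Q/G}(\bigsqcup_q\mathrm{Ann}\,\mathfrak g_q)_{(L)}/G$. Smooth functions on (subsets of) these are those whose pull-backs to $T(Q/G)\times_{Q/G}Q\times\mathfrak g$, respectively to $\mathcal W$, are smooth. A stratified isomorphism is a homeomorphism that maps the $(L)$-stratum onto the $(L)$-stratum for each $(L)$ and identifies the smooth functions, on the whole spaces and on all corresponding subsets; in particular it is a diffeomorphism on each stratum. **Theorem (Weinstein space).** (1) The map $$\alpha:(TQ)/G\to T(Q/G)\times_{Q/G}\Big(\bigsqcup_{q\in Q}\mathfrak g/\mathfrak g_q\Big)/G,\qquad [(q,v)]\mapsto(T\pi(q,v),[(q,A_q(v))])$$ is a well-defined stratified isomorphism over $Q/G$. (2) The map $$\beta:(T^*Q)/G\to W,\qquad[(q,p)]\mapsto(C_q^*(p),[(q,\mu(q,p))])$$ is a well-defined stratified isomorphism over $Q/G$. It is the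 fibrewise dual of $\alpha^{-1}$, in the sense that $\langle C_q^*(p),T_q\pi.v\rangle+\langle\mu(q,p),A_q(v)\rangle=\langle p,v\rangle$ for all $q\in Q$, $v\in T_qQ$, $p\in T_q^*Q$. (3) The map $\mathcal W/G\to W$, $[(q,\eta,\lambda)]\mapsto(\eta,[(q,\lambda)])$, is a well-defined stratified isomorphism, so that $C^\infty(W)=C^\infty(\mathcal W)^G$. The map $\psi:\mathcal W\to T^*Q$, $(q,\eta,\lambda)\mapsto(q,(T_q\pi)^*\eta+\lambda\circ A_q)$, is bijective with inverse $(q,p)\mapsto(q,C_q^*(p),\mu(q,p))$. Let $\mathcal W$ carry the Poisson bracket of the symplectic form $\sigma=\psi^*\Omega$, where $\Omega=-d\theta$ is the canonical symplectic form of $T^*Q$. The bracket of $\mathcal W$ descends to a Poisson bracket on $C^\infty(W)=C^\infty(\mathcal W)^G$, the bracket of $T^*Q$ descends to a Poisson bracket on $C^\infty((T^*Q)/G)=C^\infty(T^*Q)^G$, and $\beta$ is an isomorphism of Poisson spaces: $\{f\circ\beta,h\circ\beta\}=\{f,h\}\circ\beta$ for all $f,h\in C^\infty(W)$. -/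

import Mathlib

open Set Function Bundle Manifold
open scoped Manifold ContDiff Pointwise

noncomputable section

set_option linter.unusedSectionVars false

/-! ### Orbit spaces, orbit type strata, smooth functions -/

section Strata

/-- The orbit space `X/G` of an action; it carries the quotient topology. -/
abbrev OrbitSpace {G : Type*} [Group G] {X : Type*} (a : MulAction G X) : Type _ :=
  Quotient (@MulAction.orbitRel G X _ a)

/-- The orbit `[x]` of a point. -/
def OrbitSpace.mk {G : Type*} [Group G] {X : Type*} (a : MulAction G X) (x : X) : OrbitSpace a :=
  Quotient.mk (@MulAction.orbitRel G X _ a) x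

/-- The orbit type stratum `X_(L)/G` of `X/G`: the orbits of those points whose isotropy group
is conjugate to `L` within `G`. It is non-empty exactly if `(L)` lies in the isotropy lattice. -/
def orbitTypeStratum {G : Type*} [Group G] {X : Type*} (a : MulAction G X) (L : Subgroup G) :
    Set (OrbitSpace a) :=
  {y | ∃ x : X, OrbitSpace.mk a x = y ∧
    ∃ g : G, @MulAction.stabilizer G X _ a x = MulAut.conj g • L}

/-- A decomposition of `X` into pieces indexed by subgroups of `G` up to conjugacy, together with
the notion of a smooth real function on a subset of `X`. -/
structure StratData (G : Type*) [Group G] (X : Type*) where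
  /-- the stratum with index `(L)` -/
  stratum : Subgroup G → Set X
  /-- `smoothOn Z f`: the restriction of `f` to `Z` is smooth -/
  smoothOn : Set X → (X → ℝ) → Prop

/-- Smooth functions on a space `X` that is presented by a map `p : P → X`, where `P` is regarded
through `e : P → M` as a subset of a manifold `M`: the restriction of `f` to `Z` is smooth if its
pull-back to the part of `P` over `Z` extends, locally around each point, to a smooth function on
an open subset of `M`. -/
def presentedSmoothOn {EM : Type*} [NormedAddCommGroup EM] [NormedSpace ℝ EM]
    {HM : Type*} [TopologicalSpace HM] (J : ModelWithCorners ℝ EM HM)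
    {M : Type*} [TopologicalSpace M] [ChartedSpace HM M] {P X : Type*}
    (e : P → M) (p : P → X) (Z : Set X) (f : X → ℝ) : Prop :=
  ∀ a : P, p a ∈ Z → ∃ U : Set M, IsOpen U ∧ e a ∈ U ∧ ∃ f' : M → ℝ,
    ContMDiffOn J 𝓘(ℝ, ℝ) ∞ f' U ∧ ∀ b : P, e b ∈ U → p b ∈ Z → f' (e b) = f (p b)

/-- The algebra `C^∞(X)`. -/
def StratData.smoothFunctions {G : Type*} [Group G] {X : Type*} (D : StratData G X) :
    Set (X → ℝ) :=
  {f | D.smoothOn univ f}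

/-- Disjoint unions. -/
def StratData.sigma {G : Type*} [Group G] {ι : Type*} {X : ι → Type*}
    (D : ∀ i, StratData G (X i)) : StratData G (Σ i, X i) where
  stratum L := {x | x.2 ∈ (D x.1).stratum L}
  smoothOn Z f := ∀ i, (D i).smoothOn (Sigma.mk i ⁻¹' Z) (fun x => f ⟨i, x⟩)

/-- A stratified isomorphism: a homeomorphism that maps, for each `(L)`, the `(L)`-stratum onto the
`(L)`-stratum, and that identifies the smooth functions on `Z` with those on the pre-image
of `Z`, for each subset `Z` (the whole space, a stratum, an open subset of a stratum);
thus it restricts to diffeomorphisms of strata. -/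
structure IsStratifiedIso {G : Type*} [Group G] {X Y : Type*} [TopologicalSpace X]
    [TopologicalSpace Y] (D : StratData G X) (D' : StratData G Y) (φ : X ≃ₜ Y) : Prop where
  image_stratum : ∀ L : Subgroup G, φ '' D.stratum L = D'.stratum L
  smoothOn_iff : ∀ (Z : Set Y) (f : Y → ℝ), D'.smoothOn Z f ↔ D.smoothOn (φ ⁻¹' Z) (f ∘ φ)

/-- `br` is a Poisson bracket on the algebra `C` of functions on `X`. -/
structure IsPoissonBracket {X : Type*} (C : Set (X → ℝ))
    (br : (X → ℝ) → (X → ℝ) → (X → ℝ)) : Prop where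
  mem : ∀ f ∈ C, ∀ g ∈ C, br f g ∈ C
  add_left : ∀ f ∈ C, ∀ g ∈ C, ∀ h ∈ C, br (f + g) h = br f h + br g h
  smul_left : ∀ c : ℝ, ∀ f ∈ C, ∀ g ∈ C, br (c • f) g = c • br f g
  antisymm : ∀ f ∈ C, ∀ g ∈ C, br f g = -br g f
  leibniz : ∀ f ∈ C, ∀ g ∈ C, ∀ h ∈ C, br f (g * h) = br f g * h + g * br f h
  jacobi : ∀ f ∈ C, ∀ g ∈ C, ∀ h ∈ C, br f (br g h) + br g (br h f) + br h (br f g) = 0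

end Strata

/-! ### The cotangent bundle and its canonical Poisson bracket -/

section Cotangent

/-- The cotangent bundle `T*Q`, as the bundle of continuous linear forms on the tangent spaces. -/
abbrev CotangentBundle (E : Type*) [NormedAddCommGroup E] [NormedSpace ℝ E]
    (Q : Type*) [TopologicalSpace Q] [ChartedSpace E Q] : Type _ :=
  TotalSpace (E →L[ℝ] ℝ) (fun q : Q => TangentSpace 𝓘(ℝ, E) q →L[ℝ] Bundle.Trivial Q ℝ q)

variable {E : Type*} [NormedAddCommGroup E] [NormedSpace ℝ E] [FiniteDimensional ℝ E]
  {Q : Type*} [TopologicalSpace Q] [ChartedSpace E Q] [IsManifold 𝓘(ℝ, E) ∞ Q]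

/-- The preferred chart of `T*Q` at `z` is the cotangent chart induced by the preferred
chart `x` of `Q` at the foot point of `z`: it maps `(q, p)` to `x q` and to `p` read in the
coordinates `x`. -/
theorem cotangent_chart (z y : CotangentBundle E Q) :
    chartAt (ModelProd E (E →L[ℝ] ℝ)) z y =
      (chartAt E z.1 y.1, ContinuousLinearMap.comp (y.2 : E →L[ℝ] ℝ)
        ((trivializationAt E (TangentSpace 𝓘(ℝ, E)) z.1).symmL ℝ y.1 : E →L[ℝ] E)) := by
  rw [hom_chart]
  refine Prod.ext rfl ?_
  ext v
  simp [ContinuousLinearMap.inCoordinates]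

/-- The Poisson bracket of the canonical symplectic form `Ω = -dθ = ∑ dqᵢ ∧ dpᵢ` of `T*Q`,
`{f, h} = ∑ (∂f/∂qᵢ ∂h/∂pᵢ - ∂f/∂pᵢ ∂h/∂qᵢ)`, computed at `z` in the canonical coordinates
`(q, p)` given by the preferred chart at `z` (this is the chart in which `mfderiv` at `z` is
expressed) and by a basis of the model space with its dual basis. -/
def canonicalBracket (f h : CotangentBundle E Q → ℝ) (z : CotangentBundle E Q) : ℝ :=
  let df : E × (E →L[ℝ] ℝ) →L[ℝ] ℝ :=
    mfderiv (𝓘(ℝ, E).prod 𝓘(ℝ, E →L[ℝ] ℝ)) 𝓘(ℝ, ℝ) f z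
  let dh : E × (E →L[ℝ] ℝ) →L[ℝ] ℝ :=
    mfderiv (𝓘(ℝ, E).prod 𝓘(ℝ, E →L[ℝ] ℝ)) 𝓘(ℝ, ℝ) h z
  let b := Module.finBasis ℝ E
  ∑ i, (df (b i, 0) * dh (0, LinearMap.toContinuousLinearMap (b.coord i)) -
    df (0, LinearMap.toContinuousLinearMap (b.coord i)) * dh (b i, 0))

end Cotangent

/-! ### Lie group actions and their lifts -/

section Lifts

variable (EG : Type*) [NormedAddCommGroup EG] [NormedSpace ℝ EG]
  (E : Type*) [NormedAddCommGroup E] [NormedSpace ℝ E]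
  (G : Type*) [Group G] [TopologicalSpace G] [ChartedSpace EG G] [LieGroup 𝓘(ℝ, EG) ∞ G]
  (Q : Type*) [TopologicalSpace Q] [ChartedSpace E Q] [IsManifold 𝓘(ℝ, E) ∞ Q]
  [MulAction G Q] [ContMDiffSMul 𝓘(ℝ, EG) 𝓘(ℝ, E) ∞ G Q]

/-- The Lie algebra `𝔤 = T_1 G`. The tangent space at a point is by definition a copy of the
model space `EG`; here it is used together with the norm and the smooth structure of `EG`. -/
abbrev LieAlg (EG : Type*) [NormedAddCommGroup EG] [NormedSpace ℝ EG]
    (G : Type*) [Group G] [TopologicalSpace G] [ChartedSpace EG G] : Type _ := EG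

variable {E G Q} in
/-- `ζ_q : 𝔤 → T_q Q`, the value at `q` of the fundamental vector fields; it is the derivative
at `1` of the orbit map `g ↦ g • q`. -/
def fundamental (q : Q) : LieAlg EG G →L[ℝ] TangentSpace 𝓘(ℝ, E) q :=
  mfderiv 𝓘(ℝ, EG) 𝓘(ℝ, E) (fun g : G => g • q) (1 : G)

variable {G} in
/-- The adjoint action `Ad g : 𝔤 → 𝔤`, the derivative at `1` of conjugation by `g`. -/
def adjointRep (g : G) : LieAlg EG G →L[ℝ] LieAlg EG G :=
  mfderiv 𝓘(ℝ, EG) 𝓘(ℝ, EG) (fun k : G => g * k * g⁻¹) (1 : G)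

variable {G Q} in
/-- The derivative `T_q Q → T_{g q} Q` of the action of `g`. -/
def actionDeriv (g : G) (q : Q) : TangentSpace 𝓘(ℝ, E) q →L[ℝ] TangentSpace 𝓘(ℝ, E) (g • q) :=
  mfderiv 𝓘(ℝ, E) 𝓘(ℝ, E) (fun x : Q => g • x) q

variable {Q} in
/-- The isotropy Lie algebra `𝔤_q = {X | ζ_X(q) = 0}`. -/
def isotropyAlgebra (q : Q) : Submodule ℝ (LieAlg EG G) :=
  LinearMap.ker (fundamental EG (E := E) (G := G) q).toLinearMap




variable {E G Q} in
theorem mdifferentiable_smul_const (EG : Type*) [NormedAddCommGroup EG] [NormedSpace ℝ EG]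
    [ChartedSpace EG G] [ContMDiffSMul 𝓘(ℝ, EG) 𝓘(ℝ, E) ∞ G Q] (g : G) :
    MDifferentiable 𝓘(ℝ, E) 𝓘(ℝ, E) (fun x : Q => g • x) := by
  have h : ContMDiff 𝓘(ℝ, E) 𝓘(ℝ, E) ∞ (fun x : Q => g • x) :=
    ContMDiffSMul.contMDiff_const_smul (I := 𝓘(ℝ, EG)) g
  exact h.mdifferentiable (by simp)

variable {E G Q} in
theorem mdifferentiable_orbitMap (q : Q) :
    MDifferentiable 𝓘(ℝ, EG) 𝓘(ℝ, E) (fun g : G => g • q) := by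
  have h : ContMDiff 𝓘(ℝ, EG) 𝓘(ℝ, E) ∞ (fun g : G => g • q) :=
    (contMDiff_smul (I := 𝓘(ℝ, EG)) (I' := 𝓘(ℝ, E)) (n := ∞)).comp
      (contMDiff_id.prodMk contMDiff_const)
  exact h.mdifferentiable (by simp)

variable {G} in
theorem mdifferentiable_conj (g : G) :
    MDifferentiable 𝓘(ℝ, EG) 𝓘(ℝ, EG) (fun k : G => g * k * g⁻¹) := by
  have h : ContMDiff 𝓘(ℝ, EG) 𝓘(ℝ, EG) ∞ (fun k : G => g * k * g⁻¹) :=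
    (contMDiff_mul_right (a := g⁻¹)).comp (contMDiff_mul_left (a := g))
  exact h.mdifferentiable (by simp)

variable {E G Q} in
theorem actionDeriv_one (q : Q) :
    (actionDeriv E (1 : G) q : E →L[ℝ] E) = ContinuousLinearMap.id ℝ E := by
  have h : (fun x : Q => (1 : G) • x) = id := by
    funext x
    simp
  unfold actionDeriv
  rw [h]
  exact mfderiv_id

variable {E G Q} in
theorem actionDeriv_mul (EG : Type*) [NormedAddCommGroup EG] [NormedSpace ℝ EG] [ChartedSpace EG G]
    [ContMDiffSMul 𝓘(ℝ, EG) 𝓘(ℝ, E) ∞ G Q] (g h : G) (q : Q) :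
    (actionDeriv E (g * h) q : E →L[ℝ] E) =
      (actionDeriv E g (h • q) : E →L[ℝ] E).comp (actionDeriv E h q : E →L[ℝ] E) := by
  have e : (fun x : Q => (g * h) • x) = (fun x : Q => g • x) ∘ (fun x : Q => h • x) := by
    funext x
    simp [mul_smul]
  unfold actionDeriv
  rw [e]
  exact mfderiv_comp q (mdifferentiable_smul_const EG g _) (mdifferentiable_smul_const EG h _)

variable {E G Q} in
theorem fundamental_smul (g : G) (q : Q) (X : LieAlg EG G) :
    (fundamental EG (g • q) (adjointRep EG g X) : E) =
      (actionDeriv E g q : E →L[ℝ] E) (fundamental EG q X : E) := by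
  have e : (fun k : G => k • (g • q)) ∘ (fun k : G => g * k * g⁻¹) =
      (fun x : Q => g • x) ∘ (fun k : G => k • q) := by
    funext k
    simp [mul_smul]
  have key : ∀ k : G, k = 1 →
      (mfderiv 𝓘(ℝ, EG) 𝓘(ℝ, E) (fun k : G => k • (g • q)) k : EG →L[ℝ] E) =
        mfderiv 𝓘(ℝ, EG) 𝓘(ℝ, E) (fun k : G => k • (g • q)) 1 := by
    rintro _ rfl
    rfl
  have key' : ∀ x : Q, x = q →
      (mfderiv 𝓘(ℝ, E) 𝓘(ℝ, E) (fun x : Q => g • x) x : E →L[ℝ] E) =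
        mfderiv 𝓘(ℝ, E) 𝓘(ℝ, E) (fun x : Q => g • x) q := by
    rintro _ rfl
    rfl
  have h1 : (mfderiv 𝓘(ℝ, EG) 𝓘(ℝ, E)
      ((fun k : G => k • (g • q)) ∘ (fun k : G => g * k * g⁻¹)) 1 : EG →L[ℝ] E) = _ :=
    mfderiv_comp (1 : G) (mdifferentiable_orbitMap EG (g • q) _) (mdifferentiable_conj EG g _)
  have h2 : (mfderiv 𝓘(ℝ, EG) 𝓘(ℝ, E)
      ((fun x : Q => g • x) ∘ (fun k : G => k • q)) 1 : EG →L[ℝ] E) = _ :=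
    mfderiv_comp (1 : G) (mdifferentiable_smul_const EG g _) (mdifferentiable_orbitMap EG q _)
  have h3 := (h1.symm.trans (by rw [e])).trans h2
  have h4 := congrArg (fun T : EG →L[ℝ] E => T X) h3
  have h5 := congrArg (fun T : EG →L[ℝ] E => T (adjointRep EG g X)) (key (g * 1 * g⁻¹) (by simp))
  have h6 := congrArg (fun T : E →L[ℝ] E => T (fundamental EG q X : E)) (key' ((1 : G) • q) (by simp))
  exact h5.symm.trans (h4.trans h6)

variable {G} in
theorem adjointRep_one : adjointRep EG (1 : G) = ContinuousLinearMap.id ℝ EG := by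
  have h : (fun k : G => 1 * k * (1 : G)⁻¹) = id := by
    funext x
    simp
  unfold adjointRep
  rw [h]
  exact mfderiv_id

variable {G} in
theorem adjointRep_mul (g h : G) :
    adjointRep EG (g * h) = (adjointRep EG g).comp (adjointRep EG h) := by
  have e : (fun k : G => g * h * k * (g * h)⁻¹) =
      (fun k : G => g * k * g⁻¹) ∘ (fun k : G => h * k * h⁻¹) := by
    funext x
    simp [mul_assoc]
  have key : ∀ k : G, k = 1 →
      (mfderiv 𝓘(ℝ, EG) 𝓘(ℝ, EG) (fun k : G => g * k * g⁻¹) k : EG →L[ℝ] EG) =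
        mfderiv 𝓘(ℝ, EG) 𝓘(ℝ, EG) (fun k : G => g * k * g⁻¹) 1 := by
    rintro _ rfl
    rfl
  have h1 : (mfderiv 𝓘(ℝ, EG) 𝓘(ℝ, EG)
      ((fun k : G => g * k * g⁻¹) ∘ (fun k : G => h * k * h⁻¹)) 1 : EG →L[ℝ] EG) = _ :=
    mfderiv_comp (1 : G) (mdifferentiable_conj EG g _) (mdifferentiable_conj EG h _)
  unfold adjointRep
  rw [e]
  exact h1.trans (congrArg (fun T : EG →L[ℝ] EG => T.comp (adjointRep EG h))
    (key (h * 1 * h⁻¹) (by simp)))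

variable {E G Q} in
theorem adjointRep_mem (g : G) (q : Q) {X : LieAlg EG G} (hX : X ∈ isotropyAlgebra EG E G q) :
    adjointRep EG g X ∈ isotropyAlgebra EG E G (g • q) := by
  have h : (fundamental EG q X : E) = 0 := hX
  have h' := fundamental_smul EG (E := E) g q X
  rw [h, map_zero] at h'
  exact h'

variable {G Q} in
/-- The tangent lifted action `g.(q, v) = (g q, T_q l_g v)` on `TQ`. -/
abbrev tangentAction : MulAction G (TangentBundle 𝓘(ℝ, E) Q) where
  smul g x := ⟨g • x.1, actionDeriv E g x.1 x.2⟩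
  one_smul x := by
    refine TotalSpace.ext (one_smul G x.1) (heq_of_eq ?_)
    exact congrArg (fun T : E →L[ℝ] E => T x.2) (actionDeriv_one (G := G) x.1)
  mul_smul g h x := by
    refine TotalSpace.ext (mul_smul g h x.1) (heq_of_eq ?_)
    exact congrArg (fun T : E →L[ℝ] E => T x.2) (actionDeriv_mul EG g h x.1)

variable {G Q} in
/-- The cotangent lifted action `g.(q, p) = (g q, p ∘ T_{g q} l_{g⁻¹})` on `T*Q`. -/
abbrev cotangentAction : MulAction G (CotangentBundle E Q) where
  smul g z := ⟨g • z.1, ContinuousLinearMap.comp (z.2 : E →L[ℝ] ℝ)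
    (actionDeriv E g⁻¹ (g • z.1) : E →L[ℝ] E)⟩
  one_smul z := by
    refine TotalSpace.ext (one_smul G z.1) (heq_of_eq ?_)
    have h : (actionDeriv E (1 : G)⁻¹ ((1 : G) • z.1) : E →L[ℝ] E) =
        ContinuousLinearMap.id ℝ E := by
      rw [inv_one]
      exact actionDeriv_one _
    exact congrArg (fun T : E →L[ℝ] E => ContinuousLinearMap.comp (z.2 : E →L[ℝ] ℝ) T) h
  mul_smul g h z := by
    refine TotalSpace.ext (mul_smul g h z.1) (heq_of_eq ?_)
    have e : (actionDeriv E (g * h)⁻¹ ((g * h) • z.1) : E →L[ℝ] E) =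
        (actionDeriv E h⁻¹ (h • z.1) : E →L[ℝ] E).comp
          (actionDeriv E g⁻¹ (g • h • z.1) : E →L[ℝ] E) := by
      rw [mul_inv_rev]
      have e1 := actionDeriv_mul (E := E) EG h⁻¹ g⁻¹ ((g * h) • z.1)
      have key : ∀ x y x' y' : Q, x = x' → y = y' →
          (actionDeriv E h⁻¹ x : E →L[ℝ] E).comp (actionDeriv E g⁻¹ y : E →L[ℝ] E) =
          (actionDeriv E h⁻¹ x' : E →L[ℝ] E).comp (actionDeriv E g⁻¹ y' : E →L[ℝ] E) := by
        rintro _ _ _ _ rfl rfl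
        rfl
      exact e1.trans (key _ _ _ _ (by simp [mul_smul]) (mul_smul g h z.1))
    exact congrArg (fun T : E →L[ℝ] E => ContinuousLinearMap.comp (z.2 : E →L[ℝ] ℝ) T) e

/-- The bundle `⨆_q 𝔤/𝔤_q` over `Q`. -/
structure IsotropyQuotient where
  /-- the foot point -/
  base : Q
  /-- the element of `𝔤/𝔤_q` -/
  val : LieAlg EG G ⧸ isotropyAlgebra EG E G base

variable {E G Q} in
/-- The element `(q, X + 𝔤_q)`. -/
def IsotropyQuotient.mk' (q : Q) (X : LieAlg EG G) : IsotropyQuotient EG E G Q :=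
  ⟨q, Submodule.Quotient.mk X⟩

/-- The topology of the vector bundle `⨆_q 𝔤/𝔤_q`: the quotient topology from `Q × 𝔤`. -/
instance : TopologicalSpace (IsotropyQuotient EG E G Q) :=
  TopologicalSpace.coinduced
    (fun x : Q × LieAlg EG G => IsotropyQuotient.mk' EG (E := E) x.1 x.2) inferInstance

/-- The action `g.(q, X + 𝔤_q) = (g q, Ad(g) X + 𝔤_{g q})`. -/
abbrev isotropyQuotientAction : MulAction G (IsotropyQuotient EG E G Q) where
  smul g x := ⟨g • x.base, Submodule.mapQ (isotropyAlgebra EG E G x.base)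
    (isotropyAlgebra EG E G (g • x.base)) (adjointRep EG g).toLinearMap
    (fun X hX => Submodule.mem_comap.mpr (adjointRep_mem EG g x.base hX)) x.val⟩
  one_smul := by
    rintro ⟨q, x⟩
    obtain ⟨X, rfl⟩ := Submodule.Quotient.mk_surjective _ x
    change IsotropyQuotient.mk' EG ((1 : G) • q) (adjointRep EG (1 : G) X) =
      IsotropyQuotient.mk' EG q X
    rw [one_smul, adjointRep_one]
    rfl
  mul_smul g h := by
    rintro ⟨q, x⟩
    obtain ⟨X, rfl⟩ := Submodule.Quotient.mk_surjective _ x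
    change IsotropyQuotient.mk' EG ((g * h) • q) (adjointRep EG (g * h) X) =
      IsotropyQuotient.mk' EG (g • h • q) (adjointRep EG g (adjointRep EG h X))
    rw [mul_smul, adjointRep_mul]
    rfl

variable {Q} in
/-- The annihilator `Ann 𝔤_q ⊆ 𝔤*`. -/
def isotropyAnn (q : Q) : Set (LieAlg EG G →L[ℝ] ℝ) :=
  {l | ∀ X ∈ isotropyAlgebra EG E G q, l X = 0}

variable {G} in
/-- The coadjoint action `Ad*(g) λ = λ ∘ Ad(g⁻¹)` on `𝔤*`. -/
def coadjoint (g : G) (l : LieAlg EG G →L[ℝ] ℝ) : LieAlg EG G →L[ℝ] ℝ :=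
  l.comp (adjointRep EG g⁻¹)

variable {G} in
theorem coadjoint_one (l : LieAlg EG G →L[ℝ] ℝ) : coadjoint EG (1 : G) l = l := by
  unfold coadjoint
  rw [inv_one, adjointRep_one]
  rfl

variable {G} in
theorem coadjoint_mul (g h : G) (l : LieAlg EG G →L[ℝ] ℝ) :
    coadjoint EG (g * h) l = coadjoint EG g (coadjoint EG h l) := by
  unfold coadjoint
  rw [mul_inv_rev, adjointRep_mul]
  rfl

variable {E G Q} in
theorem coadjoint_mem (g : G) (q : Q) {l : LieAlg EG G →L[ℝ] ℝ} (hl : l ∈ isotropyAnn EG E G q) :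
    coadjoint EG g l ∈ isotropyAnn EG E G (g • q) := by
  intro X hX
  have h := adjointRep_mem EG g⁻¹ (g • q) hX
  rw [inv_smul_smul] at h
  exact hl _ h

/-- The bundle `⨆_q Ann 𝔤_q` over `Q`, a subspace of `Q × 𝔤*`. -/
abbrev AnnBundle : Type _ :=
  {x : Q × (LieAlg EG G →L[ℝ] ℝ) // x.2 ∈ isotropyAnn EG E G x.1}

/-- The action `g.(q, λ) = (g q, Ad*(g) λ)`. -/
abbrev annAction : MulAction G (AnnBundle EG E G Q) where
  smul g x := ⟨(g • x.1.1, coadjoint EG g x.1.2), coadjoint_mem EG g x.1.1 x.2⟩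
  one_smul x := Subtype.ext (Prod.ext (one_smul G x.1.1) (coadjoint_one EG x.1.2))
  mul_smul g h x :=
    Subtype.ext (Prod.ext (mul_smul g h x.1.1) (coadjoint_mul EG g h x.1.2))

variable {E G Q} in
/-- The momentum map `μ : T*Q → 𝔤*`, `⟨μ(q, p), X⟩ = ⟨p, ζ_X(q)⟩`. -/
def momentum (z : CotangentBundle E Q) : LieAlg EG G →L[ℝ] ℝ :=
  ContinuousLinearMap.comp (z.2 : E →L[ℝ] ℝ) (fundamental EG (G := G) z.1 : EG →L[ℝ] E)

variable {E G Q} in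
theorem momentum_mem (z : CotangentBundle E Q) :
    momentum EG (G := G) z ∈ isotropyAnn EG E G z.1 := by
  intro X hX
  have h : (fundamental EG z.1 X : E) = 0 := hX
  change (z.2 : E →L[ℝ] ℝ) (fundamental EG z.1 X : E) = 0
  rw [h, map_zero]

/-- A generalized principal connection form: a smooth `G`-equivariant `𝔤`-valued one-form `A`
on `Q` with `ζ ∘ A ∘ ζ = ζ`. -/
structure GeneralizedConnection where
  /-- the one-form -/
  form : ∀ q : Q, TangentSpace 𝓘(ℝ, E) q →L[ℝ] LieAlg EG G
  smooth : ContMDiff 𝓘(ℝ, E).tangent 𝓘(ℝ, EG) ∞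
    (fun x : TangentBundle 𝓘(ℝ, E) Q => form x.1 x.2)
  equivariant : ∀ (g : G) (q : Q) (v : TangentSpace 𝓘(ℝ, E) q),
    form (g • q) (actionDeriv E g q v) = adjointRep EG g (form q v)
  fundamental_form_fundamental : ∀ (q : Q) (X : LieAlg EG G),
    fundamental EG (E := E) q (form q (fundamental EG q X)) = fundamental EG q X

end Lifts

/-! ### The orbit space as base, horizontal lifts, and the Weinstein spaces -/

section Weinstein

/-- The orbit space `Q/G`. -/
abbrev BaseSpace (G : Type*) [Group G] (Q : Type*) [a : MulAction G Q] : Type _ := OrbitSpace a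

/-- The projection `π : Q → Q/G`. -/
def baseProj (G : Type*) [Group G] {Q : Type*} [a : MulAction G Q] (q : Q) : BaseSpace G Q :=
  OrbitSpace.mk a q

variable {EG : Type*} [NormedAddCommGroup EG] [NormedSpace ℝ EG]
  {E : Type*} [NormedAddCommGroup E] [NormedSpace ℝ E]
  {F : Type*} [NormedAddCommGroup F] [NormedSpace ℝ F]
  {G : Type*} [Group G] [TopologicalSpace G] [ChartedSpace EG G] [LieGroup 𝓘(ℝ, EG) ∞ G]
  {Q : Type*} [TopologicalSpace Q] [ChartedSpace E Q] [IsManifold 𝓘(ℝ, E) ∞ Q]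
  [MulAction G Q] [ContMDiffSMul 𝓘(ℝ, EG) 𝓘(ℝ, E) ∞ G Q]
  [ChartedSpace F (BaseSpace G Q)] [IsManifold 𝓘(ℝ, F) ∞ (BaseSpace G Q)]

variable (E F G) in
/-- `T_q π : T_q Q → T_{π q}(Q/G)`. -/
def baseProjDeriv (q : Q) : TangentSpace 𝓘(ℝ, E) q →L[ℝ] TangentSpace 𝓘(ℝ, F) (baseProj G q) :=
  mfderiv 𝓘(ℝ, E) 𝓘(ℝ, F) (baseProj G) q

namespace GeneralizedConnection

variable (A : GeneralizedConnection EG E G Q)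

/-- The horizontal space at `q`: the kernel of `A_q : T_q Q → 𝔤/𝔤_q`. -/
def Hor (q : Q) : Submodule ℝ (TangentSpace 𝓘(ℝ, E) q) :=
  (isotropyAlgebra EG E G q).comap (A.form q).toLinearMap

variable (F) in
/-- The horizontal lift `C_q = (T_q π | Hor_q)⁻¹ : T_{π q}(Q/G) → Hor_q ⊆ T_q Q`. -/
def horizontalLift (q : Q) :
    TangentSpace 𝓘(ℝ, F) (baseProj G q) →L[ℝ] TangentSpace 𝓘(ℝ, E) q :=
  (A.Hor q).subtypeL.comp
    (ContinuousLinearMap.inverse ((baseProjDeriv E F G q).comp (A.Hor q).subtypeL))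

end GeneralizedConnection

/-! The quotient `(TQ)/G` and the space `T(Q/G) ×_{Q/G} (⨆_q 𝔤/𝔤_q)/G`. -/

variable (EG E G Q) in
/-- The orbit space `(TQ)/G`. -/
abbrev TangentQuotient : Type _ := OrbitSpace (tangentAction EG E (G := G) (Q := Q))

variable (EG E G Q) in
/-- The orbit type strata and the smooth functions of `(TQ)/G`. -/
def tangentQuotientData : StratData G (TangentQuotient EG E G Q) where
  stratum := orbitTypeStratum _
  smoothOn := presentedSmoothOn 𝓘(ℝ, E).tangent (fun x : TangentBundle 𝓘(ℝ, E) Q => x)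
    (OrbitSpace.mk _)

/-- The projection `(⨆_q 𝔤/𝔤_q)/G → Q/G`. -/
def isotropyQuotientBase : OrbitSpace (isotropyQuotientAction EG E G Q) → BaseSpace G Q :=
  Quotient.lift (fun x : IsotropyQuotient EG E G Q => baseProj G x.base) (by
    rintro _ b ⟨g, rfl⟩
    exact Quotient.sound ⟨g, rfl⟩)

variable (EG E F G Q) in
/-- The fibre product `T(Q/G) ×_{Q/G} (⨆_q 𝔤/𝔤_q)/G`. -/
abbrev TangentWeinstein : Type _ :=
  {y : TangentBundle 𝓘(ℝ, F) (BaseSpace G Q) × OrbitSpace (isotropyQuotientAction EG E G Q) //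
    y.1.1 = isotropyQuotientBase y.2}

variable (EG E F G Q) in
/-- The strata `T(Q/G) ×_{Q/G} (⨆_q 𝔤/𝔤_q)_(L)/G` and the smooth functions of the fibre product,
presented by the submanifold `T(Q/G) ×_{Q/G} Q × 𝔤` of `T(Q/G) × Q × 𝔤`. -/
def tangentWeinsteinData : StratData G (TangentWeinstein EG E F G Q) where
  stratum L := {y | y.1.2 ∈ orbitTypeStratum _ L}
  smoothOn := presentedSmoothOn
    (P := {x : TangentBundle 𝓘(ℝ, F) (BaseSpace G Q) × (Q × LieAlg EG G) //
      x.1.1 = baseProj G x.2.1})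
    (𝓘(ℝ, F).tangent.prod (𝓘(ℝ, E).prod 𝓘(ℝ, EG))) Subtype.val
    (fun x => ⟨(x.1.1, OrbitSpace.mk _ (IsotropyQuotient.mk' EG x.1.2.1 x.1.2.2)), x.2⟩)

variable (F) in
/-- The point `(Tπ(q, v), [(q, A_q(v))])` for `(q, v) ∈ TQ`. -/
def GeneralizedConnection.tangentPoint (A : GeneralizedConnection EG E G Q)
    (x : TangentBundle 𝓘(ℝ, E) Q) : TangentWeinstein EG E F G Q :=
  ⟨(⟨baseProj G x.1, baseProjDeriv E F G x.1 x.2⟩,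
    OrbitSpace.mk _ (IsotropyQuotient.mk' EG x.1 (A.form x.1 x.2))), rfl⟩

/-! The quotient `(T*Q)/G` and the space `W = T*(Q/G) ×_{Q/G} (⨆_q Ann 𝔤_q)/G`. -/

variable (EG E G Q) in
/-- The orbit space `(T*Q)/G`. -/
abbrev CotangentQuotient : Type _ := OrbitSpace (cotangentAction EG E (G := G) (Q := Q))

variable (EG E G Q) in
/-- The orbit type strata and the smooth functions of `(T*Q)/G`. -/
def cotangentQuotientData : StratData G (CotangentQuotient EG E G Q) where
  stratum := orbitTypeStratum _
  smoothOn := presentedSmoothOn (𝓘(ℝ, E).prod 𝓘(ℝ, E →L[ℝ] ℝ)) (fun z : CotangentBundle E Q => z)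
    (OrbitSpace.mk _)

/-- The projection `(⨆_q Ann 𝔤_q)/G → Q/G`. -/
def annBase : OrbitSpace (annAction EG E G Q) → BaseSpace G Q :=
  Quotient.lift (fun x : AnnBundle EG E G Q => baseProj G x.1.1) (by
    rintro _ b ⟨g, rfl⟩
    exact Quotient.sound ⟨g, rfl⟩)

variable (EG E F G Q) in
/-- The Weinstein space `W = T*(Q/G) ×_{Q/G} (⨆_q Ann 𝔤_q)/G`. -/
abbrev WeinsteinSpace : Type _ :=
  {y : CotangentBundle F (BaseSpace G Q) × OrbitSpace (annAction EG E G Q) // y.1.1 = annBase y.2}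

variable (EG E F G Q) in
/-- The space `𝒲 = (Q ×_{Q/G} T*(Q/G)) ×_Q ⨆_q Ann 𝔤_q` of all `(q, η, λ)` with
`η ∈ T*_{π q}(Q/G)` and `λ ∈ Ann 𝔤_q`, a submanifold of `Q × T*(Q/G) × 𝔤*`. -/
abbrev WeinsteinTotal : Type _ :=
  {w : Q × (CotangentBundle F (BaseSpace G Q) × (LieAlg EG G →L[ℝ] ℝ)) //
    w.2.1.1 = baseProj G w.1 ∧ w.2.2 ∈ isotropyAnn EG E G w.1}

variable (EG E F G Q) in
/-- The action `g.(q, η, λ) = (g q, η, Ad*(g) λ)` on `𝒲`. -/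
abbrev weinsteinAction : MulAction G (WeinsteinTotal EG E F G Q) where
  smul g w := ⟨(g • w.1.1, w.1.2.1, coadjoint EG g w.1.2.2),
    w.2.1.trans (Quotient.sound ⟨g⁻¹, inv_smul_smul g w.1.1⟩), coadjoint_mem EG g w.1.1 w.2.2⟩
  one_smul w := Subtype.ext (Prod.ext (one_smul G w.1.1)
    (Prod.ext rfl (coadjoint_one EG w.1.2.2)))
  mul_smul g h w := Subtype.ext (Prod.ext (mul_smul g h w.1.1)
    (Prod.ext rfl (coadjoint_mul EG g h w.1.2.2)))

/-- The projection `𝒲 → W`, `(q, η, λ) ↦ (η, [(q, λ)])`. -/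
def weinsteinProj (w : WeinsteinTotal EG E F G Q) : WeinsteinSpace EG E F G Q :=
  ⟨(w.1.2.1, OrbitSpace.mk _ ⟨(w.1.1, w.1.2.2), w.2.2⟩), w.2.1⟩

variable (EG E F G Q) in
/-- The orbit type strata and the smooth functions of `𝒲/G`. -/
def weinsteinQuotientData : StratData G (OrbitSpace (weinsteinAction EG E F G Q)) where
  stratum := orbitTypeStratum _
  smoothOn := presentedSmoothOn
    (𝓘(ℝ, E).prod ((𝓘(ℝ, F).prod 𝓘(ℝ, F →L[ℝ] ℝ)).prod 𝓘(ℝ, EG →L[ℝ] ℝ)))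
    (P := WeinsteinTotal EG E F G Q) Subtype.val (OrbitSpace.mk _)

variable (EG E F G Q) in
/-- The strata `T*(Q/G) ×_{Q/G} (⨆_q Ann 𝔤_q)_(L)/G` of `W` and the smooth functions of `W`,
presented by `𝒲`; in particular `C^∞(W) = C^∞(𝒲)^G`. -/
def weinsteinSpaceData : StratData G (WeinsteinSpace EG E F G Q) where
  stratum L := {y | y.1.2 ∈ orbitTypeStratum _ L}
  smoothOn := presentedSmoothOn
    (𝓘(ℝ, E).prod ((𝓘(ℝ, F).prod 𝓘(ℝ, F →L[ℝ] ℝ)).prod 𝓘(ℝ, EG →L[ℝ] ℝ)))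
    (P := WeinsteinTotal EG E F G Q) Subtype.val weinsteinProj

namespace GeneralizedConnection

variable (A : GeneralizedConnection EG E G Q)

variable (F) in
/-- The fibrewise dual `C_q^* : T*_q Q → T*_{π q}(Q/G)` of the horizontal lift. -/
def dualLift (z : CotangentBundle E Q) : CotangentBundle F (BaseSpace G Q) :=
  ⟨baseProj G z.1, ContinuousLinearMap.comp (z.2 : E →L[ℝ] ℝ)
    (A.horizontalLift F z.1 : F →L[ℝ] E)⟩

/-- The isomorphism `ψ : 𝒲 → T*Q`, `(q, η, λ) ↦ (q, (T_q π)^* η + A_q^* λ)`. -/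
def weinsteinIso (w : WeinsteinTotal EG E F G Q) : CotangentBundle E Q :=
  ⟨w.1.1, ContinuousLinearMap.comp (w.1.2.1.2 : F →L[ℝ] ℝ) (baseProjDeriv E F G w.1.1 : E →L[ℝ] F) +
    ContinuousLinearMap.comp (w.1.2.2 : EG →L[ℝ] ℝ) (A.form w.1.1 : E →L[ℝ] EG)⟩

variable (F) in
/-- The map `T*Q → 𝒲`, `(q, p) ↦ (q, C_q^* p, μ(q, p))`, inverse to `ψ`. -/
def weinsteinIsoInv (z : CotangentBundle E Q) : WeinsteinTotal EG E F G Q :=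
  ⟨(z.1, A.dualLift F z, momentum EG z), rfl, momentum_mem EG z⟩

/-- The Poisson bracket on `𝒲` of the symplectic form `σ = ψ^* Ω`. -/
def weinsteinBracket [FiniteDimensional ℝ E] (f h : WeinsteinTotal EG E F G Q → ℝ)
    (w : WeinsteinTotal EG E F G Q) : ℝ :=
  canonicalBracket (f ∘ A.weinsteinIsoInv F) (h ∘ A.weinsteinIsoInv F) (A.weinsteinIso w)

variable (F) in
/-- The point `(C_q^* p, [(q, μ(q, p))]) ∈ W` for `(q, p) ∈ T*Q`. -/
def cotangentPoint (z : CotangentBundle E Q) : WeinsteinSpace EG E F G Q :=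
  ⟨(A.dualLift F z, OrbitSpace.mk _ ⟨(z.1, momentum EG z), momentum_mem EG z⟩), rfl⟩

end GeneralizedConnection
end Weinstein
end

set_option linter.unusedSectionVars false
set_option linter.unusedSimpArgs false
set_option synthInstance.maxHeartbeats 200000

noncomputable section

/-! ### The canonical Poisson structure of `E × E*` -/

section PhaseSpace

/-! Everything rests on a pointwise splitting: v = C_q(Tπ v) + ζ_q(A_q v) for every tangent vector v
(`horMap_projMap_add`). Thus v is the same as Tπ v together with the class of A_q(v) in 𝔤/𝔤_q, and
dually p is the same as the pair (C_q^* p, μ(q, p)). Both decompositions are equivariant, and G acts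
trivially on the components in T(Q/G) and T*(Q/G). Hence corresponding points have equal isotropy
groups, and strata go to strata.

The splitting amounts to ker T_qπ = im ζ_q (`eq_zeta_conn_of_projMap_eq_zero`), and this is where
properness enters. The fibre of π through q is the orbit of q. The orbit map has constant rank, so
the piece {g.q : g near 1} is, in a chart, recovered differentiably from its image under L = A ζ A
(`exists_orbit_factorization`). By properness the orbit has no other points near q
(`exists_mem_nhds_orbit`). Since π is a submersion, a neighbourhood of q retracts differentiably
into the fibre, with a derivative that fixes vertical vectors (`exists_fibre_retraction`).
Differentiating the composite of retraction and recovery shows that each vertical v equals ζ_q(A_q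
v).

The passage to quotients is formal (`exists_homeomorph_of_presentations`): maps between presenting
spaces that extend locally to smooth maps of the ambient manifolds, and are mutually inverse modulo
the presentations, induce a homeomorphism that identifies smooth functions on all subsets. The
required smoothness of C holds because C_q(u) = w - ζ_q(A_q w) for any w over u (`eq_horMap_add`),
and w can be chosen smoothly by differentiating local sections of π.

In canonical coordinates the bracket is given by a constant tensor, and the derivative of a
cotangent lift preserves it because second derivatives are symmetric (`phaseBracket_comp_lift`).
This gives independence of the cotangent chart, hence smoothness and the Jacobi identity, and also
G-invariance, hence descent to (T*Q)/G. The bracket of W is transported along β; it is the one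
induced from 𝒲 because the bracket of 𝒲 is defined through ψ, and ψ induces the inverse of β. -/

theorem two_le_smooth : minSmoothness ℝ 2 ≤ (∞ : WithTop ℕ∞) := by
  rw [minSmoothness_of_isRCLikeNormedField]
  exact ENat.LEInfty.out

variable {E : Type*} [NormedAddCommGroup E] [NormedSpace ℝ E] [FiniteDimensional ℝ E]

/-- The canonical Poisson tensor of `E × E*` on covectors. -/
def poissonForm (α β : E × (E →L[ℝ] ℝ) →L[ℝ] ℝ) : ℝ :=
  ∑ i, (α (Module.finBasis ℝ E i, 0) *
      β (0, LinearMap.toContinuousLinearMap ((Module.finBasis ℝ E).coord i)) -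
    α (0, LinearMap.toContinuousLinearMap ((Module.finBasis ℝ E).coord i)) *
      β (Module.finBasis ℝ E i, 0))

/-- The Hamiltonian vector of a covector of `E × E*`. -/
def hamiltonianVector : (E × (E →L[ℝ] ℝ) →L[ℝ] ℝ) →L[ℝ] E × (E →L[ℝ] ℝ) :=
  LinearMap.toContinuousLinearMap
    { toFun := fun β : E × (E →L[ℝ] ℝ) →L[ℝ] ℝ =>
        (∑ i, β (0, LinearMap.toContinuousLinearMap ((Module.finBasis ℝ E).coord i)) •
            Module.finBasis ℝ E i,
          -β.comp (ContinuousLinearMap.inl ℝ E (E →L[ℝ] ℝ)))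
      map_add' := fun β γ => by
        refine Prod.ext ?_ ?_
        · simp [add_smul, Finset.sum_add_distrib]
        · ext v
          simp [add_comm]
      map_smul' := fun c β => by
        refine Prod.ext ?_ ?_
        · simp [mul_smul, Finset.smul_sum]
        · ext v
          simp }

theorem dual_apply_eq_sum (r : E →L[ℝ] ℝ) :
    r = ∑ i, r (Module.finBasis ℝ E i) •
      LinearMap.toContinuousLinearMap ((Module.finBasis ℝ E).coord i) := by
  ext v
  conv_lhs => rw [← (Module.finBasis ℝ E).sum_repr v, map_sum]
  simp [mul_comm, -Module.Basis.sum_repr]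

theorem apply_hamiltonianVector_fst (β : E × (E →L[ℝ] ℝ) →L[ℝ] ℝ) (r : E →L[ℝ] ℝ) :
    r (hamiltonianVector β).1 = β (0, r) := by
  have h : ((0 : E), r) = ContinuousLinearMap.inr ℝ E (E →L[ℝ] ℝ) r := rfl
  rw [h, ← ContinuousLinearMap.comp_apply]
  conv_rhs => rw [dual_apply_eq_sum r]
  simp [hamiltonianVector, mul_comm]

theorem hamiltonianVector_snd_apply (β : E × (E →L[ℝ] ℝ) →L[ℝ] ℝ) (v : E) :
    (hamiltonianVector β).2 v = -β (v, 0) := by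
  simp [hamiltonianVector]

theorem poissonForm_eq_apply (α β : E × (E →L[ℝ] ℝ) →L[ℝ] ℝ) :
    poissonForm α β = α (hamiltonianVector β) := by
  have h1 : hamiltonianVector β =
      ContinuousLinearMap.inl ℝ E (E →L[ℝ] ℝ) (hamiltonianVector β).1 +
        ContinuousLinearMap.inr ℝ E (E →L[ℝ] ℝ) (hamiltonianVector β).2 := by
    simp
  rw [h1, map_add, ← ContinuousLinearMap.comp_apply α, ← ContinuousLinearMap.comp_apply α,
    dual_apply_eq_sum (hamiltonianVector β).2]
  simp only [hamiltonianVector_snd_apply]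
  simp [hamiltonianVector, poissonForm, Finset.sum_sub_distrib, mul_comm, sub_eq_add_neg,
    Finset.sum_add_distrib]

theorem poissonForm_antisymm (α β : E × (E →L[ℝ] ℝ) →L[ℝ] ℝ) :
    poissonForm α β = -poissonForm β α := by
  simp only [poissonForm, ← Finset.sum_neg_distrib]
  refine Finset.sum_congr rfl fun i _ => ?_
  ring

theorem apply_hamiltonianVector_antisymm (α β : E × (E →L[ℝ] ℝ) →L[ℝ] ℝ) :
    α (hamiltonianVector β) = -β (hamiltonianVector α) := by
  rw [← poissonForm_eq_apply, ← poissonForm_eq_apply, poissonForm_antisymm]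

theorem dual_separates {x y : E} (h : ∀ r : E →L[ℝ] ℝ, r x = r y) : x = y := by
  by_contra hne
  obtain ⟨r, hr⟩ := SeparatingDual.exists_separating_of_ne (R := ℝ) hne
  exact hr (h r)

/-- The derivative of a cotangent lift, as a linear map of phase spaces, preserves the Poisson
tensor. -/
theorem poissonForm_comp_lift {T : E →L[ℝ] E} (hT : Surjective T) {s : E →L[ℝ] E →L[ℝ] ℝ}
    (hs : ∀ u w, s u w = s w u) {D : E × (E →L[ℝ] ℝ) →L[ℝ] E × (E →L[ℝ] ℝ)}
    (h1 : ∀ w r, (D (w, r)).1 = T w) (h2 : ∀ w r u, (D (w, r)).2 (T u) = r u - s w u)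
    (α β : E × (E →L[ℝ] ℝ) →L[ℝ] ℝ) :
    poissonForm (α.comp D) (β.comp D) = poissonForm α β := by
  -- It suffices that D carries the Hamiltonian vector y of β ∘ D to that of β. The first component
  -- is tested with D(0, ρ ∘ T) = (0, ρ); in the second, the two terms in s cancel by symmetry.
  rw [poissonForm_eq_apply, poissonForm_eq_apply]
  set y := hamiltonianVector (β.comp D) with hy
  have e1 : T y.1 = (hamiltonianVector β).1 := by
    refine dual_separates fun ρ => ?_
    have h3 := apply_hamiltonianVector_fst (β.comp D) (ρ.comp T)
    have h4 : D (0, ρ.comp T) = (0, ρ) := by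
      refine Prod.ext ?_ ?_
      · rw [h1, map_zero]
      · ext v
        obtain ⟨u, rfl⟩ := hT v
        rw [h2]
        simp
    rw [ContinuousLinearMap.comp_apply β, h4] at h3
    rw [apply_hamiltonianVector_fst, ← h3]
    rfl
  have e2 : D y = hamiltonianVector β := by
    have h0 : D y = D (y.1, y.2) := rfl
    refine Prod.ext ?_ ?_
    · rw [h0, h1, e1]
    · ext v
      obtain ⟨u, rfl⟩ := hT v
      rw [h0, h2, hy, hamiltonianVector_snd_apply, ← hy, ContinuousLinearMap.comp_apply]
      have h5 : D (u, 0) = (T u, 0) + (0, (D (u, 0)).2) := by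
        refine Prod.ext ?_ ?_ <;> simp [h1]
      rw [h5, map_add, ← apply_hamiltonianVector_fst, ← e1, h2, hamiltonianVector_snd_apply,
        hs u y.1]
      simp
  rw [ContinuousLinearMap.comp_apply, e2]

/-- The canonical Poisson bracket of functions on `E × E*`. -/
def phaseBracket (f h : E × (E →L[ℝ] ℝ) → ℝ) (x : E × (E →L[ℝ] ℝ)) : ℝ :=
  poissonForm (fderiv ℝ f x) (fderiv ℝ h x)

theorem ContDiffAt.phaseBracket {f h : E × (E →L[ℝ] ℝ) → ℝ} {x : E × (E →L[ℝ] ℝ)}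
    (hf : ContDiffAt ℝ ∞ f x) (hh : ContDiffAt ℝ ∞ h x) :
    ContDiffAt ℝ ∞ (phaseBracket f h) x := by
  have e : _root_.phaseBracket f h = fun y => fderiv ℝ f y (hamiltonianVector (fderiv ℝ h y)) := by
    funext y
    exact poissonForm_eq_apply _ _
  rw [e]
  have hf' : ContDiffAt ℝ ∞ (fderiv ℝ f) x := hf.fderiv_right (by simp)
  have hh' : ContDiffAt ℝ ∞ (fderiv ℝ h) x := hh.fderiv_right (by simp)
  have hv : ContDiff ℝ ∞ (hamiltonianVector (E := E)) := by fun_prop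
  exact hf'.clm_apply (hv.contDiffAt.comp x hh')

/-- The derivative of dg(X_h) along X_f has two terms; by antisymmetry the one that differentiates
dh becomes a Hessian of h on (X_f, X_g). Only Hessians survive, so the Jacobi sum cancels in pairs.
-/
theorem phaseBracket_phaseBracket {f g h : E × (E →L[ℝ] ℝ) → ℝ} {x : E × (E →L[ℝ] ℝ)}
    (hg : ContDiffAt ℝ ∞ g x) (hh : ContDiffAt ℝ ∞ h x) :
    phaseBracket f (phaseBracket g h) x =
      fderiv ℝ (fderiv ℝ h) x (hamiltonianVector (fderiv ℝ f x))
          (hamiltonianVector (fderiv ℝ g x)) -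
        fderiv ℝ (fderiv ℝ g) x (hamiltonianVector (fderiv ℝ f x))
          (hamiltonianVector (fderiv ℝ h x)) := by
  have e : phaseBracket g h = fun y => fderiv ℝ g y (hamiltonianVector (fderiv ℝ h y)) := by
    funext y
    exact poissonForm_eq_apply _ _
  have hg' : ContDiffAt ℝ ∞ (fderiv ℝ g) x := hg.fderiv_right (by simp)
  have hh' : ContDiffAt ℝ ∞ (fderiv ℝ h) x := hh.fderiv_right (by simp)
  have dg : HasFDerivAt (fderiv ℝ g) _ x := (hg'.differentiableAt (by simp)).hasFDerivAt
  have dh : HasFDerivAt (fderiv ℝ h) _ x := (hh'.differentiableAt (by simp)).hasFDerivAt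
  have key := dg.clm_apply (hamiltonianVector.hasFDerivAt.comp x dh)
  rw [_root_.phaseBracket, e, poissonForm_antisymm, poissonForm_eq_apply]
  have key' := key.fderiv
  simp only [Function.comp_apply] at key'
  rw [key']
  simp only [add_apply, ContinuousLinearMap.comp_apply,
    ContinuousLinearMap.flip_apply]
  rw [apply_hamiltonianVector_antisymm (fderiv ℝ g x)]
  ring

theorem phaseBracket_jacobi {f g h : E × (E →L[ℝ] ℝ) → ℝ} {x : E × (E →L[ℝ] ℝ)}
    (hf : ContDiffAt ℝ ∞ f x) (hg : ContDiffAt ℝ ∞ g x) (hh : ContDiffAt ℝ ∞ h x) :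
    phaseBracket f (phaseBracket g h) x + phaseBracket g (phaseBracket h f) x +
      phaseBracket h (phaseBracket f g) x = 0 := by
  have sf := (hf.isSymmSndFDerivAt two_le_smooth)
  have sg := (hg.isSymmSndFDerivAt two_le_smooth)
  have sh := (hh.isSymmSndFDerivAt two_le_smooth)
  rw [phaseBracket_phaseBracket hg hh, phaseBracket_phaseBracket hh hf,
    phaseBracket_phaseBracket hf hg,
    sf.eq (hamiltonianVector (fderiv ℝ g x)) (hamiltonianVector (fderiv ℝ h x)),
    sg.eq (hamiltonianVector (fderiv ℝ f x)) (hamiltonianVector (fderiv ℝ h x)),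
    sh.eq (hamiltonianVector (fderiv ℝ f x)) (hamiltonianVector (fderiv ℝ g x))]
  ring

/-- The coordinate expression of a cotangent lift preserves the bracket. -/
theorem phaseBracket_comp_lift {τ : E → E} {Φ : E × (E →L[ℝ] ℝ) → E × (E →L[ℝ] ℝ)}
    {x : E × (E →L[ℝ] ℝ)} (hτ : ContDiffAt ℝ ∞ τ x.1) (hT : Surjective (fderiv ℝ τ x.1))
    (hΦ : DifferentiableAt ℝ Φ x)
    (h1 : ∀ᶠ y in nhds x, (Φ y).1 = τ y.1)
    (h2 : ∀ᶠ y in nhds x, (Φ y).2.comp (fderiv ℝ τ y.1) = y.2)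
    {f h : E × (E →L[ℝ] ℝ) → ℝ} (hf : DifferentiableAt ℝ f (Φ x))
    (hh : DifferentiableAt ℝ h (Φ x)) :
    phaseBracket (f ∘ Φ) (h ∘ Φ) x = phaseBracket f h (Φ x) := by
  have hτ' : ContDiffAt ℝ ∞ (fderiv ℝ τ) x.1 := hτ.fderiv_right (by simp)
  have d2 : HasFDerivAt (fderiv ℝ τ) _ x.1 := (hτ'.differentiableAt (by simp)).hasFDerivAt
  have d1 : HasFDerivAt τ _ x.1 := (hτ.differentiableAt (by simp)).hasFDerivAt
  have sym := hτ.isSymmSndFDerivAt two_le_smooth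
  have dΦ := hΦ.hasFDerivAt
  have hfst : HasFDerivAt (fun y : E × (E →L[ℝ] ℝ) => y.1)
    (ContinuousLinearMap.fst ℝ E (E →L[ℝ] ℝ)) x := hasFDerivAt_fst
  have hsnd : HasFDerivAt (fun y : E × (E →L[ℝ] ℝ) => y.2)
    (ContinuousLinearMap.snd ℝ E (E →L[ℝ] ℝ)) x := hasFDerivAt_snd
  have D1 : (ContinuousLinearMap.fst ℝ E (E →L[ℝ] ℝ)).comp (fderiv ℝ Φ x) =
      (fderiv ℝ τ x.1).comp (ContinuousLinearMap.fst ℝ E (E →L[ℝ] ℝ)) :=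
    (dΦ.fst.congr_of_eventuallyEq (h1.mono fun y hy => hy.symm)).unique (d1.comp x hfst)
  -- Differentiating p' ∘ dτ = p determines the fibre part of dΦ up to the term p' ∘ d²τ. This term
  -- is s below, and it is symmetric because d²τ is.
  have D2 := ((dΦ.snd.clm_comp (d2.comp x hfst)).congr_of_eventuallyEq
    (h2.mono fun y hy => hy.symm)).unique hsnd
  set s : E →L[ℝ] E →L[ℝ] ℝ :=
    (ContinuousLinearMap.compL ℝ E E ℝ (Φ x).2).comp (fderiv ℝ (fderiv ℝ τ) x.1) with hsdef
  have key := poissonForm_comp_lift (D := fderiv ℝ Φ x) hT (s := s)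
    (fun u w => by simp [hsdef, sym.eq u w])
    (fun w r => by simpa using congrArg (fun L => L (w, r)) D1)
    (fun w r u => by
      have := congrArg (fun L => L (w, r) u) D2
      simp at this
      simp only [hsdef, ContinuousLinearMap.comp_apply, ContinuousLinearMap.compL_apply]
      linarith) (fderiv ℝ f (Φ x)) (fderiv ℝ h (Φ x))
  rw [_root_.phaseBracket, fderiv_comp x hf hΦ, fderiv_comp x hh hΦ, key, _root_.phaseBracket]

theorem phaseBracket_congr {f f' h h' : E × (E →L[ℝ] ℝ) → ℝ} {x : E × (E →L[ℝ] ℝ)}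
    (hf : f =ᶠ[nhds x] f') (hh : h =ᶠ[nhds x] h') :
    phaseBracket f h x = phaseBracket f' h' x := by
  rw [phaseBracket, phaseBracket, hf.fderiv_eq, hh.fderiv_eq]

end PhaseSpace

/-! ### The canonical bracket in cotangent charts -/

section CotangentCharts

variable {E : Type*} [NormedAddCommGroup E] [NormedSpace ℝ E]
  {Q : Type*} [TopologicalSpace Q] [ChartedSpace E Q]
  {E' : Type*} [NormedAddCommGroup E'] [NormedSpace ℝ E']
  {Q' : Type*} [TopologicalSpace Q'] [ChartedSpace E' Q']

/-- All tangent spaces are copies of the model space. With derivatives stated as maps of model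
spaces, the linear map, or the base point, can be replaced by an equal one without casts between
fibres. -/
theorem HasMFDerivAt.congr_clm {f : Q → Q'} {q : Q} {L L' : E →L[ℝ] E'}
    (hd : HasMFDerivAt 𝓘(ℝ, E) 𝓘(ℝ, E') f q L) (h : L = L') :
    HasMFDerivAt 𝓘(ℝ, E) 𝓘(ℝ, E') f q L' :=
  h ▸ hd

theorem HasMFDerivWithinAt.congr_clm {f : Q → Q'} {s : Set Q} {q : Q} {L L' : E →L[ℝ] E'}
    (hd : HasMFDerivWithinAt 𝓘(ℝ, E) 𝓘(ℝ, E') f s q L) (h : L = L') :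
    HasMFDerivWithinAt 𝓘(ℝ, E) 𝓘(ℝ, E') f s q L' :=
  h ▸ hd

theorem HasMFDerivAt.congr_point {f : Q → Q'} {q q' : Q} {L : E →L[ℝ] E'}
    (hd : HasMFDerivAt 𝓘(ℝ, E) 𝓘(ℝ, E') f q L) (h : q = q') :
    HasMFDerivAt 𝓘(ℝ, E) 𝓘(ℝ, E') f q' L := by
  subst h
  exact hd

variable [IsManifold 𝓘(ℝ, E) ∞ Q] [IsManifold 𝓘(ℝ, E') ∞ Q']

theorem hasMFDerivAt_extChartAt_symm {q q₁ : Q} (h1 : q ∈ (chartAt E q₁).source) :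
    HasMFDerivAt 𝓘(ℝ, E) 𝓘(ℝ, E) (extChartAt 𝓘(ℝ, E) q₁).symm (extChartAt 𝓘(ℝ, E) q₁ q)
      ((trivializationAt E (TangentSpace 𝓘(ℝ, E)) q₁).symmL ℝ q : E →L[ℝ] E) := by
  have hq1 : q ∈ (extChartAt 𝓘(ℝ, E) q₁).source := by rwa [extChartAt_source]
  have d1 := (mdifferentiableWithinAt_extChartAt_symm (I := 𝓘(ℝ, E))
    ((extChartAt 𝓘(ℝ, E) q₁).map_source hq1)).hasMFDerivWithinAt
  have hr : range 𝓘(ℝ, E) = univ := ModelWithCorners.range_eq_univ _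
  have d1' := HasMFDerivWithinAt.congr_clm d1 (TangentBundle.symmL_trivializationAt h1).symm
  exact hasMFDerivWithinAt_univ.1 (d1'.mono (by rw [hr]))

theorem hasMFDerivAt_extChartAt' {q q₁ : Q} (h1 : q ∈ (chartAt E q₁).source) :
    HasMFDerivAt 𝓘(ℝ, E) 𝓘(ℝ, E) (extChartAt 𝓘(ℝ, E) q₁) q
      ((trivializationAt E (TangentSpace 𝓘(ℝ, E)) q₁).continuousLinearMapAt ℝ q : E →L[ℝ] E) :=
  HasMFDerivAt.congr_clm (mdifferentiableAt_extChartAt (I := 𝓘(ℝ, E)) h1).hasMFDerivAt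
    (TangentBundle.continuousLinearMapAt_trivializationAt h1).symm

/-- A tangent map in charts. -/
theorem hasFDerivAt_writtenInCharts {θ : Q → Q'} {q q₁ : Q} {q₂ : Q'}
    (hθ : MDifferentiableAt 𝓘(ℝ, E) 𝓘(ℝ, E') θ q)
    (h1 : q ∈ (chartAt E q₁).source) (h2 : θ q ∈ (chartAt E' q₂).source) :
    HasFDerivAt (extChartAt 𝓘(ℝ, E') q₂ ∘ θ ∘ (extChartAt 𝓘(ℝ, E) q₁).symm)
      (((trivializationAt E' (TangentSpace 𝓘(ℝ, E')) q₂).continuousLinearMapAt ℝ (θ q) :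
        E' →L[ℝ] E').comp ((mfderiv 𝓘(ℝ, E) 𝓘(ℝ, E') θ q : E →L[ℝ] E').comp
          ((trivializationAt E (TangentSpace 𝓘(ℝ, E)) q₁).symmL ℝ q : E →L[ℝ] E)))
        (extChartAt 𝓘(ℝ, E) q₁ q) := by
  have hq1 : q ∈ (extChartAt 𝓘(ℝ, E) q₁).source := by rwa [extChartAt_source]
  have e1 : (extChartAt 𝓘(ℝ, E) q₁).symm (extChartAt 𝓘(ℝ, E) q₁ q) = q :=
    (extChartAt 𝓘(ℝ, E) q₁).left_inv hq1
  have d1 := hasMFDerivAt_extChartAt_symm h1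
  have d2 := HasMFDerivAt.congr_point hθ.hasMFDerivAt e1.symm
  have d3 := HasMFDerivAt.congr_point (hasMFDerivAt_extChartAt' h2) (congrArg θ e1.symm)
  exact hasMFDerivAt_iff_hasFDerivAt.1 (HasMFDerivAt.comp _ d3 (HasMFDerivAt.comp _ d2 d1))

/-- A canonical chart of `T*Q`, as a map to the phase space. -/
abbrev phaseChart (z : CotangentBundle E Q) :
    PartialEquiv (CotangentBundle E Q) (E × (E →L[ℝ] ℝ)) :=
  extChartAt (𝓘(ℝ, E).prod 𝓘(ℝ, E →L[ℝ] ℝ)) z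

theorem phaseChart_source_eq (z : CotangentBundle E Q) :
    (phaseChart z).source = (chartAt (ModelProd E (E →L[ℝ] ℝ)) z).source :=
  extChartAt_source _ _

theorem mem_phaseChart_source {z y : CotangentBundle E Q} :
    y ∈ (phaseChart z).source ↔ y.1 ∈ (chartAt E z.1).source := by
  rw [phaseChart_source_eq, FiberBundle.chartedSpace_chartAt]
  simp only [hom_trivializationAt_source, mfld_simps]
  exact ⟨fun h => h.1.1, fun h => ⟨⟨h, trivial⟩, h⟩⟩

theorem contDiffAt_comp_phaseChart_symm {f : CotangentBundle E Q → ℝ} {z z₀ : CotangentBundle E Q}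
    (hf : ContMDiffAt (𝓘(ℝ, E).prod 𝓘(ℝ, E →L[ℝ] ℝ)) 𝓘(ℝ, ℝ) ∞ f z)
    (hz : z ∈ (phaseChart z₀).source) :
    ContDiffAt ℝ ∞ (f ∘ (phaseChart z₀).symm) (phaseChart z₀ z) := by
  rw [phaseChart_source_eq] at hz
  have h := ((contMDiffAt_iff_of_mem_source (y := f z) hz (mem_chart_source _ _)).1 hf).2
  rw [ModelWithCorners.range_eq_univ, contDiffWithinAt_univ] at h
  exact h

theorem phaseChart_symm_eventually {z z₀ : CotangentBundle E Q} {P : CotangentBundle E Q → Prop}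
    (hz : z ∈ (phaseChart z₀).source) (hP : ∀ᶠ y in nhds z, P y) :
    ∀ᶠ x in nhds (phaseChart z₀ z), P ((phaseChart z₀).symm x) ∧ x ∈ (phaseChart z₀).target := by
  refine Filter.Eventually.and ?_ ?_
  · have h := continuousAt_extChartAt_symm'' (I := 𝓘(ℝ, E).prod 𝓘(ℝ, E →L[ℝ] ℝ))
      ((phaseChart z₀).map_source hz)
    refine h.eventually ?_
    rwa [(phaseChart z₀).left_inv hz]
  · exact extChartAt_target_mem_nhds' ((phaseChart z₀).map_source hz)

variable [FiniteDimensional ℝ E]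

theorem phaseChart_apply (z y : CotangentBundle E Q) :
    phaseChart z y = (extChartAt 𝓘(ℝ, E) z.1 y.1, ContinuousLinearMap.comp (y.2 : E →L[ℝ] ℝ)
      ((trivializationAt E (TangentSpace 𝓘(ℝ, E)) z.1).symmL ℝ y.1 : E →L[ℝ] E)) :=
  cotangent_chart z y

theorem canonicalBracket_eq_phaseBracket_self {f h : CotangentBundle E Q → ℝ}
    {z : CotangentBundle E Q}
    (hf : ContMDiffAt (𝓘(ℝ, E).prod 𝓘(ℝ, E →L[ℝ] ℝ)) 𝓘(ℝ, ℝ) ∞ f z)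
    (hh : ContMDiffAt (𝓘(ℝ, E).prod 𝓘(ℝ, E →L[ℝ] ℝ)) 𝓘(ℝ, ℝ) ∞ h z) :
    canonicalBracket f h z =
      phaseBracket (f ∘ (phaseChart z).symm) (h ∘ (phaseChart z).symm) (phaseChart z z) := by
  have key : ∀ f : CotangentBundle E Q → ℝ,
      ContMDiffAt (𝓘(ℝ, E).prod 𝓘(ℝ, E →L[ℝ] ℝ)) 𝓘(ℝ, ℝ) ∞ f z →
      (mfderiv (𝓘(ℝ, E).prod 𝓘(ℝ, E →L[ℝ] ℝ)) 𝓘(ℝ, ℝ) f z : E × (E →L[ℝ] ℝ) →L[ℝ] ℝ) =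
        fderiv ℝ (f ∘ (phaseChart z).symm) (phaseChart z z) := by
    intro f hf
    have hd : MDifferentiableAt (𝓘(ℝ, E).prod 𝓘(ℝ, E →L[ℝ] ℝ)) 𝓘(ℝ, ℝ) f z :=
      hf.mdifferentiableAt (by simp)
    have h1 := hd.mfderiv
    rw [ModelWithCorners.range_eq_univ, fderivWithin_univ] at h1
    exact h1
  change poissonForm _ _ = poissonForm _ _
  exact congrArg₂ poissonForm (key f hf) (key h hh)

/-- The canonical brackets in two cotangent charts correspond under the cotangent lift of a map. -/
theorem phaseBracket_cotangentLift {θ : Q → Q} {Φ : CotangentBundle E Q → CotangentBundle E Q}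
    (hθ : ContMDiff 𝓘(ℝ, E) 𝓘(ℝ, E) ∞ θ)
    (hsurj : ∀ q, Surjective (mfderiv 𝓘(ℝ, E) 𝓘(ℝ, E) θ q : E →L[ℝ] E))
    (hΦ : ContMDiff (𝓘(ℝ, E).prod 𝓘(ℝ, E →L[ℝ] ℝ)) (𝓘(ℝ, E).prod 𝓘(ℝ, E →L[ℝ] ℝ)) ∞ Φ)
    (hbase : ∀ z, (Φ z).1 = θ z.1)
    (hfib : ∀ z, ContinuousLinearMap.comp ((Φ z).2 : E →L[ℝ] ℝ)
      (mfderiv 𝓘(ℝ, E) 𝓘(ℝ, E) θ z.1 : E →L[ℝ] E) = (z.2 : E →L[ℝ] ℝ))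
    {z z₁ z₂ : CotangentBundle E Q} (h1 : z ∈ (phaseChart z₁).source)
    (h2 : Φ z ∈ (phaseChart z₂).source) {f h : CotangentBundle E Q → ℝ}
    (hf : ContMDiffAt (𝓘(ℝ, E).prod 𝓘(ℝ, E →L[ℝ] ℝ)) 𝓘(ℝ, ℝ) ∞ f (Φ z))
    (hh : ContMDiffAt (𝓘(ℝ, E).prod 𝓘(ℝ, E →L[ℝ] ℝ)) 𝓘(ℝ, ℝ) ∞ h (Φ z)) :
    phaseBracket (f ∘ Φ ∘ (phaseChart z₁).symm) (h ∘ Φ ∘ (phaseChart z₁).symm)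
        (phaseChart z₁ z) =
      phaseBracket (f ∘ (phaseChart z₂).symm) (h ∘ (phaseChart z₂).symm)
        (phaseChart z₂ (Φ z)) := by
  have i1 := h1
  have i2 := h2
  rw [mem_phaseChart_source] at i1 i2
  rw [hbase] at i2
  set τ : E → E := extChartAt 𝓘(ℝ, E) z₂.1 ∘ θ ∘ (extChartAt 𝓘(ℝ, E) z₁.1).symm with hτdef
  set Ψ : E × (E →L[ℝ] ℝ) → E × (E →L[ℝ] ℝ) := phaseChart z₂ ∘ Φ ∘ (phaseChart z₁).symm with hΨdef
  have e0 : (phaseChart z₁).symm (phaseChart z₁ z) = z := (phaseChart z₁).left_inv h1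
  have eΨ : Ψ (phaseChart z₁ z) = phaseChart z₂ (Φ z) := by
    rw [hΨdef, comp_apply, comp_apply, e0]
  have hx1 : (phaseChart z₁ z).1 = extChartAt 𝓘(ℝ, E) z₁.1 z.1 :=
    congrArg Prod.fst (phaseChart_apply z₁ z)
  have hτ : ContDiffAt ℝ ∞ τ (phaseChart z₁ z).1 := by
    have h := ((contMDiffAt_iff_of_mem_source i1 i2).1 (hθ z.1)).2
    rw [ModelWithCorners.range_eq_univ, contDiffWithinAt_univ] at h
    rw [hx1]
    exact h
  have hsrc : ∀ᶠ x in nhds (phaseChart z₁ z),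
      Φ ((phaseChart z₁).symm x) ∈ (phaseChart z₂).source ∧ x ∈ (phaseChart z₁).target :=
    phaseChart_symm_eventually h1 (hΦ.continuous.continuousAt.eventually
      ((isOpen_extChartAt_source z₂).mem_nhds h2))
  have hT : Surjective (fderiv ℝ τ (phaseChart z₁ z).1) := by
    have h := hasFDerivAt_writtenInCharts ((hθ.mdifferentiable (by simp)) z.1) i1 i2
    rw [hx1, h.fderiv]
    have s1 : Surjective ((trivializationAt E (TangentSpace 𝓘(ℝ, E)) z₁.1).symmL ℝ z.1 :
        E →L[ℝ] E) := fun y =>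
      ⟨_, (trivializationAt E (TangentSpace 𝓘(ℝ, E)) z₁.1).symmL_continuousLinearMapAt i1 y⟩
    have s2 : Surjective ((trivializationAt E (TangentSpace 𝓘(ℝ, E)) z₂.1).continuousLinearMapAt ℝ
        (θ z.1) : E →L[ℝ] E) := fun y =>
      ⟨_, (trivializationAt E (TangentSpace 𝓘(ℝ, E)) z₂.1).continuousLinearMapAt_symmL i2 y⟩
    exact s2.comp ((hsurj z.1).comp s1)
  have hΨ : DifferentiableAt ℝ Ψ (phaseChart z₁ z) := by
    have j1 := h1
    have j2 := h2
    rw [phaseChart_source_eq] at j1 j2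
    have h := ((contMDiffAt_iff_of_mem_source j1 j2).1 (hΦ z)).2
    rw [ModelWithCorners.range_eq_univ, contDiffWithinAt_univ] at h
    exact h.differentiableAt (by simp)
  have k1 : ∀ᶠ y in nhds (phaseChart z₁ z), (Ψ y).1 = τ y.1 := by
    filter_upwards [hsrc] with y hy
    have e1 : y.1 = extChartAt 𝓘(ℝ, E) z₁.1 ((phaseChart z₁).symm y).1 := by
      conv_lhs => rw [← (phaseChart z₁).right_inv hy.2]
      rw [phaseChart_apply]
    have m1 := (phaseChart z₁).map_target hy.2
    rw [mem_phaseChart_source, ← extChartAt_source 𝓘(ℝ, E)] at m1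
    rw [hΨdef, comp_apply, comp_apply, phaseChart_apply, hτdef, comp_apply, comp_apply, e1,
      (extChartAt 𝓘(ℝ, E) z₁.1).left_inv m1]
    simp only [hbase]
  -- In coordinates, the trivialization at `z₂` entering dτ cancels against its inverse entering the
  -- covector of Φ w; what remains is `hfib` composed with the trivialization at `z₁`.
  have k2 : ∀ᶠ y in nhds (phaseChart z₁ z), (Ψ y).2.comp (fderiv ℝ τ y.1) = y.2 := by
    filter_upwards [hsrc] with y hy
    obtain ⟨w, hw⟩ : ∃ w, w = (phaseChart z₁).symm y := ⟨_, rfl⟩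
    have m1 : w.1 ∈ (chartAt E z₁.1).source := by
      rw [← mem_phaseChart_source, hw]
      exact (phaseChart z₁).map_target hy.2
    have m2 : θ w.1 ∈ (chartAt E z₂.1).source := by
      rw [← hbase, ← mem_phaseChart_source, hw]
      exact hy.1
    have e2 : y = phaseChart z₁ w := by rw [hw, (phaseChart z₁).right_inv hy.2]
    have e3 : Ψ y = phaseChart z₂ (Φ w) := by rw [hw]; rfl
    have D := (hasFDerivAt_writtenInCharts ((hθ.mdifferentiable (by simp)) w.1) m1 m2).fderiv
    rw [e3, e2, phaseChart_apply, phaseChart_apply]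
    change _ ∘SL fderiv ℝ τ (extChartAt 𝓘(ℝ, E) z₁.1 w.1) = _
    rw [hτdef, D, ← hfib w]
    simp only [hbase]
    ext v
    have key : ∀ x, x = θ w.1 → ∀ u : E,
        ((trivializationAt E (TangentSpace 𝓘(ℝ, E)) z₂.1).symmL ℝ x : E →L[ℝ] E)
          (((trivializationAt E (TangentSpace 𝓘(ℝ, E)) z₂.1).continuousLinearMapAt ℝ (θ w.1) :
            E →L[ℝ] E) u) = u := by
      rintro _ rfl u
      exact (trivializationAt E (TangentSpace 𝓘(ℝ, E)) z₂.1).symmL_continuousLinearMapAt (R := ℝ)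
        m2 _
    exact congrArg (fun x : E => ((Φ w).2 : E →L[ℝ] ℝ) x) (key _ (hbase w) _)
  have c2 : ∀ g : CotangentBundle E Q → ℝ,
      (g ∘ (phaseChart z₂).symm) ∘ Ψ =ᶠ[nhds (phaseChart z₁ z)]
        g ∘ Φ ∘ (phaseChart z₁).symm := by
    intro g
    filter_upwards [hsrc] with y hy
    simp only [hΨdef, comp_apply, (phaseChart z₂).left_inv hy.1]
  rw [← phaseBracket_congr (c2 f) (c2 h), ← eΨ]
  refine phaseBracket_comp_lift hτ hT hΨ k1 k2 ?_ ?_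
  · rw [eΨ]
    exact (contDiffAt_comp_phaseChart_symm hf h2).differentiableAt (by simp)
  · rw [eΨ]
    exact (contDiffAt_comp_phaseChart_symm hh h2).differentiableAt (by simp)

/-- The identity of T*Q is the cotangent lift of the identity of Q, so all cotangent charts give the
same bracket. The definition uses a different chart at each point; a fixed chart is needed in order
to differentiate the bracket. -/
theorem canonicalBracket_eq_phaseBracket {f h : CotangentBundle E Q → ℝ}
    {z z₀ : CotangentBundle E Q} (hz : z ∈ (phaseChart z₀).source)
    (hf : ContMDiffAt (𝓘(ℝ, E).prod 𝓘(ℝ, E →L[ℝ] ℝ)) 𝓘(ℝ, ℝ) ∞ f z)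
    (hh : ContMDiffAt (𝓘(ℝ, E).prod 𝓘(ℝ, E →L[ℝ] ℝ)) 𝓘(ℝ, ℝ) ∞ h z) :
    canonicalBracket f h z =
      phaseBracket (f ∘ (phaseChart z₀).symm) (h ∘ (phaseChart z₀).symm) (phaseChart z₀ z) := by
  have hid : ∀ q : Q, (mfderiv 𝓘(ℝ, E) 𝓘(ℝ, E) (id : Q → Q) q : E →L[ℝ] E) =
    ContinuousLinearMap.id ℝ E := fun q => mfderiv_id
  rw [canonicalBracket_eq_phaseBracket_self hf hh]
  exact phaseBracket_cotangentLift (θ := id) (Φ := id) contMDiff_id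
    (fun q => by rw [hid]; exact surjective_id) contMDiff_id (fun _ => rfl)
    (fun z => by rw [hid]; rfl) (mem_extChartAt_source z) hz hf hh

/-- The canonical bracket is invariant under cotangent lifts. -/
theorem canonicalBracket_cotangentLift {θ : Q → Q} {Φ : CotangentBundle E Q → CotangentBundle E Q}
    (hθ : ContMDiff 𝓘(ℝ, E) 𝓘(ℝ, E) ∞ θ)
    (hsurj : ∀ q, Surjective (mfderiv 𝓘(ℝ, E) 𝓘(ℝ, E) θ q : E →L[ℝ] E))
    (hΦ : ContMDiff (𝓘(ℝ, E).prod 𝓘(ℝ, E →L[ℝ] ℝ)) (𝓘(ℝ, E).prod 𝓘(ℝ, E →L[ℝ] ℝ)) ∞ Φ)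
    (hbase : ∀ z, (Φ z).1 = θ z.1)
    (hfib : ∀ z, ContinuousLinearMap.comp ((Φ z).2 : E →L[ℝ] ℝ)
      (mfderiv 𝓘(ℝ, E) 𝓘(ℝ, E) θ z.1 : E →L[ℝ] E) = (z.2 : E →L[ℝ] ℝ))
    {f h : CotangentBundle E Q → ℝ}
    (hf : ContMDiff (𝓘(ℝ, E).prod 𝓘(ℝ, E →L[ℝ] ℝ)) 𝓘(ℝ, ℝ) ∞ f)
    (hh : ContMDiff (𝓘(ℝ, E).prod 𝓘(ℝ, E →L[ℝ] ℝ)) 𝓘(ℝ, ℝ) ∞ h) (z : CotangentBundle E Q) :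
    canonicalBracket (f ∘ Φ) (h ∘ Φ) z = canonicalBracket f h (Φ z) := by
  rw [canonicalBracket_eq_phaseBracket_self (hf.comp hΦ z) (hh.comp hΦ z),
    canonicalBracket_eq_phaseBracket_self (hf (Φ z)) (hh (Φ z))]
  exact phaseBracket_cotangentLift hθ hsurj hΦ hbase hfib (mem_extChartAt_source z)
    (mem_extChartAt_source (Φ z)) (hf _) (hh _)

theorem canonicalBracket_comp_symm_eventuallyEq {f h : CotangentBundle E Q → ℝ}
    (hf : ContMDiff (𝓘(ℝ, E).prod 𝓘(ℝ, E →L[ℝ] ℝ)) 𝓘(ℝ, ℝ) ∞ f)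
    (hh : ContMDiff (𝓘(ℝ, E).prod 𝓘(ℝ, E →L[ℝ] ℝ)) 𝓘(ℝ, ℝ) ∞ h) (z : CotangentBundle E Q) :
    canonicalBracket f h ∘ (phaseChart z).symm =ᶠ[nhds (phaseChart z z)]
      phaseBracket (f ∘ (phaseChart z).symm) (h ∘ (phaseChart z).symm) := by
  filter_upwards [extChartAt_target_mem_nhds z] with x hx
  rw [comp_apply, canonicalBracket_eq_phaseBracket ((phaseChart z).map_target hx) (hf _) (hh _),
    (phaseChart z).right_inv hx]

theorem ContMDiff.canonicalBracket {f h : CotangentBundle E Q → ℝ}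
    (hf : ContMDiff (𝓘(ℝ, E).prod 𝓘(ℝ, E →L[ℝ] ℝ)) 𝓘(ℝ, ℝ) ∞ f)
    (hh : ContMDiff (𝓘(ℝ, E).prod 𝓘(ℝ, E →L[ℝ] ℝ)) 𝓘(ℝ, ℝ) ∞ h) :
    ContMDiff (𝓘(ℝ, E).prod 𝓘(ℝ, E →L[ℝ] ℝ)) 𝓘(ℝ, ℝ) ∞ (canonicalBracket f h) := by
  intro z
  have hz := mem_extChartAt_source (I := 𝓘(ℝ, E).prod 𝓘(ℝ, E →L[ℝ] ℝ)) z
  have h1 : ContDiffAt ℝ ∞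
      (phaseBracket (f ∘ (phaseChart z).symm) (h ∘ (phaseChart z).symm)) (phaseChart z z) :=
    (contDiffAt_comp_phaseChart_symm (hf z) hz).phaseBracket
      (contDiffAt_comp_phaseChart_symm (hh z) hz)
  have h2 : ContMDiffAt (𝓘(ℝ, E).prod 𝓘(ℝ, E →L[ℝ] ℝ)) 𝓘(ℝ, E × (E →L[ℝ] ℝ)) ∞
      (phaseChart z) z := contMDiffAt_extChartAt
  refine (h1.contMDiffAt.comp z h2).congr_of_eventuallyEq ?_
  filter_upwards [(isOpen_extChartAt_source (I := 𝓘(ℝ, E).prod 𝓘(ℝ, E →L[ℝ] ℝ)) z).mem_nhds hz]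
    with y hy
  exact canonicalBracket_eq_phaseBracket hy (hf y) (hh y)

theorem canonicalBracket_jacobi {f g h : CotangentBundle E Q → ℝ}
    (hf : ContMDiff (𝓘(ℝ, E).prod 𝓘(ℝ, E →L[ℝ] ℝ)) 𝓘(ℝ, ℝ) ∞ f)
    (hg : ContMDiff (𝓘(ℝ, E).prod 𝓘(ℝ, E →L[ℝ] ℝ)) 𝓘(ℝ, ℝ) ∞ g)
    (hh : ContMDiff (𝓘(ℝ, E).prod 𝓘(ℝ, E →L[ℝ] ℝ)) 𝓘(ℝ, ℝ) ∞ h) (z : CotangentBundle E Q) :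
    canonicalBracket f (canonicalBracket g h) z + canonicalBracket g (canonicalBracket h f) z +
      canonicalBracket h (canonicalBracket f g) z = 0 := by
  have hz := mem_extChartAt_source (I := 𝓘(ℝ, E).prod 𝓘(ℝ, E →L[ℝ] ℝ)) z
  have key : ∀ f g h : CotangentBundle E Q → ℝ,
      ContMDiff (𝓘(ℝ, E).prod 𝓘(ℝ, E →L[ℝ] ℝ)) 𝓘(ℝ, ℝ) ∞ f →
      ContMDiff (𝓘(ℝ, E).prod 𝓘(ℝ, E →L[ℝ] ℝ)) 𝓘(ℝ, ℝ) ∞ g →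
      ContMDiff (𝓘(ℝ, E).prod 𝓘(ℝ, E →L[ℝ] ℝ)) 𝓘(ℝ, ℝ) ∞ h →
      canonicalBracket f (canonicalBracket g h) z =
        phaseBracket (f ∘ (phaseChart z).symm)
          (phaseBracket (g ∘ (phaseChart z).symm) (h ∘ (phaseChart z).symm)) (phaseChart z z) := by
    intro f g h hf hg hh
    rw [canonicalBracket_eq_phaseBracket_self (hf z) (hg.canonicalBracket hh z)]
    exact phaseBracket_congr Filter.EventuallyEq.rfl
      (canonicalBracket_comp_symm_eventuallyEq hg hh z)
  rw [key f g h hf hg hh, key g h f hg hh hf, key h f g hh hf hg]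
  exact phaseBracket_jacobi (contDiffAt_comp_phaseChart_symm (hf z) hz)
    (contDiffAt_comp_phaseChart_symm (hg z) hz) (contDiffAt_comp_phaseChart_symm (hh z) hz)

theorem canonicalBracket_antisymm (f h : CotangentBundle E Q → ℝ) (z : CotangentBundle E Q) :
    canonicalBracket f h z = -canonicalBracket h f z :=
  poissonForm_antisymm _ _

theorem canonicalBracket_add_left {f g h : CotangentBundle E Q → ℝ}
    (hf : ContMDiff (𝓘(ℝ, E).prod 𝓘(ℝ, E →L[ℝ] ℝ)) 𝓘(ℝ, ℝ) ∞ f)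
    (hg : ContMDiff (𝓘(ℝ, E).prod 𝓘(ℝ, E →L[ℝ] ℝ)) 𝓘(ℝ, ℝ) ∞ g)
    (hh : ContMDiff (𝓘(ℝ, E).prod 𝓘(ℝ, E →L[ℝ] ℝ)) 𝓘(ℝ, ℝ) ∞ h) (z : CotangentBundle E Q) :
    canonicalBracket (f + g) h z = canonicalBracket f h z + canonicalBracket g h z := by
  have hz := mem_extChartAt_source (I := 𝓘(ℝ, E).prod 𝓘(ℝ, E →L[ℝ] ℝ)) z
  have cf := (contDiffAt_comp_phaseChart_symm (hf z) hz).differentiableAt (by simp)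
  have cg := (contDiffAt_comp_phaseChart_symm (hg z) hz).differentiableAt (by simp)
  rw [canonicalBracket_eq_phaseBracket_self ((hf.add hg) z) (hh z),
    canonicalBracket_eq_phaseBracket_self (hf z) (hh z),
    canonicalBracket_eq_phaseBracket_self (hg z) (hh z)]
  have e : (f + g) ∘ (phaseChart z).symm = f ∘ (phaseChart z).symm + g ∘ (phaseChart z).symm := rfl
  rw [phaseBracket, e, fderiv_add cf cg, poissonForm_eq_apply, add_apply, ← poissonForm_eq_apply,
    ← poissonForm_eq_apply]
  rfl

theorem canonicalBracket_smul_left (c : ℝ) {f h : CotangentBundle E Q → ℝ}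
    (hf : ContMDiff (𝓘(ℝ, E).prod 𝓘(ℝ, E →L[ℝ] ℝ)) 𝓘(ℝ, ℝ) ∞ f)
    (hh : ContMDiff (𝓘(ℝ, E).prod 𝓘(ℝ, E →L[ℝ] ℝ)) 𝓘(ℝ, ℝ) ∞ h) (z : CotangentBundle E Q) :
    canonicalBracket (c • f) h z = c * canonicalBracket f h z := by
  have hz := mem_extChartAt_source (I := 𝓘(ℝ, E).prod 𝓘(ℝ, E →L[ℝ] ℝ)) z
  have cf := (contDiffAt_comp_phaseChart_symm (hf z) hz).differentiableAt (by simp)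
  have hcf : ContMDiff (𝓘(ℝ, E).prod 𝓘(ℝ, E →L[ℝ] ℝ)) 𝓘(ℝ, ℝ) ∞ (c • f) :=
    contMDiff_const.mul hf
  rw [canonicalBracket_eq_phaseBracket_self (hcf z) (hh z),
    canonicalBracket_eq_phaseBracket_self (hf z) (hh z)]
  have e : (c • f) ∘ (phaseChart z).symm = c • (f ∘ (phaseChart z).symm) := rfl
  rw [phaseBracket, e, fderiv_const_smul cf, poissonForm_eq_apply, smul_apply,
    ← poissonForm_eq_apply]
  rfl

theorem canonicalBracket_mul_right {f g h : CotangentBundle E Q → ℝ}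
    (hf : ContMDiff (𝓘(ℝ, E).prod 𝓘(ℝ, E →L[ℝ] ℝ)) 𝓘(ℝ, ℝ) ∞ f)
    (hg : ContMDiff (𝓘(ℝ, E).prod 𝓘(ℝ, E →L[ℝ] ℝ)) 𝓘(ℝ, ℝ) ∞ g)
    (hh : ContMDiff (𝓘(ℝ, E).prod 𝓘(ℝ, E →L[ℝ] ℝ)) 𝓘(ℝ, ℝ) ∞ h) (z : CotangentBundle E Q) :
    canonicalBracket f (g * h) z =
      canonicalBracket f g z * h z + g z * canonicalBracket f h z := by
  have hz := mem_extChartAt_source (I := 𝓘(ℝ, E).prod 𝓘(ℝ, E →L[ℝ] ℝ)) z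
  have cg := (contDiffAt_comp_phaseChart_symm (hg z) hz).differentiableAt (by simp)
  have ch := (contDiffAt_comp_phaseChart_symm (hh z) hz).differentiableAt (by simp)
  rw [canonicalBracket_eq_phaseBracket_self (hf z) ((hg.mul hh) z),
    canonicalBracket_eq_phaseBracket_self (hf z) (hg z),
    canonicalBracket_eq_phaseBracket_self (hf z) (hh z)]
  have e : (g * h) ∘ (phaseChart z).symm = (g ∘ (phaseChart z).symm) * (h ∘ (phaseChart z).symm) :=
    rfl
  have e0 : (phaseChart z).symm (phaseChart z z) = z := (phaseChart z).left_inv hz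
  simp only [phaseBracket]
  rw [e, fderiv_mul cg ch, poissonForm_antisymm, poissonForm_eq_apply,
    poissonForm_antisymm _ (fderiv ℝ (g ∘ (phaseChart z).symm) _), poissonForm_eq_apply,
    poissonForm_antisymm _ (fderiv ℝ (h ∘ (phaseChart z).symm) _), poissonForm_eq_apply]
  simp only [add_apply, smul_apply, comp_apply, e0, smul_eq_mul]
  ring

end CotangentCharts

/-! ### A constant rank theorem -/

section ConstantRank

/-- A map of constant rank factors locally through a linear projection of its values. -/
theorem exists_local_factorization_of_constant_rank {X Y : Type*} [NormedAddCommGroup X]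
    [NormedSpace ℝ X] [FiniteDimensional ℝ X] [NormedAddCommGroup Y] [NormedSpace ℝ Y]
    {f : X → Y} {c : X} (hf : ContDiffAt ℝ ∞ f c) {e : X →L[ℝ] X} {L : Y →L[ℝ] X}
    (heL : ∀ y, e (L y) = L y) (hLf : L.comp (fderiv ℝ f c) = e)
    (hker : ∀ᶠ x in nhds c, Module.finrank ℝ (LinearMap.ker (fderiv ℝ f x).toLinearMap) =
      Module.finrank ℝ (LinearMap.ker e.toLinearMap)) :
    ∃ j : X → Y, DifferentiableAt ℝ j (L (f c)) ∧ ∀ᶠ x in nhds c, j (L (f x)) = f x := by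
  have hee : ∀ x, e (e x) = e x := fun x => by
    have h1 : e x = L (fderiv ℝ f c x) := by
      rw [← hLf]
      rfl
    rw [h1, heL]
  -- The e-part of Θ is L ∘ f and the complementary part is that of the identity. As L ∘ f'(c) = e,
  -- the derivative of Θ at c is the identity, so Θ is a local coordinate system.
  set Θ : X → X := fun x => L (f x) + (x - e x) with hΘ
  have hΘc : ContDiffAt ℝ ∞ Θ c :=
    (L.contDiff.contDiffAt.comp c hf).add (contDiffAt_id.sub e.contDiff.contDiffAt)
  have dΘ : ∀ x, DifferentiableAt ℝ f x →
      HasFDerivAt Θ (L.comp (fderiv ℝ f x) + (ContinuousLinearMap.id ℝ X - e)) x := fun x hx =>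
    (L.hasFDerivAt.comp x hx.hasFDerivAt).add ((hasFDerivAt_id x).sub e.hasFDerivAt)
  have hdf : ∀ᶠ x in nhds c, DifferentiableAt ℝ f x := by
    have h1 : ContDiffAt ℝ 1 f c := hf.of_le (by simp)
    filter_upwards [h1.eventually (by simp)] with x hx using hx.differentiableAt (by simp)
  have dΘc : HasFDerivAt Θ ((ContinuousLinearEquiv.refl ℝ X : X ≃L[ℝ] X) : X →L[ℝ] X) c := by
    have h := dΘ c hdf.self_of_nhds
    rw [hLf] at h
    convert! h using 1
    ext x
    simp
  set Λ := hΘc.toOpenPartialHomeomorph Θ dΘc (by simp) with hΛ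
  have hΛΘ : ∀ x, Λ x = Θ x := fun x => rfl
  have hcs : c ∈ Λ.source := hΘc.mem_toOpenPartialHomeomorph_source dΘc (by simp)
  have hct : Θ c ∈ Λ.target := Λ.map_source hcs
  have hsymm : Λ.symm (Θ c) = c := Λ.left_inv hcs
  have hι : ContDiffAt ℝ ∞ Λ.symm (Θ c) := hΘc.to_localInverse dΘc (by simp)
  set h : X → Y := f ∘ Λ.symm with hh
  -- Near c, Θ'(x) is injective and maps ker(L ∘ f'(x)) into ker e. Therefore dim ker(L ∘ f'(x)) ≤
  -- dim ker e = dim ker f'(x); the reverse inclusion being clear, the kernels agree and L is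
  -- injective on the image of f'(x).
  have hgood : ∀ᶠ x in nhds c, DifferentiableAt ℝ f x ∧
      (∀ u, L (fderiv ℝ f x u) = 0 → fderiv ℝ f x u = 0) := by
    have hinj : ∀ᶠ x in nhds c, Injective (fderiv ℝ Θ x) := by
      have hcont : ContinuousAt (fderiv ℝ Θ) c :=
        (hΘc.fderiv_right (m := ∞) (by simp)).continuousAt
      have hopen := ContinuousLinearEquiv.nhds (ContinuousLinearEquiv.refl ℝ X)
      rw [← dΘc.fderiv] at hopen
      filter_upwards [hcont hopen] with x hx
      obtain ⟨T, hT⟩ := hx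
      rw [← hT]
      exact T.injective
    filter_upwards [hdf, hker, hinj] with x h1 h2 h3
    refine ⟨h1, ?_⟩
    have hle : LinearMap.ker (fderiv ℝ f x).toLinearMap ≤
        LinearMap.ker (L.comp (fderiv ℝ f x)).toLinearMap := by
      intro u hu
      have hu' : fderiv ℝ f x u = 0 := hu
      change L (fderiv ℝ f x u) = 0
      rw [hu', map_zero]
    have hfr : Module.finrank ℝ (LinearMap.ker (L.comp (fderiv ℝ f x)).toLinearMap) ≤
        Module.finrank ℝ (LinearMap.ker e.toLinearMap) := by
      have hmap : ∀ u ∈ LinearMap.ker (L.comp (fderiv ℝ f x)).toLinearMap,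
          (fderiv ℝ Θ x).toLinearMap u ∈ LinearMap.ker e.toLinearMap := by
        intro u hu
        have hu' : L (fderiv ℝ f x u) = 0 := hu
        change e (fderiv ℝ Θ x u) = 0
        rw [(dΘ x h1).fderiv]
        simp [hu', hee]
      refine LinearMap.finrank_le_finrank_of_injective
        (f := (fderiv ℝ Θ x).toLinearMap.restrict hmap) ?_
      intro a b hab
      exact Subtype.ext (h3 (congrArg Subtype.val hab))
    have heq := Submodule.eq_of_le_of_finrank_le hle (hfr.trans_eq h2.symm)
    intro u hu
    have : u ∈ LinearMap.ker (L.comp (fderiv ℝ f x)).toLinearMap := hu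
    rw [← heq] at this
    exact this
  have hball : ∀ᶠ y in nhds (Θ c), y ∈ Λ.target ∧ DifferentiableAt ℝ Λ.symm y ∧
      DifferentiableAt ℝ f (Λ.symm y) ∧
      (∀ u, L (fderiv ℝ f (Λ.symm y) u) = 0 → fderiv ℝ f (Λ.symm y) u = 0) := by
    have h1 : ContDiffAt ℝ 1 Λ.symm (Θ c) := hι.of_le (by simp)
    have h2 : Filter.Tendsto Λ.symm (nhds (Θ c)) (nhds c) := by
      have := hι.continuousAt.tendsto
      rwa [hsymm] at this
    filter_upwards [Λ.open_target.mem_nhds hct, h1.eventually (by simp), h2.eventually hgood]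
      with y a b c using ⟨a, b.differentiableAt (by simp), c.1, c.2⟩
  obtain ⟨δ, hδ, hB⟩ := Metric.eventually_nhds_iff_ball.1 hball
  -- In the coordinates Θ, f is constant along ker e: the direction k comes from a vector killed by
  -- L ∘ f', hence by f'. The ball is convex, so the whole segment stays where this holds.
  have hconst : ∀ y k, y ∈ Metric.ball (Θ c) δ → y + k ∈ Metric.ball (Θ c) δ → e k = 0 →
      h (y + k) = h y := by
    intro y k hy hyk hk
    have hseg : ∀ t ∈ Icc (0 : ℝ) 1, y + t • k ∈ Metric.ball (Θ c) δ := by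
      intro t ht
      have := (convex_ball (Θ c) δ).add_smul_sub_mem hy hyk ht
      simpa using this
    have hder : ∀ t ∈ Icc (0 : ℝ) 1, HasDerivAt (fun t : ℝ => h (y + t • k)) 0 t := by
      intro t ht
      obtain ⟨a1, a2, a3, a4⟩ := hB _ (hseg t ht)
      have hd : HasFDerivAt h ((fderiv ℝ f (Λ.symm (y + t • k))).comp
          (fderiv ℝ Λ.symm (y + t • k))) (y + t • k) :=
        a3.hasFDerivAt.comp _ a2.hasFDerivAt
      have hl : HasDerivAt (fun t : ℝ => y + t • k) k t := by
        simpa using ((hasDerivAt_id t).smul_const k).const_add y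
      have hd' := hd.comp_hasDerivAt t hl
      convert! hd' using 1
      symm
      refine a4 _ ?_
      have hid : HasFDerivAt (Θ ∘ Λ.symm) (ContinuousLinearMap.id ℝ X) (y + t • k) := by
        refine (hasFDerivAt_id _).congr_of_eventuallyEq ?_
        filter_upwards [Λ.open_target.mem_nhds a1] with z hz
        exact Λ.right_inv hz
      have hid' := ((dΘ _ a3).comp _ a2.hasFDerivAt).unique hid
      have hk' := congrArg (fun T => e (T k)) hid'
      simp only [ContinuousLinearMap.comp_apply, add_apply, sub_apply, ContinuousLinearMap.id_apply,
        map_add, map_sub, hee, sub_self, add_zero, heL, hk] at hk'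
      exact hk'
    have hc := constant_of_has_deriv_right_zero (f := fun t : ℝ => h (y + t • k)) (a := 0) (b := 1)
      (fun t ht => (hder t ht).continuousAt.continuousWithinAt)
      (fun t ht => (hder t ⟨ht.1, ht.2.le⟩).hasDerivWithinAt) 1 (by simp)
    simpa using hc
  have he0 : e (Θ c) = L (f c) := by
    simp [hΘ, heL, hee]
  have hpt : L (f c) + (Θ c - e (Θ c)) = Θ c := by rw [he0]; abel
  -- The map j is f in the coordinates Θ with the ker e part frozen at its value for c.
  refine ⟨fun v => h (v + (Θ c - e (Θ c))), ?_, ?_⟩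
  · have hd : DifferentiableAt ℝ h (L (f c) + (Θ c - e (Θ c))) := by
      rw [hpt]
      obtain ⟨a1, a2, a3, a4⟩ := hB _ (Metric.mem_ball_self hδ)
      exact a3.comp _ a2
    exact DifferentiableAt.comp (g := h) (L (f c)) hd (differentiableAt_id.add_const _)
  · have t1 : ∀ᶠ x in nhds c, Θ x ∈ Metric.ball (Θ c) δ :=
      hΘc.continuousAt.eventually (Metric.ball_mem_nhds _ hδ)
    have t2 : ∀ᶠ x in nhds c, L (f x) + (Θ c - e (Θ c)) ∈ Metric.ball (Θ c) δ := by
      have : ContinuousAt (fun x => L (f x) + (Θ c - e (Θ c))) c :=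
        (L.continuous.continuousAt.comp hf.continuousAt).add continuousAt_const
      refine this.eventually ?_
      change ∀ᶠ y in nhds (L (f c) + (Θ c - e (Θ c))), _
      rw [hpt]
      exact Metric.ball_mem_nhds _ hδ
    filter_upwards [t1, t2, Λ.open_source.mem_nhds hcs] with x h1 h2 h3
    have hx : L (f x) + (Θ c - e (Θ c)) = Θ x + ((Θ c - e (Θ c)) - (x - e x)) := by
      simp only [hΘ]
      abel
    change h (L (f x) + (Θ c - e (Θ c))) = f x
    rw [hx] at h2 ⊢
    rw [hconst _ _ h1 h2 (by simp [hee])]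
    simp only [hh, comp_apply]
    rw [← hΛΘ, Λ.left_inv h3]

end ConstantRank

/-! ### Orbits of proper actions -/

section ProperAction

/-- For a proper action, the orbit map is open onto the orbit. -/
theorem exists_mem_nhds_orbit {G X : Type*} [Group G] [TopologicalSpace G] [IsTopologicalGroup G]
    [TopologicalSpace X] [T1Space X] [MulAction G X] [ProperSMul G X] (q : X) {U : Set G}
    (hU : U ∈ nhds (1 : G)) :
    ∃ V ∈ nhds q, ∀ x ∈ V, x ∈ MulAction.orbit G q → ∃ g ∈ U, g • q = x := by
  -- By properness the points g • q with g outside the open set O form a closed set. It misses q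
  -- because the stabilizer lies in O. V is the complement; a point of the orbit in V is (u k) • q =
  -- u • q with u in U and k in the stabilizer.
  set O : Set G := interior U * (MulAction.stabilizer G q : Set G) with hO
  have hOo : IsOpen O := isOpen_interior.mul_right
  have hcl := (ProperSMul.isProperMap_smul_pair (G := G) (X := X)).isClosedMap
  have h1 : IsClosed (Oᶜ ×ˢ ({q} : Set X)) := hOo.isClosed_compl.prod isClosed_singleton
  have h2 := (hcl _ h1).preimage (f := fun x : X => (x, q)) (by fun_prop)
  refine ⟨_, h2.isOpen_compl.mem_nhds ?_, ?_⟩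
  · rintro ⟨⟨g, y⟩, ⟨hg, hy⟩, he⟩
    simp only [mem_singleton_iff] at hy
    subst hy
    have he' := congrArg Prod.fst he
    exact hg ⟨1, mem_interior_iff_mem_nhds.2 hU, g, he', one_mul g⟩
  · rintro x hx ⟨g, rfl⟩
    by_contra hne
    refine hx ⟨(g, q), ⟨?_, rfl⟩, rfl⟩
    rintro ⟨u, hu, k, hk, rfl⟩
    refine hne ⟨u, interior_subset hu, ?_⟩
    have hk' : k • q = q := hk
    simp only [mul_smul, hk']

end ProperAction

/-! ### Local sections of submersions -/

section LocalSection

variable {E : Type*} [NormedAddCommGroup E] [NormedSpace ℝ E]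
  {F : Type*} [NormedAddCommGroup F] [NormedSpace ℝ F]
  {M : Type*} [TopologicalSpace M] [ChartedSpace E M]
  {N : Type*} [TopologicalSpace N] [ChartedSpace F N]

/-- A submersion has, locally, a smooth family of sections through all points. -/
theorem exists_local_sections_of_isSubmersionAt {f : M → N} {q : M}
    (hf : IsSubmersionAt 𝓘(ℝ, E) 𝓘(ℝ, F) ∞ f q) :
    ∃ (O : Set (N × M)) (s : N × M → M), IsOpen O ∧ (f q, q) ∈ O ∧
      ContMDiffOn (𝓘(ℝ, F).prod 𝓘(ℝ, E)) 𝓘(ℝ, E) ∞ s O ∧ (∀ p ∈ O, f (s p) = p.1) ∧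
      ∀ x, (f x, x) ∈ O → s (f x, x) = x := by
  obtain ⟨K, _, _, h⟩ := hf
  set φ := h.domChart with hφ
  set ψ := h.codChart with hψ
  set ε := h.equiv with hε
  have hw : ∀ x ∈ φ.target, ψ (f (φ.symm x)) = (ε x).1 := fun x hx => by
    have hx' : x ∈ (φ.extend 𝓘(ℝ, E)).target := by simpa using hx
    simpa using h.writtenInCharts hx'
  have hsub : ∀ x ∈ φ.source, f x ∈ ψ.source := h.source_subset_preimage_source
  -- In adapted charts f is the projection to the first factor. The section replaces the first
  -- coordinate of x by that of y; it lies over y, and changes nothing if y = f x.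
  set m : N × M → E := fun p => ε.symm (ψ p.1, (ε (φ p.2)).2) with hm
  have hψs : ContMDiffOn 𝓘(ℝ, F) 𝓘(ℝ, F) ∞ ψ ψ.source :=
    contMDiffOn_of_mem_maximalAtlas h.codChart_mem_maximalAtlas
  have hφs : ContMDiffOn 𝓘(ℝ, E) 𝓘(ℝ, E) ∞ φ φ.source :=
    contMDiffOn_of_mem_maximalAtlas h.domChart_mem_maximalAtlas
  have hφt : ContMDiffOn 𝓘(ℝ, E) 𝓘(ℝ, E) ∞ φ.symm φ.target :=
    contMDiffOn_symm_of_mem_maximalAtlas h.domChart_mem_maximalAtlas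
  have hms : ContMDiffOn (𝓘(ℝ, F).prod 𝓘(ℝ, E)) 𝓘(ℝ, E) ∞ m (ψ.source ×ˢ φ.source) := by
    have h1 : ContMDiffOn (𝓘(ℝ, F).prod 𝓘(ℝ, E)) 𝓘(ℝ, F) ∞ (fun p : N × M => ψ p.1)
        (ψ.source ×ˢ φ.source) := hψs.comp contMDiff_fst.contMDiffOn fun p hp => hp.1
    have h2 : ContMDiffOn (𝓘(ℝ, F).prod 𝓘(ℝ, E)) 𝓘(ℝ, E) ∞ (fun p : N × M => φ p.2)
        (ψ.source ×ˢ φ.source) := hφs.comp contMDiff_snd.contMDiffOn fun p hp => hp.2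
    have h3 : ContDiff ℝ ∞ (fun p : F × E => ε.symm (p.1, (ε p.2).2)) := by fun_prop
    exact h3.contMDiff.comp_contMDiffOn (h1.prodMk_space h2)
  have hO : IsOpen ((ψ.source ×ˢ φ.source) ∩ m ⁻¹' φ.target) :=
    hms.continuousOn.isOpen_inter_preimage (ψ.open_source.prod φ.open_source) φ.open_target
  have hx : ∀ x ∈ φ.source, m (f x, x) = φ x := fun x hx => by
    have h1 := hw (φ x) (φ.map_source hx)
    rw [φ.left_inv hx] at h1
    simp only [hm, h1, Prod.mk.eta, ε.symm_apply_apply]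
  refine ⟨_, fun p => φ.symm (m p), hO, ?_, ?_, ?_, ?_⟩
  · have hq : q ∈ φ.source := h.mem_domChart_source
    refine ⟨⟨hsub q hq, hq⟩, ?_⟩
    rw [mem_preimage, hx q hq]
    exact φ.map_source hq
  · exact hφt.comp (hms.mono inter_subset_left) fun p hp => hp.2
  · rintro p ⟨⟨h1, h2⟩, h3⟩
    refine ψ.injOn (hsub _ (φ.map_target h3)) h1 ?_
    rw [hw _ h3]
    simp [hm]
  · rintro x ⟨⟨h1, h2⟩, h3⟩
    simp only [hx x h2]
    exact φ.left_inv h2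

end LocalSection

section LinearAlgebra

/-- Serves to show that the orbit map has constant rank: in charts, the kernels of its derivatives
are images of one another under isomorphisms. -/
theorem finrank_ker_eq_of_bijective {X Y Y' : Type*} [AddCommGroup X] [Module ℝ X]
    [AddCommGroup Y] [Module ℝ Y] [AddCommGroup Y'] [Module ℝ Y'] {Z : X →ₗ[ℝ] Y} {Z' : X →ₗ[ℝ] Y'}
    {B : X →ₗ[ℝ] X} (hB : Bijective B) (h : ∀ u, Z' u = 0 ↔ Z (B u) = 0) :
    Module.finrank ℝ (LinearMap.ker Z') = Module.finrank ℝ (LinearMap.ker Z) := by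
  have e : (LinearMap.ker Z').map ((LinearEquiv.ofBijective B hB : X ≃ₗ[ℝ] X) : X →ₗ[ℝ] X) =
      LinearMap.ker Z := by
    ext y
    constructor
    · rintro ⟨u, hu, rfl⟩
      exact (h u).1 hu
    · intro hy
      obtain ⟨u, rfl⟩ := hB.2 y
      exact ⟨u, (h u).2 hy, rfl⟩
  rw [← e]
  exact ((LinearEquiv.ofBijective B hB).submoduleMap (LinearMap.ker Z')).finrank_eq

end LinearAlgebra

/-! ### Vertical vectors are tangent to orbits -/

section Geometry

variable {EG : Type*} [NormedAddCommGroup EG] [NormedSpace ℝ EG]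
  {E : Type*} [NormedAddCommGroup E] [NormedSpace ℝ E]
  {F : Type*} [NormedAddCommGroup F] [NormedSpace ℝ F]
  {G : Type*} [Group G] [TopologicalSpace G] [ChartedSpace EG G] [LieGroup 𝓘(ℝ, EG) ∞ G]
  {Q : Type*} [TopologicalSpace Q] [ChartedSpace E Q] [IsManifold 𝓘(ℝ, E) ∞ Q]
  [MulAction G Q] [ContMDiffSMul 𝓘(ℝ, EG) 𝓘(ℝ, E) ∞ G Q]

variable (EG E G) in
/-- The fundamental vector fields, as maps between the model spaces. -/
def zeta (q : Q) : EG →L[ℝ] E := fundamental EG (E := E) (G := G) q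

variable (E) in
/-- The tangent action, as a map between the model spaces. -/
def actMap (g : G) (q : Q) : E →L[ℝ] E := actionDeriv E g q

/-- The connection form, as a map between the model spaces. -/
def GeneralizedConnection.conn (A : GeneralizedConnection EG E G Q) (q : Q) : E →L[ℝ] EG :=
  A.form q

theorem hasMFDerivAt_smul_one (q : Q) :
    HasMFDerivAt 𝓘(ℝ, EG) 𝓘(ℝ, E) (fun g : G => g • q) 1 (zeta EG E G q) :=
  (mdifferentiable_orbitMap EG q 1).hasMFDerivAt

theorem hasMFDerivAt_smul_const
    (EG : Type*) [NormedAddCommGroup EG] [NormedSpace ℝ EG] [ChartedSpace EG G]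
    [ContMDiffSMul 𝓘(ℝ, EG) 𝓘(ℝ, E) ∞ G Q]
    (g : G) (q : Q) :
    HasMFDerivAt 𝓘(ℝ, E) 𝓘(ℝ, E) (fun x : Q => g • x) q (actMap E g q) :=
  (mdifferentiable_smul_const EG g q).hasMFDerivAt

theorem actMap_mul
    (EG : Type*) [NormedAddCommGroup EG] [NormedSpace ℝ EG] [ChartedSpace EG G]
    [ContMDiffSMul 𝓘(ℝ, EG) 𝓘(ℝ, E) ∞ G Q]
    (g h : G) (q : Q) :
    actMap E (g * h) q = (actMap E g (h • q)).comp (actMap E h q) :=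
  actionDeriv_mul EG g h q

theorem actMap_one (q : Q) : actMap E (1 : G) q = ContinuousLinearMap.id ℝ E :=
  actionDeriv_one q

theorem actMap_inv_apply
    (EG : Type*) [NormedAddCommGroup EG] [NormedSpace ℝ EG] [ChartedSpace EG G]
    [ContMDiffSMul 𝓘(ℝ, EG) 𝓘(ℝ, E) ∞ G Q]
    (g : G) (q : Q) (v : E) :
    actMap E g⁻¹ (g • q) (actMap E g q v) = v := by
  have h := actMap_mul (E := E) EG g⁻¹ g q
  rw [inv_mul_cancel, actMap_one] at h
  exact (congrArg (fun T : E →L[ℝ] E => T v) h).symm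

theorem actMap_apply_inv
    (EG : Type*) [NormedAddCommGroup EG] [NormedSpace ℝ EG] [ChartedSpace EG G]
    [ContMDiffSMul 𝓘(ℝ, EG) 𝓘(ℝ, E) ∞ G Q]
    (g : G) (q : Q) (v : E) :
    actMap E g q (actMap E g⁻¹ (g • q) v) = v := by
  have h := actMap_inv_apply (E := E) EG g⁻¹ (g • q) v
  rw [inv_inv, inv_smul_smul] at h
  exact h

theorem actMap_injective
    (EG : Type*) [NormedAddCommGroup EG] [NormedSpace ℝ EG] [ChartedSpace EG G]
    [ContMDiffSMul 𝓘(ℝ, EG) 𝓘(ℝ, E) ∞ G Q]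
    (g : G) (q : Q) : Injective (actMap E g q) :=
  LeftInverse.injective (actMap_inv_apply EG g q)

theorem zeta_smul (g : G) (q : Q) (X : EG) :
    zeta EG E G (g • q) (adjointRep EG g X) = actMap E g q (zeta EG E G q X) :=
  fundamental_smul EG g q X

theorem GeneralizedConnection.zeta_conn_zeta (A : GeneralizedConnection EG E G Q) (q : Q) (X : EG) :
    zeta EG E G q (A.conn q (zeta EG E G q X)) = zeta EG E G q X :=
  A.fundamental_form_fundamental q X

theorem GeneralizedConnection.conn_smul (A : GeneralizedConnection EG E G Q) (g : G) (q : Q)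
    (v : E) : A.conn (g • q) (actMap E g q v) = adjointRep EG g (A.conn q v) :=
  A.equivariant g q v

/-- Since k • q = g • ((g⁻¹ k) • q), B is the derivative of left translation by g⁻¹, with inverse
the derivative of translation by g. So the orbit map has the rank of ζ_q everywhere. -/
theorem exists_hasMFDerivAt_orbitMap (g : G) (q : Q) :
    ∃ B : EG →L[ℝ] EG, Bijective B ∧
      HasMFDerivAt 𝓘(ℝ, EG) 𝓘(ℝ, E) (fun k : G => k • q) g
        ((actMap E g q).comp ((zeta EG E G q).comp B)) := by
  have dl : ∀ a b : G, ∃ B : EG →L[ℝ] EG,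
      HasMFDerivAt 𝓘(ℝ, EG) 𝓘(ℝ, EG) (fun k : G => a * k) b B := fun a b =>
    ⟨_, ((contMDiff_mul_left (I := 𝓘(ℝ, EG)) (n := ∞) (a := a)).mdifferentiable (by simp)
      b).hasMFDerivAt⟩
  obtain ⟨B, hB⟩ := dl g⁻¹ g
  obtain ⟨B', hB'⟩ := dl g 1
  have e1 : B.comp B' = ContinuousLinearMap.id ℝ EG := by
    have h := HasMFDerivAt.comp (1 : G) (HasMFDerivAt.congr_point hB (mul_one g).symm) hB'
    have e : (fun k : G => g⁻¹ * k) ∘ (fun k : G => g * k) = id := by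
      funext k
      simp
    rw [e] at h
    exact hasMFDerivAt_unique h (hasMFDerivAt_id _)
  have e2 : B'.comp B = ContinuousLinearMap.id ℝ EG := by
    have h := HasMFDerivAt.comp g (HasMFDerivAt.congr_point hB' (inv_mul_cancel g).symm) hB
    have e : (fun k : G => g * k) ∘ (fun k : G => g⁻¹ * k) = id := by
      funext k
      simp
    rw [e] at h
    exact hasMFDerivAt_unique h (hasMFDerivAt_id _)
  refine ⟨B, ⟨LeftInverse.injective (g := B') fun x => congrArg (fun T : EG →L[ℝ] EG => T x) e2,
    RightInverse.surjective (g := B') fun x => congrArg (fun T : EG →L[ℝ] EG => T x) e1⟩, ?_⟩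
  have h1 := HasMFDerivAt.comp g (HasMFDerivAt.congr_point (hasMFDerivAt_smul_one (E := E) q)
    (inv_mul_cancel g).symm) hB
  have h2 := HasMFDerivAt.comp g (HasMFDerivAt.congr_point (hasMFDerivAt_smul_const (E := E) EG g q)
    (q' := (g⁻¹ * g) • q) (by simp)) h1
  have e : (fun x : Q => g • x) ∘ (fun k : G => k • q) ∘ (fun k : G => g⁻¹ * k) =
      fun k : G => k • q := by
    funext k
    simp [smul_smul]
  rw [e] at h2
  exact h2

/-- The tangent space at q is identified with the model space by the preferred chart at q itself. -/
theorem hasMFDerivAt_extChartAt_self (q : Q) :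
    HasMFDerivAt 𝓘(ℝ, E) 𝓘(ℝ, E) (extChartAt 𝓘(ℝ, E) q) q (ContinuousLinearMap.id ℝ E) := by
  refine HasMFDerivAt.congr_clm (hasMFDerivAt_extChartAt' (mem_chart_source E q)) ?_
  ext v
  have h := TangentBundle.continuousLinearMapAt_trivializationAt_eq_core (I := 𝓘(ℝ, E))
    (mem_chart_source E q)
  rw [h]
  exact (tangentBundleCore 𝓘(ℝ, E) Q).coordChange_self _ _ (mem_chart_source E q) v

variable [ChartedSpace F (BaseSpace G Q)] [IsManifold 𝓘(ℝ, F) ∞ (BaseSpace G Q)]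

variable (E F G) in
/-- `T_q π`, as a map between the model spaces. -/
def projMap (q : Q) : E →L[ℝ] F := baseProjDeriv E F G q

theorem baseProj_smul (g : G) (q : Q) : baseProj G (g • q) = baseProj G q :=
  Quotient.sound ⟨g, rfl⟩

theorem baseProj_eq_iff {x y : Q} : baseProj G x = baseProj G y ↔ x ∈ MulAction.orbit G y :=
  Quotient.eq

theorem hasMFDerivAt_baseProj (hπ : IsSubmersion 𝓘(ℝ, E) 𝓘(ℝ, F) ∞ (baseProj G : Q → BaseSpace G Q))
    (q : Q) : HasMFDerivAt 𝓘(ℝ, E) 𝓘(ℝ, F) (baseProj G) q (projMap E F G q) :=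
  (hπ.contMDiff.mdifferentiable (by simp) q).hasMFDerivAt

theorem projMap_zeta (hπ : IsSubmersion 𝓘(ℝ, E) 𝓘(ℝ, F) ∞ (baseProj G : Q → BaseSpace G Q))
    (q : Q) (X : EG) : projMap E F G q (zeta EG E G q X) = 0 := by
  have h := HasMFDerivAt.comp (1 : G) (HasMFDerivAt.congr_point (hasMFDerivAt_baseProj hπ q)
    (one_smul G q).symm) (hasMFDerivAt_smul_one (EG := EG) q)
  have e : (baseProj G : Q → BaseSpace G Q) ∘ (fun g : G => g • q) = fun _ => baseProj G q := by
    funext g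
    exact baseProj_smul g q
  rw [e] at h
  exact congrArg (fun T : EG →L[ℝ] F => T X) (hasMFDerivAt_unique h (hasMFDerivAt_const _ _))

theorem projMap_actMap
    (EG : Type*) [NormedAddCommGroup EG] [NormedSpace ℝ EG] [ChartedSpace EG G]
    [ContMDiffSMul 𝓘(ℝ, EG) 𝓘(ℝ, E) ∞ G Q]
    (hπ : IsSubmersion 𝓘(ℝ, E) 𝓘(ℝ, F) ∞ (baseProj G : Q → BaseSpace G Q))
    (g : G) (q : Q) (v : E) : projMap E F G (g • q) (actMap E g q v) = projMap E F G q v := by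
  have h := HasMFDerivAt.comp q (hasMFDerivAt_baseProj hπ (g • q)) (hasMFDerivAt_smul_const EG g q)
  have e : (baseProj G : Q → BaseSpace G Q) ∘ (fun x : Q => g • x) = baseProj G := by
    funext x
    exact baseProj_smul g x
  rw [e] at h
  exact congrArg (fun T : E →L[ℝ] F => T v) (hasMFDerivAt_unique h (hasMFDerivAt_baseProj hπ q))

/-- Tangent vectors at π(q) are lifted by differentiating the local section y ↦ s(y, q) through q.
-/
theorem projMap_surjective
    (hπ : IsSubmersion 𝓘(ℝ, E) 𝓘(ℝ, F) ∞ (baseProj G : Q → BaseSpace G Q)) (q : Q) :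
    Surjective (projMap E F G q : E →L[ℝ] F) := by
  obtain ⟨O, s, hO, hq, hs, h1, h2⟩ := exists_local_sections_of_isSubmersionAt (hπ.isSubmersionAt q)
  have hsm : MDifferentiableAt (𝓘(ℝ, F).prod 𝓘(ℝ, E)) 𝓘(ℝ, E) s (baseProj G q, q) :=
    (hs.contMDiffAt (hO.mem_nhds hq)).mdifferentiableAt (by simp)
  have hι : MDifferentiableAt 𝓘(ℝ, F) (𝓘(ℝ, F).prod 𝓘(ℝ, E))
      (fun y : BaseSpace G Q => (y, q)) (baseProj G q) :=
    (contMDiff_id.prodMk contMDiff_const).mdifferentiable (n := 1) (by simp) _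
  have hsι : MDifferentiableAt 𝓘(ℝ, F) 𝓘(ℝ, E) (fun y : BaseSpace G Q => s (y, q))
      (baseProj G q) := hsm.comp (baseProj G q) hι
  have hd := HasMFDerivAt.comp (baseProj G q)
    (HasMFDerivAt.congr_point (hasMFDerivAt_baseProj hπ q) (h2 q hq).symm) hsι.hasMFDerivAt
  have hid : (baseProj G : Q → BaseSpace G Q) ∘ (fun y => s (y, q)) =ᶠ[nhds (baseProj G q)] id := by
    have : ∀ᶠ y in nhds (baseProj G q), (y, q) ∈ O :=
      (Continuous.prodMk_left q).continuousAt.eventually (hO.mem_nhds hq)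
    filter_upwards [this] with y hy using h1 _ hy
  have he := hasMFDerivAt_unique (hd.congr_of_eventuallyEq hid.symm) (hasMFDerivAt_id _)
  intro u
  exact ⟨_, congrArg (fun T : F →L[ℝ] F => T u) he⟩

/-- A submersion `π` has, near `q`, a smooth retraction onto the fibre of `q`, whose derivative fixes
the vertical space. -/
theorem exists_fibre_retraction
    (hπ : IsSubmersion 𝓘(ℝ, E) 𝓘(ℝ, F) ∞ (baseProj G : Q → BaseSpace G Q)) (q : Q) :
    ∃ (r : Q → Q) (S : E →L[ℝ] E), HasMFDerivAt 𝓘(ℝ, E) 𝓘(ℝ, E) r q S ∧ r q = q ∧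
      (∀ᶠ x in nhds q, baseProj G (r x) = baseProj G q) ∧
      ∀ v, projMap E F G q v = 0 → S v = v := by
  obtain ⟨O, s, hO, hq, hs, hs1, hs2⟩ := exists_local_sections_of_isSubmersionAt
    (hπ.isSubmersionAt q)
  have hsq : s (baseProj G q, q) = q := hs2 q hq
  have hsm : MDifferentiableAt (𝓘(ℝ, F).prod 𝓘(ℝ, E)) 𝓘(ℝ, E) s (baseProj G q, q) :=
    (hs.contMDiffAt (hO.mem_nhds hq)).mdifferentiableAt (by simp)
  obtain ⟨S, hS⟩ : ∃ S : F × E →L[ℝ] E,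
      HasMFDerivAt (𝓘(ℝ, F).prod 𝓘(ℝ, E)) 𝓘(ℝ, E) s (baseProj G q, q) S :=
    ⟨_, hsm.hasMFDerivAt⟩
  -- The retraction slides x along the local sections into the fibre of q.
  refine ⟨fun x => s (baseProj G q, x), S.comp (ContinuousLinearMap.inr ℝ F E), ?_, hsq, ?_, ?_⟩
  · exact HasMFDerivAt.comp (f := fun x : Q => ((baseProj G q : BaseSpace G Q), x)) q hS
      ((hasMFDerivAt_const (baseProj G q) q).prodMk (hasMFDerivAt_id q))
  · have h1 : ∀ᶠ x in nhds q, ((baseProj G q : BaseSpace G Q), x) ∈ O :=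
      (Continuous.prodMk_right (baseProj G q)).continuousAt.eventually (hO.mem_nhds hq)
    filter_upwards [h1] with x hx using hs1 _ hx
  -- Differentiating s(π x, x) = x gives Ts(Tπ v, v) = v; for vertical v the left side is the
  -- derivative of the retraction.
  · intro v hv
    have h1 : HasMFDerivAt 𝓘(ℝ, E) (𝓘(ℝ, F).prod 𝓘(ℝ, E))
        (fun x : Q => ((baseProj G x : BaseSpace G Q), x)) q
        ((projMap E F G q).prod (ContinuousLinearMap.id ℝ E)) :=
      (hasMFDerivAt_baseProj hπ q).prodMk (hasMFDerivAt_id q)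
    have h2 := HasMFDerivAt.comp (f := fun x : Q => ((baseProj G x : BaseSpace G Q), x)) q hS h1
    have h3 : s ∘ (fun x : Q => ((baseProj G x : BaseSpace G Q), x)) =ᶠ[nhds q] id := by
      have : ∀ᶠ x in nhds q, ((baseProj G x : BaseSpace G Q), x) ∈ O :=
        h1.continuousAt.eventually (hO.mem_nhds hq)
      filter_upwards [this] with x hx using hs2 x hx
    have h4 := hasMFDerivAt_unique (h2.congr_of_eventuallyEq h3.symm) (hasMFDerivAt_id q)
    have h5 : S (projMap E F G q v, v) = v := congrArg (fun T : E →L[ℝ] E => T v) h4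
    rw [hv] at h5
    exact h5

/-- Near `q`, the orbit of `q` is determined by its coordinates along the connection. -/
theorem exists_orbit_factorization [FiniteDimensional ℝ EG]
    (A : GeneralizedConnection EG E G Q) (q : Q) :
    ∃ j : EG → E,
      DifferentiableAt ℝ j (((A.conn q).comp (zeta EG E G q)).comp (A.conn q)
        (extChartAt 𝓘(ℝ, E) q q)) ∧
      (fderiv ℝ j (((A.conn q).comp (zeta EG E G q)).comp (A.conn q)
        (extChartAt 𝓘(ℝ, E) q q))).comp ((((A.conn q).comp (zeta EG E G q)).comp
          (A.conn q)).comp (zeta EG E G q)) = zeta EG E G q ∧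
      ∀ᶠ g in nhds (1 : G), j (((A.conn q).comp (zeta EG E G q)).comp (A.conn q)
        (extChartAt 𝓘(ℝ, E) q (g • q))) = extChartAt 𝓘(ℝ, E) q (g • q) := by
  set χ := extChartAt 𝓘(ℝ, EG) (1 : G) with hχ
  set φ := extChartAt 𝓘(ℝ, E) q with hφ
  set f : EG → E := φ ∘ (fun g : G => g • q) ∘ χ.symm with hfdef
  have horb : ContMDiff 𝓘(ℝ, EG) 𝓘(ℝ, E) ∞ (fun g : G => g • q) :=
    (contMDiff_smul (I := 𝓘(ℝ, EG)) (I' := 𝓘(ℝ, E)) (n := ∞)).comp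
      (contMDiff_id.prodMk contMDiff_const)
  have hχ1 : χ.symm (χ 1) = 1 := extChartAt_to_inv (I := 𝓘(ℝ, EG)) (1 : G)
  have hsrc1 : (1 : G) • q ∈ (chartAt E q).source := by
    rw [one_smul]
    exact mem_chart_source E q
  have hf : ContDiffAt ℝ ∞ f (χ 1) := by
    have h := ((contMDiffAt_iff_of_mem_source (mem_chart_source EG (1 : G)) hsrc1).1
      (horb.contMDiffAt)).2
    rw [ModelWithCorners.range_eq_univ, contDiffWithinAt_univ] at h
    exact h
  have hf1 : fderiv ℝ f (χ 1) = zeta EG E G q := by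
    have h := (mdifferentiable_orbitMap EG (E := E) q (1 : G)).mfderiv
    rw [ModelWithCorners.range_eq_univ, fderivWithin_univ] at h
    simp only [writtenInExtChartAt, one_smul] at h
    exact h.symm
  -- By ζ A ζ = ζ, the map e = A ζ is a projection with kernel 𝔤_q, and L = A ζ A satisfies L ζ = e
  -- and e L = L, as the constant rank theorem requires.
  set e : EG →L[ℝ] EG := (A.conn q).comp (zeta EG E G q) with he
  set L : E →L[ℝ] EG := ((A.conn q).comp (zeta EG E G q)).comp (A.conn q) with hL
  have hnear : ∀ᶠ x in nhds (χ 1), ∃ g : G, g ∈ (chartAt EG (1 : G)).source ∧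
      g • q ∈ (chartAt E q).source ∧ χ g = x := by
    have hcont : ContinuousAt (fun x => χ.symm x • q) (χ 1) := by
      refine ContinuousAt.comp (g := fun g : G => g • q) horb.continuous.continuousAt ?_
      exact continuousAt_extChartAt_symm (I := 𝓘(ℝ, EG)) (1 : G)
    have h1 : ∀ᶠ x in nhds (χ 1), χ.symm x • q ∈ (chartAt E q).source := by
      refine hcont.eventually ((chartAt E q).open_source.mem_nhds ?_)
      simp only [hχ1]
      exact hsrc1
    filter_upwards [h1, extChartAt_target_mem_nhds (I := 𝓘(ℝ, EG)) (1 : G)] with x hx hx'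
    refine ⟨χ.symm x, ?_, hx, χ.right_inv hx'⟩
    rw [← extChartAt_source 𝓘(ℝ, EG)]
    exact χ.map_target hx'
  obtain ⟨j, hj, hjf⟩ := exists_local_factorization_of_constant_rank hf (e := e) (L := L)
    (fun y => by simp only [hL, he, ContinuousLinearMap.comp_apply, A.zeta_conn_zeta])
    (by
      rw [hf1]
      ext X
      simp only [hL, he, ContinuousLinearMap.comp_apply, A.zeta_conn_zeta])
    (by
      filter_upwards [hnear] with x hx
      obtain ⟨g, hg1, hg2, rfl⟩ := hx
      have hd := (hasFDerivAt_writtenInCharts (horb.mdifferentiable (by simp) g) hg1 hg2).fderiv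
      obtain ⟨B, hB, hBd⟩ := exists_hasMFDerivAt_orbitMap (EG := EG) (E := E) g q
      obtain ⟨S, hS⟩ : ∃ S : EG →L[ℝ] EG,
        S = (trivializationAt EG (TangentSpace 𝓘(ℝ, EG)) (1 : G)).symmL ℝ g := ⟨_, rfl⟩
      obtain ⟨R, hR⟩ : ∃ R : E →L[ℝ] E,
        R = (trivializationAt E (TangentSpace 𝓘(ℝ, E)) q).continuousLinearMapAt ℝ (g • q) :=
        ⟨_, rfl⟩
      have hbij : Bijective S := by
        rw [hS]
        exact ⟨LeftInverse.injective fun y => (trivializationAt EG (TangentSpace 𝓘(ℝ, EG))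
            (1 : G)).continuousLinearMapAt_symmL (R := ℝ) hg1 y,
          RightInverse.surjective fun y => (trivializationAt EG (TangentSpace 𝓘(ℝ, EG))
            (1 : G)).symmL_continuousLinearMapAt (R := ℝ) hg1 y⟩
      have hinj : Injective R := by
        rw [hR]
        exact LeftInverse.injective fun y => (trivializationAt E (TangentSpace 𝓘(ℝ, E))
            q).symmL_continuousLinearMapAt (R := ℝ) hg2 y
      have hm : (mfderiv 𝓘(ℝ, EG) 𝓘(ℝ, E) (fun g : G => g • q) g : EG →L[ℝ] E) =
        (actMap E g q).comp ((zeta EG E G q).comp B) := hBd.mfderiv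
      have hd' : fderiv ℝ f (χ g) = R.comp (((actMap E g q).comp ((zeta EG E G q).comp B)).comp S) := by
        rw [hR, hS, ← hm]
        exact hd
      -- The derivative at χ g is the composite of B ∘ S, of ζ_q, and of injective maps. Its kernel
      -- is therefore the preimage under B ∘ S of ker ζ_q, and ker ζ_q = ker(A ζ_q).
      refine finrank_ker_eq_of_bijective (B := (B.comp S).toLinearMap) (hB.comp hbij) ?_
      intro u
      change fderiv ℝ f (χ g) u = 0 ↔ A.conn q (zeta EG E G q (B (S u))) = 0
      rw [hd']
      simp only [ContinuousLinearMap.comp_apply]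
      constructor
      · intro h0
        have h1 := actMap_injective EG g q ((hinj (h0.trans (map_zero _).symm)).trans
          (map_zero _).symm)
        rw [h1, map_zero]
      · intro h0
        rw [← A.zeta_conn_zeta, h0, map_zero, map_zero, map_zero])
  have hfc : f (χ 1) = φ q := by
    simp only [hfdef, comp_apply, hχ1, one_smul]
  have hje : (fderiv ℝ j (L (f (χ 1)))).comp (L.comp (zeta EG E G q)) = zeta EG E G q := by
    have h1 := hj.hasFDerivAt.comp (χ 1)
      (L.hasFDerivAt.comp (χ 1) (hf.differentiableAt (by simp)).hasFDerivAt)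
    rw [hf1] at h1
    have h2 := (hf.differentiableAt (by simp)).hasFDerivAt
    rw [hf1] at h2
    exact h1.unique (h2.congr_of_eventuallyEq hjf)
  have hjG : ∀ᶠ g in nhds (1 : G), j (L (φ (g • q))) = φ (g • q) := by
    have h1 := (continuousAt_extChartAt (I := 𝓘(ℝ, EG)) (1 : G)).eventually hjf
    filter_upwards [h1, extChartAt_source_mem_nhds (I := 𝓘(ℝ, EG)) (1 : G)] with g hg hg'
    have h2 : χ.symm (χ g) = g := χ.left_inv hg'
    have h3 : f (χ g) = φ (g • q) := by simp only [hfdef, comp_apply, h2]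
    rw [← h3]
    exact hg
  rw [hfc] at hj hje
  exact ⟨j, hj, hje, hjG⟩

/-- The vertical spaces of `π` are the tangent spaces of the orbits. -/
theorem eq_zeta_conn_of_projMap_eq_zero [FiniteDimensional ℝ EG] [T2Space Q] [ProperSMul G Q]
    (hπ : IsSubmersion 𝓘(ℝ, E) 𝓘(ℝ, F) ∞ (baseProj G : Q → BaseSpace G Q))
    (A : GeneralizedConnection EG E G Q) {q : Q} {v : E} (hv : projMap E F G q v = 0) :
    zeta EG E G q (A.conn q v) = v := by
  have : IsTopologicalGroup G := topologicalGroup_of_lieGroup 𝓘(ℝ, EG) ∞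
  obtain ⟨j, hj, hje, hjG⟩ := exists_orbit_factorization A q
  obtain ⟨r, S, hr, hrq, hrf, hSv⟩ := exists_fibre_retraction hπ q
  obtain ⟨V, hV, hVo⟩ := exists_mem_nhds_orbit q hjG
  set φ := extChartAt 𝓘(ℝ, E) q with hφ
  set L : E →L[ℝ] EG := ((A.conn q).comp (zeta EG E G q)).comp (A.conn q) with hL
  have hρ : HasMFDerivAt 𝓘(ℝ, E) 𝓘(ℝ, E) (fun x : Q => φ (r x)) q S :=
    HasMFDerivAt.comp q (HasMFDerivAt.congr_point (hasMFDerivAt_extChartAt_self q) hrq.symm) hr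
  -- For x near q the point r x lies in the fibre of q, which is an orbit, and close to q. By
  -- properness it is g • q with g near 1, where j recovers it.
  have hfac : (fun x : Q => j (L (φ (r x)))) =ᶠ[nhds q] fun x : Q => φ (r x) := by
    have h2 : ∀ᶠ x in nhds q, r x ∈ V := by
      refine hr.continuousAt.eventually ?_
      rw [hrq]
      exact hV
    filter_upwards [hrf, h2] with x hx1 hx2
    obtain ⟨g, hg, hgx⟩ := hVo _ hx2 (baseProj_eq_iff.1 hx1)
    have hg' : j (L (φ (g • q))) = φ (g • q) := hg
    rwa [hgx] at hg'
  have hjL : HasFDerivAt (fun y => j (L y)) ((fderiv ℝ j (L (φ q))).comp L) (φ q) :=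
    hj.hasFDerivAt.comp (φ q) L.hasFDerivAt
  have hjL' : HasMFDerivAt 𝓘(ℝ, E) 𝓘(ℝ, E) (fun y => j (L y)) (φ (r q))
      ((fderiv ℝ j (L (φ q))).comp L) := by
    rw [hrq]
    exact hjL.hasMFDerivAt
  have hjLρ := HasMFDerivAt.comp (f := fun x : Q => φ (r x)) (g := fun y => j (L y)) q hjL' hρ
  have hu := hasMFDerivAt_unique hjLρ (hρ.congr_of_eventuallyEq hfac)
  have hu' : fderiv ℝ j (L (φ q)) (L (S v)) = S v :=
    congrArg (fun T : E →L[ℝ] E => T v) hu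
  rw [hSv v hv] at hu'
  -- Differentiation gave j' L v = v. Since L does not distinguish v from ζ(A v), the identity j' L
  -- ζ = ζ turns this into ζ(A v) = v.
  have hLv : L v = L (zeta EG E G q (A.conn q v)) := by
    simp only [hL, ContinuousLinearMap.comp_apply, A.zeta_conn_zeta]
  rw [hLv] at hu'
  exact (congrArg (fun T : EG →L[ℝ] E => T (A.conn q v)) hje).symm.trans hu'

end Geometry

section RightInverse

/-- `ContinuousLinearMap.inverse` is zero unless its argument is a continuous equivalence. In finite
dimension a bijection is one, so the horizontal lift is a genuine inverse. -/
theorem subtypeL_comp_inverse_spec {V W : Type*} [NormedAddCommGroup V] [NormedSpace ℝ V]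
    [FiniteDimensional ℝ V] [NormedAddCommGroup W] [NormedSpace ℝ W] (S : Submodule ℝ V)
    (p : V →L[ℝ] W) (hp : Bijective fun v : S => p v) (u : W) :
    (S.subtypeL.comp (ContinuousLinearMap.inverse (p.comp S.subtypeL))) u ∈ S ∧
      p ((S.subtypeL.comp (ContinuousLinearMap.inverse (p.comp S.subtypeL))) u) = u := by
  have hp' : Bijective (p.comp S.subtypeL).toLinearMap := hp
  obtain ⟨e, he⟩ : ∃ e : S ≃L[ℝ] W, (e : S →L[ℝ] W) = p.comp S.subtypeL :=
    ⟨(LinearEquiv.ofBijective _ hp').toContinuousLinearEquiv, by ext v; rfl⟩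
  rw [← he, ContinuousLinearMap.inverse_equiv]
  refine ⟨(e.symm u).2, ?_⟩
  have h : (p.comp S.subtypeL) (e.symm u) = u := by rw [← he]; exact e.apply_symm_apply u
  exact h

end RightInverse

/-! ### The horizontal-vertical splitting and its dual -/

section Splitting

variable {EG : Type*} [NormedAddCommGroup EG] [NormedSpace ℝ EG] [FiniteDimensional ℝ EG]
  {E : Type*} [NormedAddCommGroup E] [NormedSpace ℝ E] [FiniteDimensional ℝ E]
  {F : Type*} [NormedAddCommGroup F] [NormedSpace ℝ F]
  {G : Type*} [Group G] [TopologicalSpace G] [ChartedSpace EG G] [LieGroup 𝓘(ℝ, EG) ∞ G]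
  {Q : Type*} [TopologicalSpace Q] [T2Space Q] [ChartedSpace E Q] [IsManifold 𝓘(ℝ, E) ∞ Q]
  [MulAction G Q] [ContMDiffSMul 𝓘(ℝ, EG) 𝓘(ℝ, E) ∞ G Q] [ProperSMul G Q]
  [ChartedSpace F (BaseSpace G Q)] [IsManifold 𝓘(ℝ, F) ∞ (BaseSpace G Q)]

namespace GeneralizedConnection

/-- The horizontal space, as a subspace of the model space. -/
def horSubspace (A : GeneralizedConnection EG E G Q) (q : Q) : Submodule ℝ E := A.Hor q

variable (F) in
/-- The horizontal lift, as a map between the model spaces. -/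
def horMap (A : GeneralizedConnection EG E G Q) (q : Q) : F →L[ℝ] E := A.horizontalLift F q

/-- A horizontal vector killed by Tπ equals ζ(A v), which vanishes on horizontal vectors; this gives
injectivity. Any lift w becomes horizontal after subtracting ζ(A w), because ζ A ζ = ζ; this gives
surjectivity. -/
theorem bijective_projMap_hor (A : GeneralizedConnection EG E G Q)
    (hπ : IsSubmersion 𝓘(ℝ, E) 𝓘(ℝ, F) ∞ (baseProj G : Q → BaseSpace G Q)) (q : Q) :
    Bijective (fun v : A.horSubspace q => projMap E F G q v) := by
  constructor
  · rintro ⟨v, hv⟩ ⟨w, hw⟩ h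
    have h1 : projMap E F G q (v - w) = 0 := by
      rw [map_sub, sub_eq_zero]
      exact h
    have hv' : zeta EG E G q (A.conn q v) = 0 := hv
    have hw' : zeta EG E G q (A.conn q w) = 0 := hw
    have h2 := eq_zeta_conn_of_projMap_eq_zero hπ A h1
    rw [map_sub, map_sub, hv', hw', sub_zero] at h2
    exact Subtype.ext (sub_eq_zero.1 h2.symm)
  · intro u
    obtain ⟨w, hw⟩ := projMap_surjective hπ q u
    refine ⟨⟨w - zeta EG E G q (A.conn q w), ?_⟩, ?_⟩
    · change zeta EG E G q (A.conn q (w - zeta EG E G q (A.conn q w))) = 0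
      rw [map_sub, map_sub, A.zeta_conn_zeta, sub_self]
    · change projMap E F G q (w - zeta EG E G q (A.conn q w)) = u
      rw [map_sub, projMap_zeta hπ, sub_zero, hw]

theorem horMap_spec (A : GeneralizedConnection EG E G Q)
    (hπ : IsSubmersion 𝓘(ℝ, E) 𝓘(ℝ, F) ∞ (baseProj G : Q → BaseSpace G Q)) (q : Q) (u : F) :
    A.horMap F q u ∈ A.horSubspace q ∧ projMap E F G q (A.horMap F q u) = u :=
  subtypeL_comp_inverse_spec (V := E) (W := F) (A.horSubspace q) (projMap E F G q)
    (A.bijective_projMap_hor hπ q) u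

theorem projMap_horMap (A : GeneralizedConnection EG E G Q)
    (hπ : IsSubmersion 𝓘(ℝ, E) 𝓘(ℝ, F) ∞ (baseProj G : Q → BaseSpace G Q)) (q : Q) (u : F) :
    projMap E F G q (A.horMap F q u) = u :=
  (A.horMap_spec hπ q u).2

theorem zeta_conn_horMap (A : GeneralizedConnection EG E G Q)
    (hπ : IsSubmersion 𝓘(ℝ, E) 𝓘(ℝ, F) ∞ (baseProj G : Q → BaseSpace G Q)) (q : Q) (u : F) :
    zeta EG E G q (A.conn q (A.horMap F q u)) = 0 :=
  (A.horMap_spec hπ q u).1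

/-- The horizontal lift and w differ by a vertical vector, which ζ A fixes. As w is an arbitrary
lift of u, this formula yields both the equivariance and the smoothness of C. -/
theorem eq_horMap_add (A : GeneralizedConnection EG E G Q)
    (hπ : IsSubmersion 𝓘(ℝ, E) 𝓘(ℝ, F) ∞ (baseProj G : Q → BaseSpace G Q)) {q : Q} {w : E} {u : F}
    (hw : projMap E F G q w = u) :
    A.horMap F q u = w - zeta EG E G q (A.conn q w) := by
  have h : projMap E F G q (A.horMap F q u - w) = 0 := by
    rw [map_sub, A.projMap_horMap hπ, hw, sub_self]
  have h1 := eq_zeta_conn_of_projMap_eq_zero hπ A h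
  rw [map_sub, map_sub, A.zeta_conn_horMap hπ, zero_sub] at h1
  rw [sub_eq_neg_add, h1]
  abel

theorem horMap_projMap_add (A : GeneralizedConnection EG E G Q)
    (hπ : IsSubmersion 𝓘(ℝ, E) 𝓘(ℝ, F) ∞ (baseProj G : Q → BaseSpace G Q)) (q : Q) (v : E) :
    A.horMap F q (projMap E F G q v) + zeta EG E G q (A.conn q v) = v := by
  rw [A.eq_horMap_add hπ rfl]
  abel

theorem horMap_smul (A : GeneralizedConnection EG E G Q)
    (hπ : IsSubmersion 𝓘(ℝ, E) 𝓘(ℝ, F) ∞ (baseProj G : Q → BaseSpace G Q)) (g : G) (q : Q) (u : F) :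
    A.horMap F (g • q) u = actMap E g q (A.horMap F q u) := by
  have h : projMap E F G (g • q) (actMap E g q (A.horMap F q u)) = u := by
    rw [projMap_actMap EG hπ, A.projMap_horMap hπ]
  rw [A.eq_horMap_add hπ h, A.conn_smul, zeta_smul, A.zeta_conn_horMap hπ, map_zero, sub_zero]

theorem zeta_conn_horMap_add (A : GeneralizedConnection EG E G Q)
    (hπ : IsSubmersion 𝓘(ℝ, E) 𝓘(ℝ, F) ∞ (baseProj G : Q → BaseSpace G Q)) (q : Q) (u : F) (X : EG) :
    zeta EG E G q (A.conn q (A.horMap F q u + zeta EG E G q X)) = zeta EG E G q X := by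
  rw [map_add, map_add, A.zeta_conn_horMap hπ, A.zeta_conn_zeta, zero_add]

/-- Elements of `Ann 𝔤_q` are unchanged by `A ∘ ζ`. -/
theorem ann_apply_conn_zeta (A : GeneralizedConnection EG E G Q) {q : Q} {l : EG →L[ℝ] ℝ}
    (hl : l ∈ isotropyAnn EG E G q) (X : EG) : l (A.conn q (zeta EG E G q X)) = l X := by
  have h : l (A.conn q (zeta EG E G q X) - X) = 0 := by
    refine hl _ ?_
    change zeta EG E G q (A.conn q (zeta EG E G q X) - X) = 0
    rw [map_sub, A.zeta_conn_zeta, sub_self]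
  rw [map_sub] at h
  exact sub_eq_zero.1 h

theorem apply_horMap_projMap_add (A : GeneralizedConnection EG E G Q)
    (hπ : IsSubmersion 𝓘(ℝ, E) 𝓘(ℝ, F) ∞ (baseProj G : Q → BaseSpace G Q)) (q : Q)
    (p : E →L[ℝ] ℝ) (v : E) :
    p (A.horMap F q (projMap E F G q v)) + p (zeta EG E G q (A.conn q v)) = p v := by
  rw [← map_add, A.horMap_projMap_add hπ]

theorem apply_projMap_horMap (A : GeneralizedConnection EG E G Q)
    (hπ : IsSubmersion 𝓘(ℝ, E) 𝓘(ℝ, F) ∞ (baseProj G : Q → BaseSpace G Q)) {q : Q} (η : F →L[ℝ] ℝ)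
    {l : EG →L[ℝ] ℝ} (hl : l ∈ isotropyAnn EG E G q) (u : F) :
    η (projMap E F G q (A.horMap F q u)) + l (A.conn q (A.horMap F q u)) = η u := by
  have h : l (A.conn q (A.horMap F q u)) = 0 := hl _ (A.zeta_conn_horMap hπ q u)
  rw [h, A.projMap_horMap hπ, add_zero]

theorem apply_projMap_zeta (A : GeneralizedConnection EG E G Q)
    (hπ : IsSubmersion 𝓘(ℝ, E) 𝓘(ℝ, F) ∞ (baseProj G : Q → BaseSpace G Q)) {q : Q} (η : F →L[ℝ] ℝ)
    {l : EG →L[ℝ] ℝ} (hl : l ∈ isotropyAnn EG E G q) (X : EG) :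
    η (projMap E F G q (zeta EG E G q X)) + l (A.conn q (zeta EG E G q X)) = l X := by
  rw [A.ann_apply_conn_zeta hl, projMap_zeta hπ, map_zero, zero_add]

theorem weinsteinIso_weinsteinIsoInv (A : GeneralizedConnection EG E G Q)
    (hπ : IsSubmersion 𝓘(ℝ, E) 𝓘(ℝ, F) ∞ (baseProj G : Q → BaseSpace G Q))
    (z : CotangentBundle E Q) : A.weinsteinIso (A.weinsteinIsoInv F z) = z := by
  refine TotalSpace.ext rfl (heq_of_eq ?_)
  refine ContinuousLinearMap.ext fun v => ?_
  exact A.apply_horMap_projMap_add hπ z.1 z.2 v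

/-- Evaluation on horizontal lifts recovers η, because A maps them into 𝔤_q, where λ vanishes.
Evaluation on fundamental vectors recovers λ, because Tπ kills them and λ ∘ A ∘ ζ = λ on Ann 𝔤_q. -/
theorem weinsteinIsoInv_weinsteinIso (A : GeneralizedConnection EG E G Q)
    (hπ : IsSubmersion 𝓘(ℝ, E) 𝓘(ℝ, F) ∞ (baseProj G : Q → BaseSpace G Q))
    (w : WeinsteinTotal EG E F G Q) : A.weinsteinIsoInv F (A.weinsteinIso w) = w := by
  obtain ⟨⟨q, ⟨y, η⟩, l⟩, h, hl⟩ := w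
  change y = baseProj G q at h
  subst h
  refine Subtype.ext (Prod.ext rfl (Prod.ext ?_ ?_))
  · refine TotalSpace.ext rfl (heq_of_eq ?_)
    refine ContinuousLinearMap.ext fun u => ?_
    exact A.apply_projMap_horMap hπ η hl u
  · refine ContinuousLinearMap.ext fun X => ?_
    exact A.apply_projMap_zeta hπ η hl X

end GeneralizedConnection

end Splitting

/-! ### Orbit type strata and isomorphisms of presented spaces -/

section Strata

variable {G : Type*} [Group G]

theorem orbitSpace_mk_eq_iff {X : Type*} (a : MulAction G X) (x y : X) :
    OrbitSpace.mk a x = OrbitSpace.mk a y ↔ ∃ g : G, a.smul g y = x :=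
  Quotient.eq (r := @MulAction.orbitRel G X _ a)

/-- Points of one orbit have conjugate stabilizers, so every representative decides membership. -/
theorem mk_mem_orbitTypeStratum_iff {X : Type*} (a : MulAction G X) (x : X) (L : Subgroup G) :
    OrbitSpace.mk a x ∈ orbitTypeStratum a L ↔
      ∃ g : G, @MulAction.stabilizer G X _ a x = MulAut.conj g • L := by
  constructor
  · rintro ⟨y, hy, g, hg⟩
    obtain ⟨k, hk⟩ := (orbitSpace_mk_eq_iff a x y).1 hy.symm
    refine ⟨k * g, ?_⟩
    have h := @MulAction.stabilizer_smul_eq_stabilizer_map_conj G X _ a k y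
    have h' : @MulAction.stabilizer G X _ a x = MulAut.conj k • @MulAction.stabilizer G X _ a y := by
      rw [← hk]
      exact h
    rw [h', hg, smul_smul, map_mul]
  · rintro h
    exact ⟨x, rfl, h⟩

/-- The map `σ : P₁ → P₂` extends, locally around each point, to a smooth map between the ambient
manifolds. -/
def HasLocalSmoothExtensions {E₁ H₁ E₂ H₂ : Type*} [NormedAddCommGroup E₁] [NormedSpace ℝ E₁]
    [TopologicalSpace H₁] (J₁ : ModelWithCorners ℝ E₁ H₁) [NormedAddCommGroup E₂] [NormedSpace ℝ E₂]
    [TopologicalSpace H₂] (J₂ : ModelWithCorners ℝ E₂ H₂)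
    {M₁ M₂ P₁ P₂ : Type*} [TopologicalSpace M₁] [ChartedSpace H₁ M₁] [TopologicalSpace M₂]
    [ChartedSpace H₂ M₂] (e₁ : P₁ → M₁) (e₂ : P₂ → M₂) (σ : P₁ → P₂) : Prop :=
  ∀ a : P₁, ∃ U : Set M₁, IsOpen U ∧ e₁ a ∈ U ∧ ∃ R : M₁ → M₂,
    ContMDiffOn J₁ J₂ ∞ R U ∧ ∀ b : P₁, e₁ b ∈ U → R (e₁ b) = e₂ (σ b)

variable {E₁ H₁ E₂ H₂ : Type*} [NormedAddCommGroup E₁] [NormedSpace ℝ E₁]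
    [TopologicalSpace H₁] {J₁ : ModelWithCorners ℝ E₁ H₁} [NormedAddCommGroup E₂] [NormedSpace ℝ E₂]
    [TopologicalSpace H₂] {J₂ : ModelWithCorners ℝ E₂ H₂}
    {M₁ M₂ P₁ P₂ : Type*} [TopologicalSpace M₁] [ChartedSpace H₁ M₁] [TopologicalSpace M₂]
    [ChartedSpace H₂ M₂] {e₁ : P₁ → M₁} {e₂ : P₂ → M₂} {σ : P₁ → P₂} {ρ : P₂ → P₁}

theorem HasLocalSmoothExtensions.continuous [TopologicalSpace P₁] [TopologicalSpace P₂]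
    (h : HasLocalSmoothExtensions J₁ J₂ e₁ e₂ σ) (he₁ : Continuous e₁)
    (he₂ : Topology.IsInducing e₂) : Continuous σ := by
  rw [he₂.continuous_iff, continuous_iff_continuousAt]
  intro a
  obtain ⟨U, hU, ha, R, hR, hRσ⟩ := h a
  have h1 : ContinuousAt (R ∘ e₁) a :=
    (hR.continuousOn.continuousAt (hU.mem_nhds ha)).comp he₁.continuousAt
  refine h1.congr ?_
  filter_upwards [he₁.continuousAt.eventually (hU.mem_nhds ha)] with b hb using hRσ b hb

/-- Local extensions of functions pull back along local extensions of σ. No manifold structure on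
the presenting spaces is needed, only their ambient manifolds. -/
theorem presentedSmoothOn.comp {X₁ X₂ : Type*} {p₁ : P₁ → X₁} {p₂ : P₂ → X₂}
    (hσ : HasLocalSmoothExtensions J₁ J₂ e₁ e₂ σ) {Z₁ : Set X₁} {Z₂ : Set X₂} {f₁ : X₁ → ℝ}
    {f₂ : X₂ → ℝ} (hZ : ∀ a, p₁ a ∈ Z₁ → p₂ (σ a) ∈ Z₂) (hf : ∀ a, f₁ (p₁ a) = f₂ (p₂ (σ a)))
    (h : presentedSmoothOn J₂ e₂ p₂ Z₂ f₂) : presentedSmoothOn J₁ e₁ p₁ Z₁ f₁ := by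
  intro a ha
  obtain ⟨U, hU, haU, R, hR, hRσ⟩ := hσ a
  obtain ⟨V, hV, haV, f', hf', hff⟩ := h (σ a) (hZ a ha)
  refine ⟨U ∩ R ⁻¹' V, hR.continuousOn.isOpen_inter_preimage hU hV, ⟨haU, ?_⟩, f' ∘ R, ?_, ?_⟩
  · change R (e₁ a) ∈ V
    rwa [hRσ a haU]
  · exact hf'.comp (hR.mono inter_subset_left) fun x hx => hx.2
  · rintro b ⟨hb, hb'⟩ hbZ
    change R (e₁ b) ∈ V at hb'
    rw [hRσ b hb] at hb'
    simp only [comp_apply, hRσ b hb, hf]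
    exact hff _ hb' (hZ b hbZ)

/-- The common source of α, β and κ. The maps σ and ρ need only be inverse modulo the presentations:
on the tangent side, 𝔤 presents 𝔤/𝔤_q and the component in 𝔤_q is lost. -/
theorem exists_homeomorph_of_presentations [TopologicalSpace P₁] [TopologicalSpace P₂]
    {X₁ X₂ : Type*} [TopologicalSpace X₁] [TopologicalSpace X₂] {p₁ : P₁ → X₁} {p₂ : P₂ → X₂}
    (hp₁ : Topology.IsQuotientMap p₁) (hp₂ : Topology.IsQuotientMap p₂)
    (he₁ : Topology.IsInducing e₁) (he₂ : Topology.IsInducing e₂)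
    (hσ : HasLocalSmoothExtensions J₁ J₂ e₁ e₂ σ) (hρ : HasLocalSmoothExtensions J₂ J₁ e₂ e₁ ρ)
    (hσp : ∀ a a', p₁ a = p₁ a' → p₂ (σ a) = p₂ (σ a'))
    (hρp : ∀ b b', p₂ b = p₂ b' → p₁ (ρ b) = p₁ (ρ b'))
    (hρσ : ∀ a, p₁ (ρ (σ a)) = p₁ a) (hσρ : ∀ b, p₂ (σ (ρ b)) = p₂ b) :
    ∃ φ : X₁ ≃ₜ X₂, (∀ a, φ (p₁ a) = p₂ (σ a)) ∧
      ∀ (Z : Set X₂) (f : X₂ → ℝ), presentedSmoothOn J₂ e₂ p₂ Z f ↔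
        presentedSmoothOn J₁ e₁ p₁ (φ ⁻¹' Z) (f ∘ φ) := by
  have hσc := hσ.continuous he₁.continuous he₂
  have hρc := hρ.continuous he₂.continuous he₁
  let φ₀ : X₁ → X₂ := fun x => p₂ (σ (surjInv hp₁.surjective x))
  let ψ₀ : X₂ → X₁ := fun x => p₁ (ρ (surjInv hp₂.surjective x))
  have hφ₀ : ∀ a, φ₀ (p₁ a) = p₂ (σ a) := fun a => hσp _ _ (surjInv_eq hp₁.surjective (p₁ a))
  have hψ₀ : ∀ b, ψ₀ (p₂ b) = p₁ (ρ b) := fun b => hρp _ _ (surjInv_eq hp₂.surjective (p₂ b))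
  let φ : X₁ ≃ₜ X₂ :=
    { toFun := φ₀
      invFun := ψ₀
      left_inv := fun x => by
        obtain ⟨a, rfl⟩ := hp₁.surjective x
        rw [hφ₀, hψ₀, hρσ]
      right_inv := fun x => by
        obtain ⟨a, rfl⟩ := hp₂.surjective x
        rw [hψ₀, hφ₀, hσρ]
      continuous_toFun := by
        rw [hp₁.continuous_iff]
        exact (hp₂.continuous.comp hσc).congr fun a => (hφ₀ a).symm
      continuous_invFun := by
        rw [hp₂.continuous_iff]
        exact (hp₁.continuous.comp hρc).congr fun a => (hψ₀ a).symm }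
  have hφ : ∀ a, φ (p₁ a) = p₂ (σ a) := hφ₀
  refine ⟨φ, hφ, fun Z f => ⟨fun h => ?_, fun h => ?_⟩⟩
  · refine presentedSmoothOn.comp hσ (fun a ha => ?_) (fun a => ?_) h
    · rw [← hφ]
      exact ha
    · rw [← hφ]
      rfl
  · refine presentedSmoothOn.comp hρ (fun b hb => ?_) (fun b => ?_) h
    · change φ _ ∈ Z
      rwa [hφ, hσρ]
    · change _ = f (φ _)
      rw [hφ, hσρ]

/-- The strata of the target are pulled back along r from an orbit space. It suffices that x and t x
have the same stabilizer, which determines the orbit type on either side. -/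
theorem image_orbitTypeStratum {X X' Y : Type*} (a : MulAction G X) (a' : MulAction G X')
    {φ : OrbitSpace a → Y} (hφ : Surjective φ) {r : Y → OrbitSpace a'} {t : X → X'}
    (ht : ∀ x, r (φ (OrbitSpace.mk a x)) = OrbitSpace.mk a' (t x))
    (hs : ∀ (x : X) (g : G), a.smul g x = x ↔ a'.smul g (t x) = t x) (L : Subgroup G) :
    φ '' orbitTypeStratum a L = {y | r y ∈ orbitTypeStratum a' L} := by
  have hs' : ∀ x, @MulAction.stabilizer G X _ a x = @MulAction.stabilizer G X' _ a' (t x) := by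
    intro x
    ext g
    exact hs x g
  have key : ∀ x : OrbitSpace a, r (φ x) ∈ orbitTypeStratum a' L ↔ x ∈ orbitTypeStratum a L := by
    intro x
    obtain ⟨x, rfl⟩ := Quotient.exists_rep x
    have h1 := mk_mem_orbitTypeStratum_iff a x L
    have h2 := mk_mem_orbitTypeStratum_iff a' (t x) L
    rw [← ht, ← hs'] at h2
    exact h2.trans h1.symm
  ext y
  constructor
  · rintro ⟨x, hx, rfl⟩
    exact (key x).2 hx
  · intro hy
    obtain ⟨x, rfl⟩ := hφ y
    exact ⟨x, (key x).1 hy, rfl⟩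

end Strata

/-! ### Smooth maps to cotangent bundles, tested on local frames -/

section BundleMaps

variable {E : Type*} [NormedAddCommGroup E] [NormedSpace ℝ E]
  {Q : Type*} [TopologicalSpace Q] [ChartedSpace E Q] [IsManifold 𝓘(ℝ, E) ∞ Q]
  {EN HN : Type*} [NormedAddCommGroup EN] [NormedSpace ℝ EN] [TopologicalSpace HN]
  {I : ModelWithCorners ℝ EN HN} {N : Type*} [TopologicalSpace N] [ChartedSpace HN N]

theorem contMDiffAt_clm_of_apply {V : Type*} [NormedAddCommGroup V] [NormedSpace ℝ V]
    [FiniteDimensional ℝ V] {φ : N → V →L[ℝ] ℝ} {m : N}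
    (h : ∀ v, ContMDiffAt I 𝓘(ℝ, ℝ) ∞ (fun x => φ x v) m) :
    ContMDiffAt I 𝓘(ℝ, V →L[ℝ] ℝ) ∞ φ m := by
  let b := Module.finBasis ℝ V
  have e : φ = fun x => ∑ i, φ x (b i) • LinearMap.toContinuousLinearMap (b.coord i) := by
    funext x
    ext v
    have hv := congrArg (φ x) (b.sum_repr v)
    rw [map_sum] at hv
    simp only [map_smul, smul_eq_mul] at hv
    simp [← hv, mul_comm]
  rw [e]
  exact contMDiffAt_finsetSum fun i _ => (h (b i)).smul contMDiffAt_const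

theorem trivializationAt_apply_snd {x₀ x : Q} (hx : x ∈ (chartAt E x₀).source) (v : E) :
    (trivializationAt E (TangentSpace 𝓘(ℝ, E)) x₀ ⟨x, v⟩).2 =
      (trivializationAt E (TangentSpace 𝓘(ℝ, E)) x₀).continuousLinearMapAt ℝ x v :=
  congrFun ((trivializationAt E (TangentSpace 𝓘(ℝ, E)) x₀).coe_linearMapAt_of_mem (R := ℝ) hx).symm v

/-- The local frame given by the preferred chart at `x₀`. -/
def localFrame (x₀ : Q) (v : E) (x : Q) : TangentBundle 𝓘(ℝ, E) Q :=
  ⟨x, (trivializationAt E (TangentSpace 𝓘(ℝ, E)) x₀).symmL ℝ x v⟩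

theorem contMDiffOn_localFrame (x₀ : Q) (v : E) :
    ContMDiffOn 𝓘(ℝ, E) 𝓘(ℝ, E).tangent ∞ (localFrame x₀ v) (chartAt E x₀).source := by
  refine ((trivializationAt E (TangentSpace 𝓘(ℝ, E)) x₀).contMDiffOn_iff (fun x hx => ?_)).2
    ⟨contMDiffOn_id, ?_⟩
  · exact ((trivializationAt E (TangentSpace 𝓘(ℝ, E)) x₀).mem_source).2 hx
  · refine (contMDiffOn_const (c := v)).congr fun x hx => ?_
    refine (trivializationAt_apply_snd hx _).trans ?_
    exact (trivializationAt E (TangentSpace 𝓘(ℝ, E)) x₀).continuousLinearMapAt_symmL (R := ℝ) hx v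

theorem contMDiffAt_cotangent_iff {f : N → CotangentBundle E Q} {m : N} :
    ContMDiffAt I (𝓘(ℝ, E).prod 𝓘(ℝ, E →L[ℝ] ℝ)) ∞ f m ↔
      ContMDiffAt I 𝓘(ℝ, E) ∞ (fun x => (f x).1) m ∧
      ContMDiffAt I 𝓘(ℝ, E →L[ℝ] ℝ) ∞ (fun x => ContinuousLinearMap.comp ((f x).2 : E →L[ℝ] ℝ)
        ((trivializationAt E (TangentSpace 𝓘(ℝ, E)) (f m).1).symmL ℝ (f x).1 : E →L[ℝ] E)) m := by
  rw [contMDiffAt_hom_bundle]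
  refine and_congr_right fun _ => ?_
  have e : (fun x => ContinuousLinearMap.inCoordinates E (TangentSpace 𝓘(ℝ, E)) ℝ
      (Bundle.Trivial Q ℝ) (f m).1 (f x).1 (f m).1 (f x).1 (f x).2) =
      (fun x => ContinuousLinearMap.comp ((f x).2 : E →L[ℝ] ℝ)
        ((trivializationAt E (TangentSpace 𝓘(ℝ, E)) (f m).1).symmL ℝ (f x).1 : E →L[ℝ] E)) := by
    funext x
    ext v
    simp [ContinuousLinearMap.inCoordinates]
  rw [e]

/-- A map to the cotangent bundle is smooth if its pairings with a local frame are. -/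
theorem contMDiffAt_cotangent_of_apply [FiniteDimensional ℝ E] {f : N → CotangentBundle E Q} {m : N}
    (hb : ContMDiffAt I 𝓘(ℝ, E) ∞ (fun x => (f x).1) m)
    (h : ∀ v : E, ContMDiffAt I 𝓘(ℝ, ℝ) ∞ (fun x => ((f x).2 : E →L[ℝ] ℝ)
      ((localFrame (f m).1 v (f x).1).2 : E)) m) :
    ContMDiffAt I (𝓘(ℝ, E).prod 𝓘(ℝ, E →L[ℝ] ℝ)) ∞ f m :=
  contMDiffAt_cotangent_iff.2 ⟨hb, contMDiffAt_clm_of_apply h⟩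

/-- In the trivialization at the foot point of f m, the pairing is the evaluation of a smooth family
of linear forms on a smooth family of vectors. -/
theorem ContMDiffAt.cotangent_apply {f : N → CotangentBundle E Q} {V : N → TangentBundle 𝓘(ℝ, E) Q}
    {m : N} (hf : ContMDiffAt I (𝓘(ℝ, E).prod 𝓘(ℝ, E →L[ℝ] ℝ)) ∞ f m)
    (hV : ContMDiffAt I 𝓘(ℝ, E).tangent ∞ V m) (hb : ∀ᶠ x in nhds m, (V x).1 = (f x).1) :
    ContMDiffAt I 𝓘(ℝ, ℝ) ∞ (fun x => ((f x).2 : E →L[ℝ] ℝ) ((V x).2 : E)) m := by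
  obtain ⟨h1, h2⟩ := contMDiffAt_cotangent_iff.1 hf
  have hVm : V m ∈ (trivializationAt E (TangentSpace 𝓘(ℝ, E)) (f m).1).source := by
    refine ((trivializationAt E (TangentSpace 𝓘(ℝ, E)) (f m).1).mem_source).2 ?_
    rw [hb.self_of_nhds]
    exact mem_chart_source E (f m).1
  have h3 := (((trivializationAt E (TangentSpace 𝓘(ℝ, E)) (f m).1).contMDiffAt_iff hVm).1 hV).2
  refine (h2.clm_apply h3).congr_of_eventuallyEq ?_
  have h4 : ∀ᶠ x in nhds m, (f x).1 ∈ (chartAt E (f m).1).source :=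
    h1.continuousAt.eventually ((chartAt E (f m).1).open_source.mem_nhds (mem_chart_source E _))
  filter_upwards [hb, h4] with x hx hx'
  have key : ∀ y : TangentBundle 𝓘(ℝ, E) Q, y.1 = (f x).1 →
      ((trivializationAt E (TangentSpace 𝓘(ℝ, E)) (f m).1).symmL ℝ (f x).1 : E →L[ℝ] E)
        (trivializationAt E (TangentSpace 𝓘(ℝ, E)) (f m).1 y).2 = (y.2 : E) := by
    rintro ⟨y, v⟩ (rfl : y = (f x).1)
    have e := trivializationAt_apply_snd (E := E) hx' v
    refine (congrArg ((trivializationAt E (TangentSpace 𝓘(ℝ, E)) (f m).1).symmL ℝ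
      (f x).1 : E →L[ℝ] E) e).trans ?_
    exact (trivializationAt E (TangentSpace 𝓘(ℝ, E)) (f m).1).symmL_continuousLinearMapAt
      (R := ℝ) hx' v
  exact congrArg ((f x).2 : E →L[ℝ] ℝ) (key (V x) hx).symm

end BundleMaps

/-! ### Smoothness of the fundamental vector fields -/

section Lifts

variable {EG : Type*} [NormedAddCommGroup EG] [NormedSpace ℝ EG]
  {E : Type*} [NormedAddCommGroup E] [NormedSpace ℝ E]
  {G : Type*} [Group G] [TopologicalSpace G] [ChartedSpace EG G] [LieGroup 𝓘(ℝ, EG) ∞ G]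
  {Q : Type*} [TopologicalSpace Q] [ChartedSpace E Q] [IsManifold 𝓘(ℝ, E) ∞ Q]
  [MulAction G Q] [ContMDiffSMul 𝓘(ℝ, EG) 𝓘(ℝ, E) ∞ G Q]

theorem contMDiff_tangentSpace_inclusion {H : Type*} [TopologicalSpace H] [ChartedSpace EG H]
    [IsManifold 𝓘(ℝ, EG) ∞ H] (x : H) :
    ContMDiff 𝓘(ℝ, EG) 𝓘(ℝ, EG).tangent ∞
      (fun X : EG => (⟨x, X⟩ : TangentBundle 𝓘(ℝ, EG) H)) := by
  intro X
  refine contMDiffAt_totalSpace.2 ⟨contMDiffAt_const, ?_⟩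
  obtain ⟨L, hL⟩ : ∃ L : EG →L[ℝ] EG, L =
    (trivializationAt EG (TangentSpace 𝓘(ℝ, EG)) x).continuousLinearMapAt ℝ x := ⟨_, rfl⟩
  have e : (fun X : EG => (trivializationAt EG (TangentSpace 𝓘(ℝ, EG)) x
      (⟨x, X⟩ : TangentBundle 𝓘(ℝ, EG) H)).2) = L := by
    funext X
    rw [hL]
    exact trivializationAt_apply_snd (mem_chart_source EG x) X
  rw [show (fun X : EG => (trivializationAt EG (TangentSpace 𝓘(ℝ, EG)) x
      (⟨x, X⟩ : TangentBundle 𝓘(ℝ, EG) H)).2) = L from e]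
  exact L.contMDiff.contMDiffAt

theorem hasMFDerivAt_smul_pair (q : Q) :
    HasMFDerivAt (𝓘(ℝ, EG).prod 𝓘(ℝ, E)) 𝓘(ℝ, E) (fun p : G × Q => p.1 • p.2) ((1 : G), q)
      ((zeta EG E G q).comp (ContinuousLinearMap.fst ℝ EG E) + ContinuousLinearMap.snd ℝ EG E) := by
  have hsm : ContMDiff (𝓘(ℝ, EG).prod 𝓘(ℝ, E)) 𝓘(ℝ, E) ∞ (fun p : G × Q => p.1 • p.2) :=
    contMDiff_smul (I := 𝓘(ℝ, EG)) (I' := 𝓘(ℝ, E)) (n := ∞)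
  obtain ⟨S, hS⟩ : ∃ S : EG × E →L[ℝ] E, HasMFDerivAt (𝓘(ℝ, EG).prod 𝓘(ℝ, E)) 𝓘(ℝ, E)
      (fun p : G × Q => p.1 • p.2) ((1 : G), q) S :=
    ⟨_, (hsm.mdifferentiable (by simp) _).hasMFDerivAt⟩
  have h1 : S.comp ((ContinuousLinearMap.id ℝ EG).prod 0) = zeta EG E G q :=
    hasMFDerivAt_unique (HasMFDerivAt.comp (f := fun g : G => (g, q)) (1 : G) hS
      ((hasMFDerivAt_id (1 : G)).prodMk (hasMFDerivAt_const q (1 : G)))) (hasMFDerivAt_smul_one q)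
  have h2 : S.comp (ContinuousLinearMap.prod 0 (ContinuousLinearMap.id ℝ E)) =
      actMap E (1 : G) q :=
    hasMFDerivAt_unique (HasMFDerivAt.comp (f := fun x : Q => ((1 : G), x)) q hS
      ((hasMFDerivAt_const (1 : G) q).prodMk (hasMFDerivAt_id q))) (hasMFDerivAt_smul_const EG 1 q)
  rw [actMap_one] at h2
  suffices e : S = (zeta EG E G q).comp (ContinuousLinearMap.fst ℝ EG E) +
      ContinuousLinearMap.snd ℝ EG E by
    rw [← e]
    exact hS
  refine ContinuousLinearMap.ext fun x => ?_
  have h3 : S (x.1, 0) = zeta EG E G q x.1 := congrArg (fun T : EG →L[ℝ] E => T x.1) h1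
  have h4 : S (0, x.2) = x.2 := congrArg (fun T : E →L[ℝ] E => T x.2) h2
  have h5 : S x = S (x.1, 0) + S (0, x.2) := by
    rw [← map_add]
    simp
  rw [h5, h3, h4]
  rfl

/-- The map `(X, (q, v)) ↦ (q, v + ζ_X(q))`. -/
def addFundamental (G : Type*) [Group G] [TopologicalSpace G] [ChartedSpace EG G]
    [LieGroup 𝓘(ℝ, EG) ∞ G] [MulAction G Q] [ContMDiffSMul 𝓘(ℝ, EG) 𝓘(ℝ, E) ∞ G Q]
    (x : EG × TangentBundle 𝓘(ℝ, E) Q) : TangentBundle 𝓘(ℝ, E) Q :=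
  ⟨x.2.1, @HAdd.hAdd E E E _ (zeta EG E G x.2.1 x.1) x.2.2⟩

variable (EG E G Q) in
-- By `hasMFDerivAt_smul_pair`, this is the tangent map of the action G × Q → Q restricted to
-- vectors (X, v) at points (1, q). For v = 0 it yields the fundamental vector fields.
theorem contMDiff_addFundamental :
    ContMDiff (𝓘(ℝ, EG).prod 𝓘(ℝ, E).tangent) 𝓘(ℝ, E).tangent ∞
      (addFundamental G : EG × TangentBundle 𝓘(ℝ, E) Q → TangentBundle 𝓘(ℝ, E) Q) := by
  have hsm : ContMDiff (𝓘(ℝ, EG).prod 𝓘(ℝ, E)) 𝓘(ℝ, E) ∞ (fun p : G × Q => p.1 • p.2) :=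
    contMDiff_smul (I := 𝓘(ℝ, EG)) (I' := 𝓘(ℝ, E)) (n := ∞)
  have h1 := hsm.contMDiff_tangentMap (m := ∞) (by simp)
  have h2 : ContMDiff (𝓘(ℝ, EG).tangent.prod 𝓘(ℝ, E).tangent) (𝓘(ℝ, EG).prod 𝓘(ℝ, E)).tangent ∞
    (equivTangentBundleProd 𝓘(ℝ, EG) G 𝓘(ℝ, E) Q).symm := contMDiff_equivTangentBundleProd_symm
  have h3 : ContMDiff (𝓘(ℝ, EG).prod 𝓘(ℝ, E).tangent) (𝓘(ℝ, EG).tangent.prod 𝓘(ℝ, E).tangent) ∞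
      (fun x : EG × TangentBundle 𝓘(ℝ, E) Q =>
        ((⟨(1 : G), x.1⟩ : TangentBundle 𝓘(ℝ, EG) G), x.2)) :=
    ((contMDiff_tangentSpace_inclusion (1 : G)).comp contMDiff_fst).prodMk contMDiff_snd
  refine ((h1.comp h2).comp h3).congr fun x => ?_
  refine TotalSpace.ext (one_smul G x.2.1).symm (heq_of_eq ?_)
  have h := (hasMFDerivAt_smul_pair (EG := EG) (E := E) (G := G) x.2.1).mfderiv
  exact (congrArg (fun T : EG × E →L[ℝ] E => T (x.1, x.2.2)) h).symm

theorem contMDiff_fundamental (X : EG) :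
    ContMDiff 𝓘(ℝ, E) 𝓘(ℝ, E).tangent ∞
      (fun q : Q => (⟨q, zeta EG E G q X⟩ : TangentBundle 𝓘(ℝ, E) Q)) := by
  have h : ContMDiff 𝓘(ℝ, E) (𝓘(ℝ, EG).prod 𝓘(ℝ, E).tangent) ∞
      (fun q : Q => (X, zeroSection E (TangentSpace 𝓘(ℝ, E)) q)) :=
    contMDiff_const.prodMk (contMDiff_zeroSection ℝ (TangentSpace 𝓘(ℝ, E)))
  refine ((contMDiff_addFundamental EG E G Q).comp h).congr fun q => ?_
  refine TotalSpace.ext rfl (heq_of_eq ?_)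
  exact (add_zero (zeta EG E G q X)).symm

end Lifts

theorem HasLocalSmoothExtensions.of_contMDiff {E₁ H₁ E₂ H₂ : Type*} [NormedAddCommGroup E₁]
    [NormedSpace ℝ E₁] [TopologicalSpace H₁] {J₁ : ModelWithCorners ℝ E₁ H₁}
    [NormedAddCommGroup E₂] [NormedSpace ℝ E₂] [TopologicalSpace H₂]
    {J₂ : ModelWithCorners ℝ E₂ H₂} {M₁ M₂ P₁ P₂ : Type*} [TopologicalSpace M₁] [ChartedSpace H₁ M₁]
    [TopologicalSpace M₂] [ChartedSpace H₂ M₂] {e₁ : P₁ → M₁} {e₂ : P₂ → M₂} {σ : P₁ → P₂}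
    (R : M₁ → M₂) (hR : ContMDiff J₁ J₂ ∞ R) (h : ∀ b, R (e₁ b) = e₂ (σ b)) :
    HasLocalSmoothExtensions J₁ J₂ e₁ e₂ σ :=
  fun _ => ⟨univ, isOpen_univ, mem_univ _, R, hR.contMDiffOn, fun b _ => h b⟩

/-! ### Smooth extensions of the tangent splitting and its inverse -/

section SmoothLifts

variable {EG : Type*} [NormedAddCommGroup EG] [NormedSpace ℝ EG] [FiniteDimensional ℝ EG]
  {E : Type*} [NormedAddCommGroup E] [NormedSpace ℝ E] [FiniteDimensional ℝ E]
  {F : Type*} [NormedAddCommGroup F] [NormedSpace ℝ F]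
  {G : Type*} [Group G] [TopologicalSpace G] [ChartedSpace EG G] [LieGroup 𝓘(ℝ, EG) ∞ G]
  {Q : Type*} [TopologicalSpace Q] [T2Space Q] [ChartedSpace E Q] [IsManifold 𝓘(ℝ, E) ∞ Q]
  [MulAction G Q] [ContMDiffSMul 𝓘(ℝ, EG) 𝓘(ℝ, E) ∞ G Q] [ProperSMul G Q]
  [ChartedSpace F (BaseSpace G Q)] [IsManifold 𝓘(ℝ, F) ∞ (BaseSpace G Q)]

variable (EG F G Q) in
/-- The fibre product `T(Q/G) ×_{Q/G} Q × 𝔤`. -/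
abbrev TangentTotal : Type _ :=
  {x : TangentBundle 𝓘(ℝ, F) (BaseSpace G Q) × (Q × LieAlg EG G) // x.1.1 = baseProj G x.2.1}

/-- The projection `T(Q/G) ×_{Q/G} Q × 𝔤 → T(Q/G) ×_{Q/G} (⨆_q 𝔤/𝔤_q)/G`. -/
def tangentTotalProj (x : TangentTotal EG F G Q) : TangentWeinstein EG E F G Q :=
  ⟨(x.1.1, OrbitSpace.mk _ (IsotropyQuotient.mk' EG x.1.2.1 x.1.2.2)), x.2⟩

theorem smooth_baseProj
    (hπ : IsSubmersion 𝓘(ℝ, E) 𝓘(ℝ, F) ∞ (baseProj G : Q → BaseSpace G Q)) :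
    ContMDiff 𝓘(ℝ, E) 𝓘(ℝ, F) ∞ (baseProj G : Q → BaseSpace G Q) := hπ.contMDiff

theorem contMDiff_tangentMap_baseProj
    (hπ : IsSubmersion 𝓘(ℝ, E) 𝓘(ℝ, F) ∞ (baseProj G : Q → BaseSpace G Q)) :
    ContMDiff 𝓘(ℝ, E).tangent 𝓘(ℝ, F).tangent ∞ (fun x : TangentBundle 𝓘(ℝ, E) Q =>
      (⟨baseProj G x.1, projMap E F G x.1 x.2⟩ : TangentBundle 𝓘(ℝ, F) (BaseSpace G Q))) :=
  (smooth_baseProj hπ).contMDiff_tangentMap (by simp)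

namespace GeneralizedConnection

variable (F) in
/-- The map `(q, v) ↦ (Tπ(q, v), (q, A_q(v)))`. -/
def tangentSplit (A : GeneralizedConnection EG E G Q) (x : TangentBundle 𝓘(ℝ, E) Q) :
    TangentTotal EG F G Q :=
  ⟨(⟨baseProj G x.1, projMap E F G x.1 x.2⟩, (x.1, A.conn x.1 x.2)), rfl⟩

/-- The map `(u, (q, X)) ↦ (q, C_q(u) + ζ_X(q))`. -/
def tangentMerge (A : GeneralizedConnection EG E G Q) (x : TangentTotal EG F G Q) :
    TangentBundle 𝓘(ℝ, E) Q :=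
  ⟨x.1.2.1, A.horMap F x.1.2.1 x.1.1.2 + zeta EG E G x.1.2.1 x.1.2.2⟩

theorem hasLocalSmoothExtensions_tangentSplit (A : GeneralizedConnection EG E G Q)
    (hπ : IsSubmersion 𝓘(ℝ, E) 𝓘(ℝ, F) ∞ (baseProj G : Q → BaseSpace G Q)) :
    HasLocalSmoothExtensions 𝓘(ℝ, E).tangent (𝓘(ℝ, F).tangent.prod (𝓘(ℝ, E).prod 𝓘(ℝ, EG)))
      (fun x : TangentBundle 𝓘(ℝ, E) Q => x)
      (Subtype.val : TangentTotal EG F G Q →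
        TangentBundle 𝓘(ℝ, F) (BaseSpace G Q) × (Q × LieAlg EG G)) (A.tangentSplit F) :=
  .of_contMDiff (fun x => (A.tangentSplit F x).1)
    ((contMDiff_tangentMap_baseProj hπ).prodMk
      ((contMDiff_proj (TangentSpace 𝓘(ℝ, E))).prodMk A.smooth)) fun _ => rfl

theorem tangentMerge_eq_of_projMap_eq (A : GeneralizedConnection EG E G Q)
    (hπ : IsSubmersion 𝓘(ℝ, E) 𝓘(ℝ, F) ∞ (baseProj G : Q → BaseSpace G Q)) {q q' : Q} {w : E}
    {u : F} (X : EG) (h : q' = q) (hw : projMap E F G q' w = u) :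
    addFundamental G (X - A.conn q' w, (⟨q', w⟩ : TangentBundle 𝓘(ℝ, E) Q)) =
      ⟨q, A.horMap F q u + zeta EG E G q X⟩ := by
  subst h
  refine TotalSpace.ext rfl (heq_of_eq ?_)
  have e : zeta EG E G q' (X - A.conn q' w) + w = A.horMap F q' u + zeta EG E G q' X := by
    rw [A.eq_horMap_add hπ hw, map_sub]
    abel
  exact e

/-- If w is any lift of u, then C(u) + ζ(X) = w + ζ(X - A w). The right side makes sense off the
fibre product as soon as w depends smoothly on u and q, which local sections of π provide. -/
theorem hasLocalSmoothExtensions_tangentMerge (A : GeneralizedConnection EG E G Q)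
    (hπ : IsSubmersion 𝓘(ℝ, E) 𝓘(ℝ, F) ∞ (baseProj G : Q → BaseSpace G Q)) :
    HasLocalSmoothExtensions (𝓘(ℝ, F).tangent.prod (𝓘(ℝ, E).prod 𝓘(ℝ, EG))) 𝓘(ℝ, E).tangent
      (Subtype.val : TangentTotal EG F G Q →
        TangentBundle 𝓘(ℝ, F) (BaseSpace G Q) × (Q × LieAlg EG G))
      (fun x : TangentBundle 𝓘(ℝ, E) Q => x) A.tangentMerge := by
  rintro ⟨⟨⟨y, u⟩, q, X⟩, hy⟩
  change y = baseProj G q at hy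
  subst hy
  obtain ⟨O, s, hO, hq, hs, hs1, hs2⟩ := exists_local_sections_of_isSubmersionAt
    (hπ.isSubmersionAt q)
  -- The tangent vector (u, 0) at (y, q); its image under Ts is the lift w of u, since π ∘ s is the
  -- first projection.
  let ι : TangentBundle 𝓘(ℝ, F) (BaseSpace G Q) × (Q × LieAlg EG G) →
      TangentBundle (𝓘(ℝ, F).prod 𝓘(ℝ, E)) (BaseSpace G Q × Q) :=
    fun x => (equivTangentBundleProd 𝓘(ℝ, F) (BaseSpace G Q) 𝓘(ℝ, E) Q).symm
      (x.1, zeroSection E (TangentSpace 𝓘(ℝ, E)) x.2.1)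
  have hι : ContMDiff (𝓘(ℝ, F).tangent.prod (𝓘(ℝ, E).prod 𝓘(ℝ, EG)))
      (𝓘(ℝ, F).prod 𝓘(ℝ, E)).tangent ∞ ι := by
    have h2 : ContMDiff (𝓘(ℝ, F).tangent.prod 𝓘(ℝ, E).tangent) (𝓘(ℝ, F).prod 𝓘(ℝ, E)).tangent ∞
      (equivTangentBundleProd 𝓘(ℝ, F) (BaseSpace G Q) 𝓘(ℝ, E) Q).symm :=
      contMDiff_equivTangentBundleProd_symm
    exact h2.comp (contMDiff_fst.prodMk
      ((contMDiff_zeroSection ℝ (TangentSpace 𝓘(ℝ, E))).comp (contMDiff_fst.comp contMDiff_snd)))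
  have hTs := hs.contMDiffOn_tangentMapWithin (m := ∞) (by simp) hO.uniqueMDiffOn
  let U : Set (TangentBundle 𝓘(ℝ, F) (BaseSpace G Q) × (Q × LieAlg EG G)) :=
    ι ⁻¹' (π (F × E) (TangentSpace (𝓘(ℝ, F).prod 𝓘(ℝ, E))) ⁻¹' O)
  have hU : IsOpen U :=
    (hO.preimage (FiberBundle.continuous_proj _ _)).preimage hι.continuous
  let τ : TangentBundle 𝓘(ℝ, F) (BaseSpace G Q) × (Q × LieAlg EG G) → TangentBundle 𝓘(ℝ, E) Q :=
    fun x => tangentMapWithin (𝓘(ℝ, F).prod 𝓘(ℝ, E)) 𝓘(ℝ, E) s O (ι x)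
  have hτ : ContMDiffOn (𝓘(ℝ, F).tangent.prod (𝓘(ℝ, E).prod 𝓘(ℝ, EG))) 𝓘(ℝ, E).tangent ∞ τ U :=
    hTs.comp hι.contMDiffOn fun x hx => hx
  have hAτ : ContMDiffOn (𝓘(ℝ, F).tangent.prod (𝓘(ℝ, E).prod 𝓘(ℝ, EG))) 𝓘(ℝ, EG) ∞
      (fun x => (A.form (τ x).1 (τ x).2 : EG)) U := A.smooth.comp_contMDiffOn hτ
  have hX : ContMDiffOn (𝓘(ℝ, F).tangent.prod (𝓘(ℝ, E).prod 𝓘(ℝ, EG))) 𝓘(ℝ, EG) ∞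
      (fun x : TangentBundle 𝓘(ℝ, F) (BaseSpace G Q) × (Q × LieAlg EG G) => (x.2.2 : EG)) U :=
    (contMDiff_snd.comp contMDiff_snd).contMDiffOn
  refine ⟨U, hU, hq, fun x => addFundamental G ((x.2.2 : EG) - (A.form (τ x).1 (τ x).2 : EG), τ x),
    (contMDiff_addFundamental EG E G Q).comp_contMDiffOn ((hX.sub hAτ).prodMk hτ), ?_⟩
  rintro ⟨⟨⟨y, u⟩, q, X⟩, hy⟩ hb
  change y = baseProj G q at hy
  subst hy
  have hp : ((baseProj G q : BaseSpace G Q), q) ∈ O := hb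
  obtain ⟨S, hS⟩ : ∃ S : F × E →L[ℝ] E,
      HasMFDerivAt (𝓘(ℝ, F).prod 𝓘(ℝ, E)) 𝓘(ℝ, E) s (baseProj G q, q) S :=
    ⟨_, ((hs.contMDiffAt (hO.mem_nhds hp)).mdifferentiableAt (by simp)).hasMFDerivAt⟩
  have hd : (mfderivWithin (𝓘(ℝ, F).prod 𝓘(ℝ, E)) 𝓘(ℝ, E) s O (baseProj G q, q) : F × E →L[ℝ] E) =
      S := by
    rw [mfderivWithin_of_isOpen hO hp]
    exact hS.mfderiv
  have h1 := HasMFDerivAt.comp (baseProj G q, q) (hasMFDerivAt_baseProj hπ (s (baseProj G q, q))) hS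
  have h2 : (baseProj G : Q → BaseSpace G Q) ∘ s =ᶠ[nhds (baseProj G q, q)] Prod.fst := by
    filter_upwards [hO.mem_nhds hp] with x hx using hs1 x hx
  have h3 := hasMFDerivAt_unique (h1.congr_of_eventuallyEq h2.symm) (hasMFDerivAt_fst _)
  have h4 : projMap E F G (s (baseProj G q, q)) (S ((u : F), (0 : E))) = u :=
    congrArg (fun T : F × E →L[ℝ] F => T ((u : F), (0 : E))) h3
  refine Eq.trans ?_ (A.tangentMerge_eq_of_projMap_eq hπ X (hs2 q hp) h4)
  rw [← hd]
  rfl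

end GeneralizedConnection

end SmoothLifts

/-! ### Smooth extensions of ψ and its inverse -/

section SmoothCotangentLifts

variable {EG : Type*} [NormedAddCommGroup EG] [NormedSpace ℝ EG] [FiniteDimensional ℝ EG]
  {E : Type*} [NormedAddCommGroup E] [NormedSpace ℝ E] [FiniteDimensional ℝ E]
  {F : Type*} [NormedAddCommGroup F] [NormedSpace ℝ F] [FiniteDimensional ℝ F]
  {G : Type*} [Group G] [TopologicalSpace G] [ChartedSpace EG G] [LieGroup 𝓘(ℝ, EG) ∞ G]
  {Q : Type*} [TopologicalSpace Q] [T2Space Q] [ChartedSpace E Q] [IsManifold 𝓘(ℝ, E) ∞ Q]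
  [MulAction G Q] [ContMDiffSMul 𝓘(ℝ, EG) 𝓘(ℝ, E) ∞ G Q] [ProperSMul G Q]
  [ChartedSpace F (BaseSpace G Q)] [IsManifold 𝓘(ℝ, F) ∞ (BaseSpace G Q)]

theorem contMDiffAt_localFrame {x₀ x : Q} (hx : x ∈ (chartAt E x₀).source) (v : E) :
    ContMDiffAt 𝓘(ℝ, E) 𝓘(ℝ, E).tangent ∞ (localFrame x₀ v) x :=
  (contMDiffOn_localFrame x₀ v).contMDiffAt ((chartAt E x₀).open_source.mem_nhds hx)

theorem contMDiff_cotangent_proj :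
    ContMDiff (𝓘(ℝ, E).prod 𝓘(ℝ, E →L[ℝ] ℝ)) 𝓘(ℝ, E) ∞ (fun z : CotangentBundle E Q => z.1) :=
  contMDiff_proj _

theorem contMDiff_smul_const
    (EG : Type*) [NormedAddCommGroup EG] [NormedSpace ℝ EG] [ChartedSpace EG G]
    [ContMDiffSMul 𝓘(ℝ, EG) 𝓘(ℝ, E) ∞ G Q] (g : G) :
    ContMDiff 𝓘(ℝ, E) 𝓘(ℝ, E) ∞ (fun x : Q => g • x) :=
  ContMDiffSMul.contMDiff_const_smul (I := 𝓘(ℝ, EG)) g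

theorem contMDiff_cotangentAction (g : G) :
    ContMDiff (𝓘(ℝ, E).prod 𝓘(ℝ, E →L[ℝ] ℝ)) (𝓘(ℝ, E).prod 𝓘(ℝ, E →L[ℝ] ℝ)) ∞
      ((cotangentAction EG E (G := G) (Q := Q)).smul g) := by
  intro z₀
  have hb : ContMDiff (𝓘(ℝ, E).prod 𝓘(ℝ, E →L[ℝ] ℝ)) 𝓘(ℝ, E) ∞
      (fun z : CotangentBundle E Q => g • z.1) :=
    (contMDiff_smul_const EG g).comp contMDiff_cotangent_proj
  refine contMDiffAt_cotangent_of_apply hb.contMDiffAt fun v => ?_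
  have hT : ContMDiff 𝓘(ℝ, E).tangent 𝓘(ℝ, E).tangent ∞
      (tangentMap 𝓘(ℝ, E) 𝓘(ℝ, E) (fun x : Q => g⁻¹ • x)) :=
    (contMDiff_smul_const EG g⁻¹).contMDiff_tangentMap (by simp)
  have hV : ContMDiffAt (𝓘(ℝ, E).prod 𝓘(ℝ, E →L[ℝ] ℝ)) 𝓘(ℝ, E).tangent ∞
      (fun z : CotangentBundle E Q => tangentMap 𝓘(ℝ, E) 𝓘(ℝ, E) (fun x : Q => g⁻¹ • x)
        (localFrame (g • z₀.1) v (g • z.1))) z₀ :=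
    hT.contMDiffAt.comp z₀ ((contMDiffAt_localFrame (mem_chart_source E _) v).comp z₀ hb.contMDiffAt)
  exact ContMDiffAt.cotangent_apply (f := fun z : CotangentBundle E Q => z) contMDiffAt_id hV
    (Filter.Eventually.of_forall fun z => inv_smul_smul g z.1)

theorem contMDiff_momentum :
    ContMDiff (𝓘(ℝ, E).prod 𝓘(ℝ, E →L[ℝ] ℝ)) 𝓘(ℝ, EG →L[ℝ] ℝ) ∞
      (fun z : CotangentBundle E Q => (momentum EG (G := G) z : EG →L[ℝ] ℝ)) := by
  intro z₀
  refine contMDiffAt_clm_of_apply fun X => ?_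
  exact ContMDiffAt.cotangent_apply (f := fun z : CotangentBundle E Q => z) contMDiffAt_id
    (((contMDiff_fundamental (E := E) (G := G) X).comp contMDiff_cotangent_proj).contMDiffAt)
    (Filter.Eventually.of_forall fun z => rfl)

namespace GeneralizedConnection

theorem contMDiff_dualLift (A : GeneralizedConnection EG E G Q)
    (hπ : IsSubmersion 𝓘(ℝ, E) 𝓘(ℝ, F) ∞ (baseProj G : Q → BaseSpace G Q)) :
    ContMDiff (𝓘(ℝ, E).prod 𝓘(ℝ, E →L[ℝ] ℝ)) (𝓘(ℝ, F).prod 𝓘(ℝ, F →L[ℝ] ℝ)) ∞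
      (A.dualLift F) := by
  intro z₀
  have hb : ContMDiff (𝓘(ℝ, E).prod 𝓘(ℝ, E →L[ℝ] ℝ)) 𝓘(ℝ, F) ∞
      (fun z : CotangentBundle E Q => (baseProj G z.1 : BaseSpace G Q)) :=
    (smooth_baseProj hπ).comp contMDiff_cotangent_proj
  refine contMDiffAt_cotangent_of_apply hb.contMDiffAt fun v => ?_
  -- With X = 0, `tangentMerge` is the horizontal lift of a local frame of Q/G; the pairing of C_q^*
  -- p with the frame is that of p with this lift.
  let ξ : CotangentBundle E Q → TangentTotal EG F G Q := fun z =>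
    ⟨(localFrame (baseProj G z₀.1) v (baseProj G z.1), (z.1, (0 : EG))), rfl⟩
  have hξ : ContMDiffAt (𝓘(ℝ, E).prod 𝓘(ℝ, E →L[ℝ] ℝ))
      (𝓘(ℝ, F).tangent.prod (𝓘(ℝ, E).prod 𝓘(ℝ, EG))) ∞ (fun z => (ξ z).1) z₀ :=
    ((contMDiffAt_localFrame (mem_chart_source F _) v).comp z₀ hb.contMDiffAt).prodMk
      (contMDiff_cotangent_proj.contMDiffAt.prodMk contMDiffAt_const)
  obtain ⟨U, hU, haU, R, hR, hRξ⟩ := A.hasLocalSmoothExtensions_tangentMerge hπ (ξ z₀)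
  have hV : ContMDiffAt (𝓘(ℝ, E).prod 𝓘(ℝ, E →L[ℝ] ℝ)) 𝓘(ℝ, E).tangent ∞
      (fun z => R (ξ z).1) z₀ :=
    ContMDiffAt.comp z₀ (g := R) (hR.contMDiffAt (hU.mem_nhds haU)) hξ
  have hev : ∀ᶠ z in nhds z₀, R (ξ z).1 = A.tangentMerge (ξ z) := by
    filter_upwards [hξ.continuousAt.eventually (hU.mem_nhds haU)] with z hz using hRξ _ hz
  have hV' : ContMDiffAt (𝓘(ℝ, E).prod 𝓘(ℝ, E →L[ℝ] ℝ)) 𝓘(ℝ, E).tangent ∞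
      (fun z => A.tangentMerge (ξ z)) z₀ := hV.congr_of_eventuallyEq (hev.mono fun z hz => hz.symm)
  refine (ContMDiffAt.cotangent_apply (f := fun z : CotangentBundle E Q => z) contMDiffAt_id
    hV' (Filter.Eventually.of_forall fun z => rfl)).congr_of_eventuallyEq
    (Filter.Eventually.of_forall fun z => ?_)
  have e : ∀ u : F, (z.2 : E →L[ℝ] ℝ) (A.horMap F z.1 u) =
      (z.2 : E →L[ℝ] ℝ) (A.horMap F z.1 u + zeta EG E G z.1 (0 : EG)) := by
    intro u
    rw [map_zero, add_zero]
  exact e _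

theorem hasLocalSmoothExtensions_weinsteinIsoInv (A : GeneralizedConnection EG E G Q)
    (hπ : IsSubmersion 𝓘(ℝ, E) 𝓘(ℝ, F) ∞ (baseProj G : Q → BaseSpace G Q)) :
    HasLocalSmoothExtensions (𝓘(ℝ, E).prod 𝓘(ℝ, E →L[ℝ] ℝ))
      (𝓘(ℝ, E).prod ((𝓘(ℝ, F).prod 𝓘(ℝ, F →L[ℝ] ℝ)).prod 𝓘(ℝ, EG →L[ℝ] ℝ)))
      (fun z : CotangentBundle E Q => z)
      (Subtype.val : WeinsteinTotal EG E F G Q →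
        Q × (CotangentBundle F (BaseSpace G Q) × (LieAlg EG G →L[ℝ] ℝ))) (A.weinsteinIsoInv F) :=
  .of_contMDiff (fun z => (A.weinsteinIsoInv F z).1)
    (contMDiff_cotangent_proj.prodMk ((A.contMDiff_dualLift hπ).prodMk contMDiff_momentum))
    fun _ => rfl

theorem hasLocalSmoothExtensions_weinsteinIso (A : GeneralizedConnection EG E G Q)
    (hπ : IsSubmersion 𝓘(ℝ, E) 𝓘(ℝ, F) ∞ (baseProj G : Q → BaseSpace G Q)) :
    HasLocalSmoothExtensions
      (𝓘(ℝ, E).prod ((𝓘(ℝ, F).prod 𝓘(ℝ, F →L[ℝ] ℝ)).prod 𝓘(ℝ, EG →L[ℝ] ℝ)))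
      (𝓘(ℝ, E).prod 𝓘(ℝ, E →L[ℝ] ℝ))
      (Subtype.val : WeinsteinTotal EG E F G Q →
        Q × (CotangentBundle F (BaseSpace G Q) × (LieAlg EG G →L[ℝ] ℝ)))
      (fun z : CotangentBundle E Q => z) A.weinsteinIso := by
  rintro ⟨⟨q, ⟨y, η⟩, l⟩, hy, hl⟩
  change y = baseProj G q at hy
  subst hy
  set y₀ : BaseSpace G Q := baseProj G q with hy₀
  let JW := 𝓘(ℝ, E).prod ((𝓘(ℝ, F).prod 𝓘(ℝ, F →L[ℝ] ℝ)).prod 𝓘(ℝ, EG →L[ℝ] ℝ))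
  have hq : ContMDiff JW 𝓘(ℝ, E) ∞
    (fun m : Q × (CotangentBundle F (BaseSpace G Q) × (EG →L[ℝ] ℝ)) => m.1) := contMDiff_fst
  have hη : ContMDiff JW (𝓘(ℝ, F).prod 𝓘(ℝ, F →L[ℝ] ℝ)) ∞
    (fun m : Q × (CotangentBundle F (BaseSpace G Q) × (EG →L[ℝ] ℝ)) => m.2.1) :=
    contMDiff_fst.comp contMDiff_snd
  have hl' : ContMDiff JW 𝓘(ℝ, EG →L[ℝ] ℝ) ∞
    (fun m : Q × (CotangentBundle F (BaseSpace G Q) × (EG →L[ℝ] ℝ)) => m.2.2) :=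
    contMDiff_snd.comp contMDiff_snd
  have hηb : ContMDiff JW 𝓘(ℝ, F) ∞
    (fun m : Q × (CotangentBundle F (BaseSpace G Q) × (EG →L[ℝ] ℝ)) => m.2.1.1) :=
    contMDiff_cotangent_proj.comp hη
  have hπq : ContMDiff JW 𝓘(ℝ, F) ∞
    (fun m : Q × (CotangentBundle F (BaseSpace G Q) × (EG →L[ℝ] ℝ)) =>
      (baseProj G m.1 : BaseSpace G Q)) := (smooth_baseProj hπ).comp hq
  let U : Set (Q × (CotangentBundle F (BaseSpace G Q) × (EG →L[ℝ] ℝ))) :=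
    {m | m.2.1.1 ∈ (chartAt F y₀).source} ∩ {m | baseProj G m.1 ∈ (chartAt F y₀).source}
  have hU : IsOpen U := ((chartAt F y₀).open_source.preimage hηb.continuous).inter
    ((chartAt F y₀).open_source.preimage hπq.continuous)
  -- Off 𝒲 the foot point of η need not be π(q), so η cannot be composed with T_qπ directly. The
  -- trivialization at `y₀` moves vectors from π(q) to the foot point of η; on 𝒲 this transport is
  -- the identity.
  let R : Q × (CotangentBundle F (BaseSpace G Q) × (EG →L[ℝ] ℝ)) → CotangentBundle E Q := fun m =>
    ⟨m.1, ((ContinuousLinearMap.comp (m.2.1.2 : F →L[ℝ] ℝ)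
        ((trivializationAt F (TangentSpace 𝓘(ℝ, F)) y₀).symmL ℝ m.2.1.1 : F →L[ℝ] F)).comp
        (((trivializationAt F (TangentSpace 𝓘(ℝ, F)) y₀).continuousLinearMapAt ℝ
          (baseProj G m.1) : F →L[ℝ] F).comp (projMap E F G m.1))) +
        (m.2.2).comp (A.conn m.1)⟩
  have hR : ContMDiffOn JW (𝓘(ℝ, E).prod 𝓘(ℝ, E →L[ℝ] ℝ)) ∞ R U := by
    rintro m ⟨hm1, hm2⟩
    refine ContMDiffAt.contMDiffWithinAt ?_
    refine contMDiffAt_cotangent_of_apply hq.contMDiffAt fun v => ?_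
    have hVv : ContMDiffAt JW 𝓘(ℝ, E).tangent ∞
        (fun m' : Q × (CotangentBundle F (BaseSpace G Q) × (EG →L[ℝ] ℝ)) =>
          localFrame m.1 v m'.1) m :=
      (contMDiffAt_localFrame (mem_chart_source E _) v).comp m hq.contMDiffAt
    have h1 : ContMDiffAt JW 𝓘(ℝ, F →L[ℝ] ℝ) ∞
        (fun m' : Q × (CotangentBundle F (BaseSpace G Q) × (EG →L[ℝ] ℝ)) =>
          ContinuousLinearMap.comp (m'.2.1.2 : F →L[ℝ] ℝ)
            ((trivializationAt F (TangentSpace 𝓘(ℝ, F)) y₀).symmL ℝ m'.2.1.1 : F →L[ℝ] F)) m := by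
      refine contMDiffAt_clm_of_apply fun w => ?_
      exact ContMDiffAt.cotangent_apply
        (f := fun m' : Q × (CotangentBundle F (BaseSpace G Q) × (EG →L[ℝ] ℝ)) => m'.2.1)
        hη.contMDiffAt ((contMDiffAt_localFrame hm1 w).comp m hηb.contMDiffAt)
        (Filter.Eventually.of_forall fun _ => rfl)
    have h2 : ContMDiffAt JW 𝓘(ℝ, F).tangent ∞
        (fun m' : Q × (CotangentBundle F (BaseSpace G Q) × (EG →L[ℝ] ℝ)) =>
          (⟨baseProj G m'.1, projMap E F G m'.1 (localFrame m.1 v m'.1).2⟩ :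
            TangentBundle 𝓘(ℝ, F) (BaseSpace G Q))) m :=
      (contMDiff_tangentMap_baseProj hπ).contMDiffAt.comp m hVv
    have hsrc : (⟨baseProj G m.1, projMap E F G m.1 (localFrame m.1 v m.1).2⟩ :
        TangentBundle 𝓘(ℝ, F) (BaseSpace G Q)) ∈
          (trivializationAt F (TangentSpace 𝓘(ℝ, F)) y₀).source :=
      ((trivializationAt F (TangentSpace 𝓘(ℝ, F)) y₀).mem_source).2 hm2
    have h3 := (((trivializationAt F (TangentSpace 𝓘(ℝ, F)) y₀).contMDiffAt_iff
      (f := fun m' : Q × (CotangentBundle F (BaseSpace G Q) × (EG →L[ℝ] ℝ)) =>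
        (⟨baseProj G m'.1, projMap E F G m'.1 (localFrame m.1 v m'.1).2⟩ :
          TangentBundle 𝓘(ℝ, F) (BaseSpace G Q))) hsrc).1 h2).2
    have h4 : ContMDiffAt JW 𝓘(ℝ, EG) ∞
        (fun m' : Q × (CotangentBundle F (BaseSpace G Q) × (EG →L[ℝ] ℝ)) =>
          (A.form (localFrame m.1 v m'.1).1 (localFrame m.1 v m'.1).2 : EG)) m :=
      A.smooth.contMDiffAt.comp m hVv
    refine ((h1.clm_apply h3).add (hl'.contMDiffAt.clm_apply h4)).congr_of_eventuallyEq ?_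
    have h5 : ∀ᶠ m' in nhds m, baseProj G m'.1 ∈ (chartAt F y₀).source :=
      hπq.continuous.continuousAt.eventually ((chartAt F y₀).open_source.mem_nhds hm2)
    filter_upwards [h5] with m' hm'
    have e := trivializationAt_apply_snd (E := F) hm' (projMap E F G m'.1 (localFrame m.1 v m'.1).2)
    have e' := congrArg (ContinuousLinearMap.comp (m'.2.1.2 : F →L[ℝ] ℝ)
      ((trivializationAt F (TangentSpace 𝓘(ℝ, F)) y₀).symmL ℝ m'.2.1.1 : F →L[ℝ] F)) e
    exact congrArg (fun t : ℝ => t + m'.2.2 (A.conn m'.1 (localFrame m.1 v m'.1).2)) e'.symm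
  refine ⟨U, hU, ⟨mem_chart_source F y₀, mem_chart_source F y₀⟩, R, hR, ?_⟩
  rintro ⟨⟨q, ⟨y, η⟩, l⟩, hy, hl⟩ ⟨hm1, hm2⟩
  change y = baseProj G q at hy
  subst hy
  refine TotalSpace.ext rfl (heq_of_eq ?_)
  refine ContinuousLinearMap.ext fun v => ?_
  have e := (trivializationAt F (TangentSpace 𝓘(ℝ, F)) y₀).symmL_continuousLinearMapAt (R := ℝ)
    hm2 (projMap E F G q v)
  exact congrArg (fun t : F => (η : F →L[ℝ] ℝ) t + l (A.conn q v)) e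

end GeneralizedConnection

end SmoothCotangentLifts

/-! ### Open quotient maps -/

section QuotientMaps

theorem isOpenQuotientMap_orbitSpace_mk {G X : Type*} [Group G] [TopologicalSpace X]
    (a : MulAction G X) (h : ∀ g, Continuous (a.smul g)) : IsOpenQuotientMap (OrbitSpace.mk a) := by
  let := a
  have : ContinuousConstSMul G X := ⟨h⟩
  exact MulAction.isOpenQuotientMap_quotientMk

theorem IsOpenQuotientMap.restrictPreimage' {X Y : Type*} [TopologicalSpace X] [TopologicalSpace Y]
    {f : X → Y} (hf : IsOpenQuotientMap f) (s : Set Y) : IsOpenQuotientMap (s.restrictPreimage f) where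
  surjective := hf.surjective.restrictPreimage s
  continuous := hf.continuous.restrictPreimage
  isOpenMap := hf.isOpenMap.restrictPreimage s

end QuotientMaps

/-! ### Quotient topologies, equivariance and equality of isotropy groups -/

section Equivariance

variable {EG : Type*} [NormedAddCommGroup EG] [NormedSpace ℝ EG] [FiniteDimensional ℝ EG]
  {E : Type*} [NormedAddCommGroup E] [NormedSpace ℝ E] [FiniteDimensional ℝ E]
  {F : Type*} [NormedAddCommGroup F] [NormedSpace ℝ F] [FiniteDimensional ℝ F]
  {G : Type*} [Group G] [TopologicalSpace G] [ChartedSpace EG G] [LieGroup 𝓘(ℝ, EG) ∞ G]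
  {Q : Type*} [TopologicalSpace Q] [T2Space Q] [ChartedSpace E Q] [IsManifold 𝓘(ℝ, E) ∞ Q]
  [MulAction G Q] [ContMDiffSMul 𝓘(ℝ, EG) 𝓘(ℝ, E) ∞ G Q] [ProperSMul G Q]
  [ChartedSpace F (BaseSpace G Q)] [IsManifold 𝓘(ℝ, F) ∞ (BaseSpace G Q)]

/-- Classes modulo 𝔤_q are compared through their images under ζ_q, whose kernel is 𝔤_q. -/
theorem isotropyQuotient_mk'_eq_iff {q q' : Q} {X X' : EG} :
    IsotropyQuotient.mk' EG (E := E) (G := G) q X = IsotropyQuotient.mk' EG q' X' ↔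
      q = q' ∧ zeta EG E G q X = zeta EG E G q X' := by
  have key : ∀ q : Q, (Submodule.Quotient.mk X : EG ⧸ isotropyAlgebra EG E G q) =
      Submodule.Quotient.mk X' ↔ zeta EG E G q X = zeta EG E G q X' := by
    intro q
    rw [Submodule.Quotient.eq, ← sub_eq_zero (a := zeta EG E G q X), ← map_sub]
    rfl
  constructor
  · intro h
    obtain rfl : q = q' := congrArg IsotropyQuotient.base h
    refine ⟨rfl, (key q).1 ?_⟩
    unfold IsotropyQuotient.mk' at h
    injection h
  · rintro ⟨rfl, h⟩
    exact congrArg (IsotropyQuotient.mk q) ((key q).2 h)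

theorem isotropyQuotient_exists_rep (x : IsotropyQuotient EG E G Q) :
    ∃ q X, IsotropyQuotient.mk' EG q X = x := by
  obtain ⟨q, x⟩ := x
  obtain ⟨X, rfl⟩ := Submodule.Quotient.mk_surjective _ x
  exact ⟨q, X, rfl⟩

theorem continuous_isotropyQuotientAction (g : G) :
    Continuous ((isotropyQuotientAction EG E G Q).smul g) := by
  refine continuous_coinduced_dom.2 ?_
  have h : Continuous fun x : Q × EG => (g • x.1, adjointRep EG g x.2) :=
    ((contMDiff_smul_const (E := E) EG g).continuous.comp continuous_fst).prodMk
      ((adjointRep EG g).continuous.comp continuous_snd)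
  exact (continuous_coinduced_rng (f := fun x : Q × LieAlg EG G =>
    IsotropyQuotient.mk' EG (E := E) x.1 x.2)).comp h

/-- Each 𝔤_q is the image of the projection 1 - A ζ, which is continuous in q. The saturation of U
is thus a union of preimages of U under continuous fibrewise translations. -/
theorem GeneralizedConnection.isOpenQuotientMap_mk' (A : GeneralizedConnection EG E G Q) :
    IsOpenQuotientMap
      (fun x : Q × LieAlg EG G => IsotropyQuotient.mk' EG (E := E) (G := G) x.1 x.2) where
  surjective x := by
    obtain ⟨q, X, h⟩ := isotropyQuotient_exists_rep x
    exact ⟨(q, X), h⟩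
  continuous := continuous_coinduced_rng
  isOpenMap U hU := by
    refine isOpen_coinduced.2 ?_
    have e : (fun x : Q × LieAlg EG G => IsotropyQuotient.mk' EG (E := E) (G := G) x.1 x.2) ⁻¹'
        ((fun x : Q × LieAlg EG G => IsotropyQuotient.mk' EG (E := E) (G := G) x.1 x.2) '' U) =
        ⋃ Y : EG, (fun x : Q × EG => (x.1, x.2 + (Y - A.conn x.1 (zeta EG E G x.1 Y)))) ⁻¹' U := by
      ext ⟨q, X⟩
      simp only [mem_preimage, mem_image, mem_iUnion]
      constructor
      · rintro ⟨⟨q', X'⟩, hx, h⟩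
        obtain ⟨hq, hX⟩ := isotropyQuotient_mk'_eq_iff.1 h
        change q' = q at hq
        subst hq
        refine ⟨X' - X, ?_⟩
        change zeta EG E G q' X' = zeta EG E G q' X at hX
        change (q', X + (X' - X - A.conn q' (zeta EG E G q' (X' - X)))) ∈ U
        rw [map_sub, hX, sub_self, map_zero, sub_zero, add_sub_cancel]
        exact hx
      · rintro ⟨Y, hY⟩
        refine ⟨_, hY, isotropyQuotient_mk'_eq_iff.2 ⟨rfl, ?_⟩⟩
        change zeta EG E G q (X + (Y - A.conn q (zeta EG E G q Y))) = zeta EG E G q X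
        rw [map_add, map_sub, A.zeta_conn_zeta, sub_self, add_zero]
    rw [e]
    refine isOpen_iUnion fun Y => hU.preimage ?_
    have h1 : Continuous fun q : Q => A.conn q (zeta EG E G q Y) :=
      A.smooth.continuous.comp (contMDiff_fundamental (E := E) (G := G) Y).continuous
    exact continuous_fst.prodMk
      (continuous_snd.add (continuous_const.sub (h1.comp continuous_fst)))

/-- Openness matters here: unlike general quotient maps, open ones are stable under products and
under restriction to preimages, hence under passage to the fibre product. -/
theorem GeneralizedConnection.isQuotientMap_tangentTotalProj (A : GeneralizedConnection EG E G Q) :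
    Topology.IsQuotientMap
      (tangentTotalProj : TangentTotal EG F G Q → TangentWeinstein EG E F G Q) := by
  have h1 := (isOpenQuotientMap_orbitSpace_mk (isotropyQuotientAction EG E G Q)
    continuous_isotropyQuotientAction).comp A.isOpenQuotientMap_mk'
  have h2 := (IsOpenQuotientMap.id (X := TangentBundle 𝓘(ℝ, F) (BaseSpace G Q))).prodMap h1
  exact (h2.restrictPreimage' {y | y.1.1 = isotropyQuotientBase y.2}).isQuotientMap

theorem continuous_coadjoint (g : G) :
    Continuous (fun l : EG →L[ℝ] ℝ => coadjoint EG (G := G) g l) :=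
  (continuous_id.clm_comp continuous_const)

theorem continuous_annAction (g : G) : Continuous ((annAction EG E G Q).smul g) := by
  refine Continuous.subtype_mk (Continuous.prodMk ?_ ?_) _
  · exact (contMDiff_smul_const (E := E) EG g).continuous.comp
      (continuous_fst.comp continuous_subtype_val)
  · exact (continuous_coadjoint g).comp (continuous_snd.comp continuous_subtype_val)

theorem isQuotientMap_weinsteinProj : Topology.IsQuotientMap
    (weinsteinProj : WeinsteinTotal EG E F G Q → WeinsteinSpace EG E F G Q) := by
  have h1 := isOpenQuotientMap_orbitSpace_mk (annAction EG E G Q) continuous_annAction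
  have h2 := (IsOpenQuotientMap.id (X := CotangentBundle F (BaseSpace G Q))).prodMap h1
  let e : WeinsteinTotal EG E F G Q ≃ₜ
      {x : CotangentBundle F (BaseSpace G Q) × AnnBundle EG E G Q // x.1.1 = baseProj G x.2.1.1} :=
    { toFun := fun w => ⟨(w.1.2.1, ⟨(w.1.1, w.1.2.2), w.2.2⟩), w.2.1⟩
      invFun := fun x => ⟨(x.1.2.1.1, (x.1.1, x.1.2.1.2)), x.2, x.1.2.2⟩
      left_inv := fun _ => rfl
      right_inv := fun _ => rfl
      continuous_toFun := by fun_prop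
      continuous_invFun := by fun_prop }
  exact (h2.restrictPreimage' {y | y.1.1 = annBase y.2}).isQuotientMap.comp e.isQuotientMap

/-- G does not move η, so identifying the pairs (q, λ) modulo G with η kept fixed is the same as
taking orbits in 𝒲. -/
theorem weinsteinProj_eq_iff (w w' : WeinsteinTotal EG E F G Q) :
    weinsteinProj w = weinsteinProj w' ↔ ∃ g : G, (weinsteinAction EG E F G Q).smul g w' = w := by
  constructor
  · intro h
    have h' := congrArg Subtype.val h
    obtain ⟨g, hg⟩ := (orbitSpace_mk_eq_iff (annAction EG E G Q) _ _).1 (congrArg Prod.snd h')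
    have hg' := congrArg Subtype.val hg
    have h1 : g • w'.1.1 = w.1.1 := congrArg Prod.fst hg'
    have h2 : coadjoint EG g w'.1.2.2 = w.1.2.2 := congrArg Prod.snd hg'
    have h3 : w.1.2.1 = w'.1.2.1 := congrArg
      (fun y : CotangentBundle F (BaseSpace G Q) × OrbitSpace (annAction EG E G Q) => y.1) h'
    exact ⟨g, Subtype.ext (Prod.ext h1 (Prod.ext h3.symm h2))⟩
  · rintro ⟨g, rfl⟩
    exact Subtype.ext (Prod.ext rfl ((orbitSpace_mk_eq_iff (annAction EG E G Q) _ _).2 ⟨g, rfl⟩))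

theorem momentum_smul (g : G) (z : CotangentBundle E Q) :
    momentum EG ((cotangentAction EG E (G := G)).smul g z) =
      coadjoint EG (G := G) g (momentum EG z) := by
  refine ContinuousLinearMap.ext fun X => ?_
  have key : actMap E g⁻¹ (g • z.1) (zeta EG E G (g • z.1) X) =
      zeta EG E G z.1 (adjointRep EG g⁻¹ X) := by
    have h := zeta_smul (E := E) g⁻¹ (g • z.1) X
    rw [inv_smul_smul] at h
    exact h.symm
  exact congrArg (z.2 : E →L[ℝ] ℝ) key

namespace GeneralizedConnection

theorem isotropyPoint_smul (A : GeneralizedConnection EG E G Q) (g : G)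
    (x : TangentBundle 𝓘(ℝ, E) Q) :
    IsotropyQuotient.mk' EG (E := E) (G := G) (g • x.1) (A.conn (g • x.1) (actMap E g x.1 x.2)) =
      (isotropyQuotientAction EG E G Q).smul g (IsotropyQuotient.mk' EG x.1 (A.conn x.1 x.2)) := by
  exact congrArg (IsotropyQuotient.mk' EG (g • x.1)) (A.conn_smul g x.1 x.2)

theorem tangentMap_baseProj_smul
    (EG : Type*) [NormedAddCommGroup EG] [NormedSpace ℝ EG] [ChartedSpace EG G]
    [ContMDiffSMul 𝓘(ℝ, EG) 𝓘(ℝ, E) ∞ G Q]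
    (hπ : IsSubmersion 𝓘(ℝ, E) 𝓘(ℝ, F) ∞ (baseProj G : Q → BaseSpace G Q)) (g : G)
    (x : TangentBundle 𝓘(ℝ, E) Q) :
    (⟨baseProj G (g • x.1), projMap E F G (g • x.1) (actMap E g x.1 x.2)⟩ :
      TangentBundle 𝓘(ℝ, F) (BaseSpace G Q)) = ⟨baseProj G x.1, projMap E F G x.1 x.2⟩ :=
  TotalSpace.ext (baseProj_smul g x.1) (heq_of_eq (projMap_actMap EG hπ g x.1 x.2))

theorem tangentTotalProj_tangentSplit_smul (A : GeneralizedConnection EG E G Q)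
    (hπ : IsSubmersion 𝓘(ℝ, E) 𝓘(ℝ, F) ∞ (baseProj G : Q → BaseSpace G Q)) (g : G)
    (x : TangentBundle 𝓘(ℝ, E) Q) :
    tangentTotalProj (A.tangentSplit F ((tangentAction EG E (G := G)).smul g x)) =
      tangentTotalProj (E := E) (A.tangentSplit F x) :=
  Subtype.ext (Prod.ext (tangentMap_baseProj_smul EG hπ g x)
    ((orbitSpace_mk_eq_iff (isotropyQuotientAction EG E G Q) _ _).2
      ⟨g, (A.isotropyPoint_smul g x).symm⟩))

/-- The group element that relates the classes in 𝔤/𝔤_q also relates the merged vectors: C is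
equivariant, and ζ does not see the ambiguity in 𝔤_q. -/
theorem exists_smul_tangentMerge (A : GeneralizedConnection EG E G Q)
    (hπ : IsSubmersion 𝓘(ℝ, E) 𝓘(ℝ, F) ∞ (baseProj G : Q → BaseSpace G Q))
    {b b' : TangentTotal EG F G Q}
    (h : tangentTotalProj (E := E) b = tangentTotalProj (E := E) b') :
    ∃ g : G, (tangentAction EG E (G := G)).smul g (A.tangentMerge b') = A.tangentMerge b := by
  have h' := congrArg Subtype.val h
  obtain ⟨g, hg⟩ := (orbitSpace_mk_eq_iff (isotropyQuotientAction EG E G Q) _ _).1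
    (congrArg Prod.snd h')
  obtain ⟨hq, hX⟩ := isotropyQuotient_mk'_eq_iff.1 hg
  have hu : b.1.1 = b'.1.1 := congrArg (fun y => y.1) h'
  obtain ⟨⟨⟨y, u⟩, q, X⟩, hb⟩ := b
  obtain ⟨⟨⟨y', u'⟩, q', X'⟩, hb'⟩ := b'
  change (⟨y, u⟩ : TangentBundle 𝓘(ℝ, F) (BaseSpace G Q)) = ⟨y', u'⟩ at hu
  change g • q' = q at hq
  change zeta EG E G (g • q') (adjointRep EG g X') = zeta EG E G (g • q') X at hX
  cases hu
  subst hq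
  refine ⟨g, TotalSpace.ext rfl (heq_of_eq ?_)⟩
  have key : ∀ u : F, actMap E g q' (A.horMap F q' u + zeta EG E G q' X') =
      A.horMap F (g • q') u + zeta EG E G (g • q') X := by
    intro u
    rw [map_add, ← A.horMap_smul hπ, ← zeta_smul, hX]
  exact key u

theorem tangentMerge_tangentSplit (A : GeneralizedConnection EG E G Q)
    (hπ : IsSubmersion 𝓘(ℝ, E) 𝓘(ℝ, F) ∞ (baseProj G : Q → BaseSpace G Q))
    (x : TangentBundle 𝓘(ℝ, E) Q) : A.tangentMerge (A.tangentSplit F x) = x :=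
  TotalSpace.ext rfl (heq_of_eq (A.horMap_projMap_add hπ x.1 x.2))

theorem tangentTotalProj_tangentSplit_tangentMerge (A : GeneralizedConnection EG E G Q)
    (hπ : IsSubmersion 𝓘(ℝ, E) 𝓘(ℝ, F) ∞ (baseProj G : Q → BaseSpace G Q))
    (b : TangentTotal EG F G Q) :
    tangentTotalProj (E := E) (A.tangentSplit F (A.tangentMerge b)) = tangentTotalProj b := by
  obtain ⟨⟨⟨y, u⟩, q, X⟩, hb⟩ := b
  change y = baseProj G q at hb
  subst hb
  refine Subtype.ext (Prod.ext (TotalSpace.ext rfl (heq_of_eq ?_))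
    (congrArg (OrbitSpace.mk _) (isotropyQuotient_mk'_eq_iff.2 ⟨rfl, ?_⟩)))
  · have key : ∀ u : F, projMap E F G q (A.horMap F q u + zeta EG E G q X) = u := by
      intro u
      rw [map_add, A.projMap_horMap hπ, projMap_zeta hπ, add_zero]
    exact key u
  · exact A.zeta_conn_horMap_add hπ q u X

/-- Tπ is G-invariant, so by the splitting a group element fixes (q, v) as soon as it fixes q and
the class of A_q(v). -/
theorem tangentAction_smul_eq_iff (A : GeneralizedConnection EG E G Q)
    (hπ : IsSubmersion 𝓘(ℝ, E) 𝓘(ℝ, F) ∞ (baseProj G : Q → BaseSpace G Q))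
    (x : TangentBundle 𝓘(ℝ, E) Q) (g : G) :
    (tangentAction EG E (G := G)).smul g x = x ↔ (isotropyQuotientAction EG E G Q).smul g
      (IsotropyQuotient.mk' EG x.1 (A.conn x.1 x.2)) =
        IsotropyQuotient.mk' EG x.1 (A.conn x.1 x.2) := by
  rw [← A.isotropyPoint_smul]
  constructor
  · intro h
    exact congrArg (fun y : TangentBundle 𝓘(ℝ, E) Q =>
      IsotropyQuotient.mk' EG (E := E) (G := G) y.1 (A.conn y.1 y.2)) h
  · intro h
    have h1 := tangentMap_baseProj_smul EG hπ g x
    have key : ∀ y : TangentBundle 𝓘(ℝ, E) Q,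
        (⟨baseProj G y.1, projMap E F G y.1 y.2⟩ : TangentBundle 𝓘(ℝ, F) (BaseSpace G Q)) =
          ⟨baseProj G x.1, projMap E F G x.1 x.2⟩ →
        IsotropyQuotient.mk' EG (E := E) (G := G) y.1 (A.conn y.1 y.2) =
          IsotropyQuotient.mk' EG x.1 (A.conn x.1 x.2) → y = x := by
      rintro ⟨q, v⟩ hu hX
      obtain ⟨q', v'⟩ := x
      obtain ⟨hq, hX⟩ := isotropyQuotient_mk'_eq_iff.1 hX
      change q = q' at hq
      subst hq
      refine TotalSpace.ext rfl (heq_of_eq ?_)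
      have hu' : projMap E F G q v = projMap E F G q v' := TotalSpace.mk_inj.1 hu
      have e := A.horMap_projMap_add hπ q v
      have hX' : zeta EG E G q (A.conn q v) = zeta EG E G q (A.conn q v') := hX
      rw [hu', hX', A.horMap_projMap_add hπ q v'] at e
      exact e.symm
    exact key _ h1 h

theorem dualLift_smul (A : GeneralizedConnection EG E G Q)
    (hπ : IsSubmersion 𝓘(ℝ, E) 𝓘(ℝ, F) ∞ (baseProj G : Q → BaseSpace G Q)) (g : G)
    (z : CotangentBundle E Q) :
    A.dualLift F ((cotangentAction EG E (G := G)).smul g z) = A.dualLift F z := by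
  refine TotalSpace.ext (baseProj_smul g z.1) (heq_of_eq ?_)
  refine ContinuousLinearMap.ext fun u => ?_
  have key : ∀ u : F, actMap E g⁻¹ (g • z.1) (A.horMap F (g • z.1) u) = A.horMap F z.1 u := by
    intro u
    rw [A.horMap_smul hπ, actMap_inv_apply EG]
  exact congrArg (z.2 : E →L[ℝ] ℝ) (key u)

theorem weinsteinIsoInv_smul (A : GeneralizedConnection EG E G Q)
    (hπ : IsSubmersion 𝓘(ℝ, E) 𝓘(ℝ, F) ∞ (baseProj G : Q → BaseSpace G Q)) (g : G)
    (z : CotangentBundle E Q) :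
    A.weinsteinIsoInv F ((cotangentAction EG E (G := G)).smul g z) =
      (weinsteinAction EG E F G Q).smul g (A.weinsteinIsoInv F z) :=
  Subtype.ext (Prod.ext rfl (Prod.ext (A.dualLift_smul hπ g z) (momentum_smul g z)))

theorem weinsteinIso_smul (A : GeneralizedConnection EG E G Q)
    (hπ : IsSubmersion 𝓘(ℝ, E) 𝓘(ℝ, F) ∞ (baseProj G : Q → BaseSpace G Q)) (g : G)
    (w : WeinsteinTotal EG E F G Q) :
    A.weinsteinIso ((weinsteinAction EG E F G Q).smul g w) =
      (cotangentAction EG E (G := G)).smul g (A.weinsteinIso w) := by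
  rw [← A.weinsteinIso_weinsteinIsoInv hπ ((cotangentAction EG E (G := G)).smul g _),
    A.weinsteinIsoInv_smul hπ, A.weinsteinIsoInv_weinsteinIso hπ]

/-- The dual argument: C_q^* p is G-invariant, and p is determined by it together with q and μ(q,
p). -/
theorem cotangentAction_smul_eq_iff (A : GeneralizedConnection EG E G Q)
    (hπ : IsSubmersion 𝓘(ℝ, E) 𝓘(ℝ, F) ∞ (baseProj G : Q → BaseSpace G Q))
    (z : CotangentBundle E Q) (g : G) :
    (cotangentAction EG E (G := G)).smul g z = z ↔ (annAction EG E G Q).smul g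
      ⟨(z.1, momentum EG z), momentum_mem EG z⟩ = ⟨(z.1, momentum EG z), momentum_mem EG z⟩ := by
  constructor
  · intro h
    refine Subtype.ext (Prod.ext (congrArg TotalSpace.proj h) ?_)
    exact (momentum_smul g z).symm.trans (congrArg (fun y => momentum EG (G := G) y) h)
  · intro h
    have h' := congrArg Subtype.val h
    refine (LeftInverse.injective (g := A.weinsteinIso) (A.weinsteinIso_weinsteinIsoInv hπ)) ?_
    rw [A.weinsteinIsoInv_smul hπ]
    have h1 : g • z.1 = z.1 := congrArg Prod.fst h'
    have h2 : coadjoint EG (G := G) g (momentum EG z) = momentum EG z := congrArg Prod.snd h'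
    exact Subtype.ext (Prod.ext h1 (Prod.ext rfl h2))

end GeneralizedConnection

end Equivariance

/-! ### Disjoint unions and transport of brackets -/

section Assembly

theorem IsStratifiedIso.exists_sigma {G : Type*} [Group G] {ι : Type*} {X Y : ι → Type*}
    [∀ i, TopologicalSpace (X i)] [∀ i, TopologicalSpace (Y i)] {D : ∀ i, StratData G (X i)}
    {D' : ∀ i, StratData G (Y i)} {φ : ∀ i, X i ≃ₜ Y i}
    (h : ∀ i, IsStratifiedIso (D i) (D' i) (φ i)) :
    ∃ Φ : (Σ i, X i) ≃ₜ Σ i, Y i, (∀ i x, Φ ⟨i, x⟩ = ⟨i, φ i x⟩) ∧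
      IsStratifiedIso (.sigma D) (.sigma D') Φ := by
  let Φ : (Σ i, X i) ≃ₜ Σ i, Y i :=
    { toEquiv := Equiv.sigmaCongrRight fun i => (φ i).toEquiv
      continuous_toFun := continuous_sigma fun i => continuous_sigmaMk.comp (φ i).continuous
      continuous_invFun :=
        continuous_sigma fun i => continuous_sigmaMk.comp (φ i).symm.continuous }
  have hΦ : ∀ i x, Φ ⟨i, x⟩ = ⟨i, φ i x⟩ := fun _ _ => rfl
  refine ⟨Φ, hΦ, fun L => ?_, fun Z f => forall_congr' fun i => ?_⟩
  · ext ⟨i, y⟩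
    constructor
    · rintro ⟨⟨j, x⟩, hx, hxy⟩
      rw [hΦ] at hxy
      cases hxy
      have hx' : φ i x ∈ φ i '' (D i).stratum L := ⟨x, hx, rfl⟩
      rw [(h i).image_stratum] at hx'
      exact hx'
    · intro hy
      have hy' : y ∈ φ i '' (D i).stratum L := by
        rw [(h i).image_stratum]
        exact hy
      obtain ⟨x, hx, rfl⟩ := hy'
      exact ⟨⟨i, x⟩, hx, rfl⟩
  · exact (h i).smoothOn_iff (Sigma.mk i ⁻¹' Z) fun x => f ⟨i, x⟩

theorem IsPoissonBracket.sigma {G : Type*} [Group G] {ι : Type*} {X : ι → Type*}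
    {D : ∀ i, StratData G (X i)} {br : ∀ i, (X i → ℝ) → (X i → ℝ) → X i → ℝ}
    (h : ∀ i, IsPoissonBracket (D i).smoothFunctions (br i)) :
    IsPoissonBracket (StratData.sigma D).smoothFunctions
      (fun f g x => br x.1 (fun y => f ⟨x.1, y⟩) (fun y => g ⟨x.1, y⟩) x.2) where
  mem f hf g hg i := (h i).mem _ (hf i) _ (hg i)
  add_left f hf g hg k hk := by
    funext x
    exact congrFun ((h x.1).add_left _ (hf x.1) _ (hg x.1) _ (hk x.1)) x.2
  smul_left c f hf g hg := by
    funext x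
    exact congrFun ((h x.1).smul_left c _ (hf x.1) _ (hg x.1)) x.2
  antisymm f hf g hg := by
    funext x
    exact congrFun ((h x.1).antisymm _ (hf x.1) _ (hg x.1)) x.2
  leibniz f hf g hg k hk := by
    funext x
    exact congrFun ((h x.1).leibniz _ (hf x.1) _ (hg x.1) _ (hk x.1)) x.2
  jacobi f hf g hg k hk := by
    funext x
    exact congrFun ((h x.1).jacobi _ (hf x.1) _ (hg x.1) _ (hk x.1)) x.2

theorem IsPoissonBracket.transport {X Y : Type*} {C : Set (X → ℝ)} {C' : Set (Y → ℝ)}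
    {br : (X → ℝ) → (X → ℝ) → X → ℝ} (h : IsPoissonBracket C br) (φ : X ≃ Y)
    (hC : ∀ f : Y → ℝ, f ∈ C' ↔ f ∘ φ ∈ C) :
    IsPoissonBracket C' (fun f g => br (f ∘ φ) (g ∘ φ) ∘ φ.symm) := by
  have hb : ∀ f g : Y → ℝ, (br (f ∘ φ) (g ∘ φ) ∘ φ.symm) ∘ φ = br (f ∘ φ) (g ∘ φ) := by
    intro f g
    funext x
    simp
  constructor
  · intro f hf g hg
    rw [hC, hb]
    exact h.mem _ ((hC f).1 hf) _ ((hC g).1 hg)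
  · intro f hf g hg k hk
    funext y
    exact congrFun (h.add_left _ ((hC f).1 hf) _ ((hC g).1 hg) _ ((hC k).1 hk)) (φ.symm y)
  · intro c f hf g hg
    funext y
    exact congrFun (h.smul_left c _ ((hC f).1 hf) _ ((hC g).1 hg)) (φ.symm y)
  · intro f hf g hg
    funext y
    exact congrFun (h.antisymm _ ((hC f).1 hf) _ ((hC g).1 hg)) (φ.symm y)
  · intro f hf g hg k hk
    funext y
    have e := congrFun (h.leibniz _ ((hC f).1 hf) _ ((hC g).1 hg) _ ((hC k).1 hk)) (φ.symm y)
    simp only [Pi.add_apply, Pi.mul_apply, comp_apply, Equiv.apply_symm_apply] at e ⊢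
    exact e
  · intro f hf g hg k hk
    funext y
    have e := congrFun (h.jacobi _ ((hC f).1 hf) _ ((hC g).1 hg) _ ((hC k).1 hk)) (φ.symm y)
    simp only [hb]
    exact e

end Assembly

/-! ### The isomorphisms and the brackets on one piece of constant dimension -/

section Components

variable {EG : Type*} [NormedAddCommGroup EG] [NormedSpace ℝ EG] [FiniteDimensional ℝ EG]
  {E : Type*} [NormedAddCommGroup E] [NormedSpace ℝ E] [FiniteDimensional ℝ E]
  {F : Type*} [NormedAddCommGroup F] [NormedSpace ℝ F] [FiniteDimensional ℝ F]
  {G : Type*} [Group G] [TopologicalSpace G] [ChartedSpace EG G] [LieGroup 𝓘(ℝ, EG) ∞ G]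
  {Q : Type*} [TopologicalSpace Q] [T2Space Q] [ChartedSpace E Q] [IsManifold 𝓘(ℝ, E) ∞ Q]
  [MulAction G Q] [ContMDiffSMul 𝓘(ℝ, EG) 𝓘(ℝ, E) ∞ G Q] [ProperSMul G Q]
  [ChartedSpace F (BaseSpace G Q)] [IsManifold 𝓘(ℝ, F) ∞ (BaseSpace G Q)]

theorem isQuotientMap_orbitSpace_mk {X : Type*} [TopologicalSpace X] (a : MulAction G X) :
    Topology.IsQuotientMap (OrbitSpace.mk a) := isQuotientMap_quotient_mk'

theorem orbitSpace_mk_smul {X : Type*} (a : MulAction G X) (g : G) (x : X) :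
    OrbitSpace.mk a (a.smul g x) = OrbitSpace.mk a x :=
  (orbitSpace_mk_eq_iff a _ _).2 ⟨g, rfl⟩

namespace GeneralizedConnection

theorem exists_tangent_stratifiedIso (A : GeneralizedConnection EG E G Q)
    (hπ : IsSubmersion 𝓘(ℝ, E) 𝓘(ℝ, F) ∞ (baseProj G : Q → BaseSpace G Q)) :
    ∃ φ : TangentQuotient EG E G Q ≃ₜ TangentWeinstein EG E F G Q,
      (∀ x, φ (OrbitSpace.mk _ x) = A.tangentPoint F x) ∧
      IsStratifiedIso (tangentQuotientData EG E G Q) (tangentWeinsteinData EG E F G Q) φ := by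
  obtain ⟨φ, hφ, hsm⟩ := exists_homeomorph_of_presentations
    (isQuotientMap_orbitSpace_mk (tangentAction EG E (G := G) (Q := Q)))
    A.isQuotientMap_tangentTotalProj Topology.IsInducing.id Topology.IsInducing.subtypeVal
    (A.hasLocalSmoothExtensions_tangentSplit hπ) (A.hasLocalSmoothExtensions_tangentMerge hπ)
    (fun a a' h => by
      obtain ⟨g, rfl⟩ := (orbitSpace_mk_eq_iff _ _ _).1 h
      exact A.tangentTotalProj_tangentSplit_smul hπ g a')
    (fun b b' h => by
      obtain ⟨g, hg⟩ := A.exists_smul_tangentMerge hπ h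
      exact (orbitSpace_mk_eq_iff _ _ _).2 ⟨g, hg⟩)
    (fun a => congrArg _ (A.tangentMerge_tangentSplit hπ a))
    (A.tangentTotalProj_tangentSplit_tangentMerge hπ)
  refine ⟨φ, hφ, fun L => ?_, hsm⟩
  exact image_orbitTypeStratum (tangentAction EG E (G := G) (Q := Q))
    (isotropyQuotientAction EG E G Q) φ.surjective (r := fun y => y.1.2)
    (t := fun x => IsotropyQuotient.mk' EG x.1 (A.conn x.1 x.2))
    (fun x => congrArg (fun y : TangentWeinstein EG E F G Q => y.1.2) (hφ x))
    (A.tangentAction_smul_eq_iff hπ) L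

theorem exists_cotangent_stratifiedIso (A : GeneralizedConnection EG E G Q)
    (hπ : IsSubmersion 𝓘(ℝ, E) 𝓘(ℝ, F) ∞ (baseProj G : Q → BaseSpace G Q)) :
    ∃ φ : CotangentQuotient EG E G Q ≃ₜ WeinsteinSpace EG E F G Q,
      (∀ z, φ (OrbitSpace.mk _ z) = A.cotangentPoint F z) ∧
      IsStratifiedIso (cotangentQuotientData EG E G Q) (weinsteinSpaceData EG E F G Q) φ := by
  obtain ⟨φ, hφ, hsm⟩ := exists_homeomorph_of_presentations
    (isQuotientMap_orbitSpace_mk (cotangentAction EG E (G := G) (Q := Q)))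
    isQuotientMap_weinsteinProj Topology.IsInducing.id Topology.IsInducing.subtypeVal
    (A.hasLocalSmoothExtensions_weinsteinIsoInv hπ) (A.hasLocalSmoothExtensions_weinsteinIso hπ)
    (fun a a' h => by
      obtain ⟨g, rfl⟩ := (orbitSpace_mk_eq_iff _ _ _).1 h
      exact (weinsteinProj_eq_iff _ _).2 ⟨g, (A.weinsteinIsoInv_smul hπ g a').symm⟩)
    (fun b b' h => by
      obtain ⟨g, rfl⟩ := (weinsteinProj_eq_iff _ _).1 h
      rw [A.weinsteinIso_smul hπ]
      exact orbitSpace_mk_smul _ g _)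
    (fun a => congrArg _ (A.weinsteinIso_weinsteinIsoInv hπ a))
    (fun b => congrArg _ (A.weinsteinIsoInv_weinsteinIso hπ b))
  refine ⟨φ, hφ, fun L => ?_, hsm⟩
  exact image_orbitTypeStratum (cotangentAction EG E (G := G) (Q := Q))
    (annAction EG E G Q) φ.surjective (r := fun y => y.1.2)
    (t := fun z => ⟨(z.1, momentum EG z), momentum_mem EG z⟩)
    (fun x => congrArg (fun y : WeinsteinSpace EG E F G Q => y.1.2) (hφ x))
    (A.cotangentAction_smul_eq_iff hπ) L

end GeneralizedConnection

variable (EG E F G Q) in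
theorem exists_weinstein_stratifiedIso :
    ∃ φ : OrbitSpace (weinsteinAction EG E F G Q) ≃ₜ WeinsteinSpace EG E F G Q,
      (∀ w, φ (OrbitSpace.mk _ w) = weinsteinProj w) ∧
      IsStratifiedIso (weinsteinQuotientData EG E F G Q) (weinsteinSpaceData EG E F G Q) φ := by
  have hid : HasLocalSmoothExtensions
      (𝓘(ℝ, E).prod ((𝓘(ℝ, F).prod 𝓘(ℝ, F →L[ℝ] ℝ)).prod 𝓘(ℝ, EG →L[ℝ] ℝ)))
      (𝓘(ℝ, E).prod ((𝓘(ℝ, F).prod 𝓘(ℝ, F →L[ℝ] ℝ)).prod 𝓘(ℝ, EG →L[ℝ] ℝ)))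
      (Subtype.val : WeinsteinTotal EG E F G Q →
        Q × (CotangentBundle F (BaseSpace G Q) × (LieAlg EG G →L[ℝ] ℝ)))
      (Subtype.val : WeinsteinTotal EG E F G Q →
        Q × (CotangentBundle F (BaseSpace G Q) × (LieAlg EG G →L[ℝ] ℝ))) id :=
    .of_contMDiff id contMDiff_id fun _ => rfl
  obtain ⟨φ, hφ, hsm⟩ := exists_homeomorph_of_presentations
    (isQuotientMap_orbitSpace_mk (weinsteinAction EG E F G Q)) isQuotientMap_weinsteinProj
    Topology.IsInducing.subtypeVal Topology.IsInducing.subtypeVal hid hid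
    (fun a a' h => (weinsteinProj_eq_iff a a').2 ((orbitSpace_mk_eq_iff _ _ _).1 h))
    (fun a a' h => (orbitSpace_mk_eq_iff _ _ _).2 ((weinsteinProj_eq_iff a a').1 h))
    (fun _ => rfl) (fun _ => rfl)
  refine ⟨φ, hφ, fun L => ?_, hsm⟩
  refine image_orbitTypeStratum (weinsteinAction EG E F G Q)
    (annAction EG E G Q) φ.surjective (r := fun y => y.1.2)
    (t := fun w => ⟨(w.1.1, w.1.2.2), w.2.2⟩)
    (fun x => congrArg (fun y : WeinsteinSpace EG E F G Q => y.1.2) (hφ x)) (fun w g => ?_) L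
  constructor
  · intro h
    have h1 : g • w.1.1 = w.1.1 := congrArg (fun w : WeinsteinTotal EG E F G Q => w.1.1) h
    have h2 : coadjoint EG g w.1.2.2 = w.1.2.2 :=
      congrArg (fun w : WeinsteinTotal EG E F G Q => w.1.2.2) h
    exact Subtype.ext (Prod.ext h1 h2)
  · intro h
    have h1 : g • w.1.1 = w.1.1 := congrArg (fun w : AnnBundle EG E G Q => w.1.1) h
    have h2 : coadjoint EG g w.1.2.2 = w.1.2.2 := congrArg (fun w : AnnBundle EG E G Q => w.1.2) h
    exact Subtype.ext (Prod.ext h1 (Prod.ext rfl h2))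

/-- The presenting space is all of T*Q, so a local extension is the pull-back itself; smooth
functions on the quotient are the invariant smooth functions. -/
theorem mem_cotangentQuotient_smoothFunctions_iff (f : CotangentQuotient EG E G Q → ℝ) :
    f ∈ (cotangentQuotientData EG E G Q).smoothFunctions ↔
      ContMDiff (𝓘(ℝ, E).prod 𝓘(ℝ, E →L[ℝ] ℝ)) 𝓘(ℝ, ℝ) ∞
        (fun z => f (OrbitSpace.mk (cotangentAction EG E (G := G) (Q := Q)) z)) := by
  constructor
  · intro h z
    obtain ⟨U, hU, hz, f', hf', hff⟩ := h z (mem_univ _)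
    refine (hf'.contMDiffAt (hU.mem_nhds hz)).congr_of_eventuallyEq ?_
    filter_upwards [hU.mem_nhds hz] with y hy using (hff y hy (mem_univ _)).symm
  · intro h z _
    exact ⟨univ, isOpen_univ, mem_univ _, _, h.contMDiffOn, fun _ _ _ => rfl⟩

variable (EG E G Q) in
/-- The bracket of `T*Q`, evaluated on invariant functions. -/
def quotientBracket (f h : CotangentQuotient EG E G Q → ℝ) (y : CotangentQuotient EG E G Q) : ℝ :=
  canonicalBracket (fun z => f (OrbitSpace.mk (cotangentAction EG E (G := G) (Q := Q)) z))
    (fun z => h (OrbitSpace.mk (cotangentAction EG E (G := G) (Q := Q)) z)) (Quotient.out y)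

/-- G acts on T*Q by cotangent lifts of diffeomorphisms, which preserve the bracket, and the two
functions are invariant. -/
theorem canonicalBracket_cotangentAction {f h : CotangentQuotient EG E G Q → ℝ}
    (hf : f ∈ (cotangentQuotientData EG E G Q).smoothFunctions)
    (hh : h ∈ (cotangentQuotientData EG E G Q).smoothFunctions) (g : G) (z : CotangentBundle E Q) :
    canonicalBracket (fun z => f (OrbitSpace.mk (cotangentAction EG E (G := G) (Q := Q)) z))
      (fun z => h (OrbitSpace.mk (cotangentAction EG E (G := G) (Q := Q)) z)) z =
    canonicalBracket (fun z => f (OrbitSpace.mk (cotangentAction EG E (G := G) (Q := Q)) z))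
      (fun z => h (OrbitSpace.mk (cotangentAction EG E (G := G) (Q := Q)) z))
      ((cotangentAction EG E (G := G) (Q := Q)).smul g z) := by
  have hinv : ∀ f : CotangentQuotient EG E G Q → ℝ,
      (fun z => f (OrbitSpace.mk (cotangentAction EG E (G := G) (Q := Q)) z)) ∘
        ((cotangentAction EG E (G := G) (Q := Q)).smul g) =
      (fun z => f (OrbitSpace.mk (cotangentAction EG E (G := G) (Q := Q)) z)) := by
    intro f
    funext z
    exact congrArg f (orbitSpace_mk_smul _ g z)
  have hsurj : ∀ q : Q, Surjective (actMap E g q) := fun q v => ⟨_, actMap_apply_inv EG g q v⟩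
  have hfib : ∀ (q : Q) (p : E →L[ℝ] ℝ),
      (p.comp (actMap E g⁻¹ (g • q))).comp (actMap E g q) = p := fun q p =>
    ContinuousLinearMap.ext fun v => congrArg p (actMap_inv_apply EG g q v)
  have key := canonicalBracket_cotangentLift (θ := fun x : Q => g • x)
    (Φ := (cotangentAction EG E (G := G) (Q := Q)).smul g)
    (contMDiff_smul_const EG g)
    hsurj
    (contMDiff_cotangentAction g) (fun _ => rfl)
    (fun z => hfib z.1 z.2)
    ((mem_cotangentQuotient_smoothFunctions_iff f).1 hf)
    ((mem_cotangentQuotient_smoothFunctions_iff h).1 hh) z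
  rw [hinv, hinv] at key
  exact key

/-- By invariance, the representative chosen in `quotientBracket` can be exchanged for any other
point of the orbit. -/
theorem quotientBracket_mk {f h : CotangentQuotient EG E G Q → ℝ}
    (hf : f ∈ (cotangentQuotientData EG E G Q).smoothFunctions)
    (hh : h ∈ (cotangentQuotientData EG E G Q).smoothFunctions) (z : CotangentBundle E Q) :
    quotientBracket EG E G Q f h (OrbitSpace.mk _ z) =
      canonicalBracket (fun z => f (OrbitSpace.mk (cotangentAction EG E (G := G) (Q := Q)) z))
        (fun z => h (OrbitSpace.mk (cotangentAction EG E (G := G) (Q := Q)) z)) z := by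
  obtain ⟨g, hg⟩ := (orbitSpace_mk_eq_iff (cotangentAction EG E (G := G) (Q := Q))
    (Quotient.out (OrbitSpace.mk (cotangentAction EG E (G := G) (Q := Q)) z)) z).1
    (Quotient.out_eq _)
  rw [quotientBracket, ← hg, ← canonicalBracket_cotangentAction hf hh]

variable (EG E G Q) in
-- The identities are those of T*Q at a representative. For the Jacobi identity, the pull-back of an
-- inner bracket must first be recognized as the canonical bracket of the pull-backs.
theorem isPoissonBracket_quotientBracket :
    IsPoissonBracket (cotangentQuotientData EG E G Q).smoothFunctions
      (quotientBracket EG E G Q) := by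
  have hs := fun f => (mem_cotangentQuotient_smoothFunctions_iff (EG := EG) (E := E) (G := G)
    (Q := Q) f)
  have hlift : ∀ f h : CotangentQuotient EG E G Q → ℝ,
      f ∈ (cotangentQuotientData EG E G Q).smoothFunctions →
      h ∈ (cotangentQuotientData EG E G Q).smoothFunctions →
      (fun z => quotientBracket EG E G Q f h
        (OrbitSpace.mk (cotangentAction EG E (G := G) (Q := Q)) z)) =
      canonicalBracket (fun z => f (OrbitSpace.mk (cotangentAction EG E (G := G) (Q := Q)) z))
        (fun z => h (OrbitSpace.mk (cotangentAction EG E (G := G) (Q := Q)) z)) :=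
    fun f h hf hh => funext fun z => quotientBracket_mk hf hh z
  constructor
  · intro f hf h hh
    rw [hs, hlift f h hf hh]
    exact ((hs f).1 hf).canonicalBracket ((hs h).1 hh)
  · intro f hf g hg h hh
    funext y
    exact canonicalBracket_add_left ((hs f).1 hf) ((hs g).1 hg) ((hs h).1 hh) _
  · intro c f hf h hh
    funext y
    exact canonicalBracket_smul_left c ((hs f).1 hf) ((hs h).1 hh) _
  · intro f hf h hh
    funext y
    exact canonicalBracket_antisymm _ _ _
  · intro f hf g hg h hh
    funext y
    have e := canonicalBracket_mul_right ((hs f).1 hf) ((hs g).1 hg) ((hs h).1 hh) (Quotient.out y)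
    have hy : OrbitSpace.mk (cotangentAction EG E (G := G) (Q := Q)) (Quotient.out y) = y :=
      Quotient.out_eq y
    rw [hy] at e
    exact e
  · intro f hf g hg h hh
    funext y
    have e := canonicalBracket_jacobi ((hs f).1 hf) ((hs g).1 hg) ((hs h).1 hh) (Quotient.out y)
    rw [← hlift g h hg hh, ← hlift h f hh hf, ← hlift f g hf hg] at e
    exact e

end Components

end

/-- `Q` is the disjoint union of the pieces `Q i`, each of constant dimension and invariant
under `G`; all isotropy groups are conjugate to `H`. The orbit spaces `Q i / G`, with the quotient
topology, carry the smooth structure for which the projection is a submersion. -/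
theorem theorem5p2
    {EG : Type*} [NormedAddCommGroup EG] [NormedSpace ℝ EG] [FiniteDimensional ℝ EG]
    {G : Type*} [Group G] [TopologicalSpace G] [T2Space G] [ChartedSpace EG G]
    [LieGroup 𝓘(ℝ, EG) ∞ G]
    {ι : Type*}
    {E : ι → Type*} [∀ i, NormedAddCommGroup (E i)] [∀ i, NormedSpace ℝ (E i)]
    [∀ i, FiniteDimensional ℝ (E i)]
    {Q : ι → Type*} [∀ i, TopologicalSpace (Q i)] [∀ i, T2Space (Q i)]
    [∀ i, ParacompactSpace (Q i)] [∀ i, ChartedSpace (E i) (Q i)]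
    [∀ i, IsManifold 𝓘(ℝ, E i) ∞ (Q i)]
    [∀ i, MulAction G (Q i)] [∀ i, ContMDiffSMul 𝓘(ℝ, EG) 𝓘(ℝ, E i) ∞ G (Q i)]
    [∀ i, ProperSMul G (Q i)]
    (H : Subgroup G)
    (hH : ∀ i, ∀ q : Q i, ∃ g : G, MulAction.stabilizer G q = MulAut.conj g • H)
    {F : ι → Type*} [∀ i, NormedAddCommGroup (F i)] [∀ i, NormedSpace ℝ (F i)]
    [∀ i, FiniteDimensional ℝ (F i)]
    [∀ i, ChartedSpace (F i) (BaseSpace G (Q i))]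
    [∀ i, IsManifold 𝓘(ℝ, F i) ∞ (BaseSpace G (Q i))]
    (hπ : ∀ i, IsSubmersion 𝓘(ℝ, E i) 𝓘(ℝ, F i) ∞ (baseProj G : Q i → BaseSpace G (Q i)))
    (A : ∀ i, GeneralizedConnection EG (E i) G (Q i)) :
    -- the horizontal lift `C_q` is well defined, as the inverse of `T_q π | Hor_q`
    (∀ i, ∀ q : Q i,
      Bijective (fun v : (A i).Hor q => baseProjDeriv (E i) (F i) G q v) ∧
      ∀ u, (A i).horizontalLift (F i) q u ∈ (A i).Hor q ∧
        baseProjDeriv (E i) (F i) G q ((A i).horizontalLift (F i) q u) = u) ∧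
    -- `ψ : 𝒲 → T*Q` is bijective, with the inverse `(q, p) ↦ (q, C_q^* p, μ(q, p))`
    (∀ i, LeftInverse ((A i).weinsteinIsoInv (F i)) (A i).weinsteinIso ∧
      RightInverse ((A i).weinsteinIsoInv (F i)) (A i).weinsteinIso) ∧
    ∃ (α : (Σ i, TangentQuotient EG (E i) G (Q i)) ≃ₜ
        Σ i, TangentWeinstein EG (E i) (F i) G (Q i))
      (β : (Σ i, CotangentQuotient EG (E i) G (Q i)) ≃ₜ
        Σ i, WeinsteinSpace EG (E i) (F i) G (Q i))
      (κ : (Σ i, OrbitSpace (weinsteinAction EG (E i) (F i) G (Q i))) ≃ₜ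
        Σ i, WeinsteinSpace EG (E i) (F i) G (Q i)),
      -- `α [(q, v)] = (Tπ(q, v), [(q, A_q(v))])`
      (∀ i, ∀ x : TangentBundle 𝓘(ℝ, E i) (Q i),
        α ⟨i, OrbitSpace.mk _ x⟩ = ⟨i, (A i).tangentPoint (F i) x⟩) ∧
      IsStratifiedIso (.sigma fun i => tangentQuotientData EG (E i) G (Q i))
        (.sigma fun i => tangentWeinsteinData EG (E i) (F i) G (Q i)) α ∧
      -- `β [(q, p)] = (C_q^* p, [(q, μ(q, p))])`
      (∀ i, ∀ z : CotangentBundle (E i) (Q i),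
        β ⟨i, OrbitSpace.mk _ z⟩ = ⟨i, (A i).cotangentPoint (F i) z⟩) ∧
      IsStratifiedIso (.sigma fun i => cotangentQuotientData EG (E i) G (Q i))
        (.sigma fun i => weinsteinSpaceData EG (E i) (F i) G (Q i)) β ∧
      -- `β` is the fibrewise dual of the inverse of `α`:
      -- `⟨C_q^* p, Tπ v⟩ + ⟨μ(q, p), A_q v⟩ = ⟨p, v⟩`
      (∀ i, ∀ z : CotangentBundle (E i) (Q i), ∀ v : TangentSpace 𝓘(ℝ, E i) z.1,
        (((A i).dualLift (F i) z).2 (baseProjDeriv (E i) (F i) G z.1 v) : ℝ) +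
          momentum EG z ((A i).form z.1 v) = z.2 v) ∧
      -- the identification `𝒲/G = W`
      (∀ i, ∀ w : WeinsteinTotal EG (E i) (F i) G (Q i),
        κ ⟨i, OrbitSpace.mk _ w⟩ = ⟨i, weinsteinProj w⟩) ∧
      IsStratifiedIso (.sigma fun i => weinsteinQuotientData EG (E i) (F i) G (Q i))
        (.sigma fun i => weinsteinSpaceData EG (E i) (F i) G (Q i)) κ ∧
      -- the canonical bracket of `T*Q` descends to a Poisson bracket on `C^∞((T*Q)/G)`,
      -- the bracket of `𝒲` descends to a Poisson bracket on `C^∞(W)`, and `β` preserves brackets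
      ∃ (brT : ((Σ i, CotangentQuotient EG (E i) G (Q i)) → ℝ) →
            ((Σ i, CotangentQuotient EG (E i) G (Q i)) → ℝ) →
            (Σ i, CotangentQuotient EG (E i) G (Q i)) → ℝ)
        (brW : ((Σ i, WeinsteinSpace EG (E i) (F i) G (Q i)) → ℝ) →
            ((Σ i, WeinsteinSpace EG (E i) (F i) G (Q i)) → ℝ) →
            (Σ i, WeinsteinSpace EG (E i) (F i) G (Q i)) → ℝ),
        (∀ f ∈ (StratData.sigma fun i => cotangentQuotientData EG (E i) G (Q i)).smoothFunctions,
          ∀ h ∈ (StratData.sigma fun i => cotangentQuotientData EG (E i) G (Q i)).smoothFunctions,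
          ∀ i, ∀ z : CotangentBundle (E i) (Q i),
            brT f h ⟨i, OrbitSpace.mk _ z⟩ =
              canonicalBracket (fun z' => f ⟨i, OrbitSpace.mk _ z'⟩)
                (fun z' => h ⟨i, OrbitSpace.mk _ z'⟩) z) ∧
        (∀ f ∈ (StratData.sigma fun i => weinsteinSpaceData EG (E i) (F i) G (Q i)).smoothFunctions,
          ∀ h ∈ (StratData.sigma fun i =>
              weinsteinSpaceData EG (E i) (F i) G (Q i)).smoothFunctions,
          ∀ i, ∀ w : WeinsteinTotal EG (E i) (F i) G (Q i),
            brW f h ⟨i, weinsteinProj w⟩ =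
              (A i).weinsteinBracket (fun w' => f ⟨i, weinsteinProj w'⟩)
                (fun w' => h ⟨i, weinsteinProj w'⟩) w) ∧
        IsPoissonBracket
          (StratData.sigma fun i => cotangentQuotientData EG (E i) G (Q i)).smoothFunctions brT ∧
        IsPoissonBracket
          (StratData.sigma fun i => weinsteinSpaceData EG (E i) (F i) G (Q i)).smoothFunctions
          brW ∧
        ∀ f ∈ (StratData.sigma fun i => weinsteinSpaceData EG (E i) (F i) G (Q i)).smoothFunctions,
          ∀ h ∈ (StratData.sigma fun i =>
              weinsteinSpaceData EG (E i) (F i) G (Q i)).smoothFunctions,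
            brT (f ∘ β) (h ∘ β) = brW f h ∘ β := by
  refine ⟨fun i q => ⟨(A i).bijective_projMap_hor (hπ i) q, (A i).horMap_spec (hπ i) q⟩,
    fun i => ⟨(A i).weinsteinIsoInv_weinsteinIso (hπ i), (A i).weinsteinIso_weinsteinIsoInv (hπ i)⟩,
    ?_⟩
  choose α' hα' hαs using fun i => (A i).exists_tangent_stratifiedIso (hπ i)
  choose β' hβ' hβs using fun i => (A i).exists_cotangent_stratifiedIso (hπ i)
  choose κ' hκ' hκs using fun i => exists_weinstein_stratifiedIso EG (E i) (F i) G (Q i)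
  obtain ⟨α, hα, hα_iso⟩ := IsStratifiedIso.exists_sigma hαs
  obtain ⟨β, hβ, hβ_iso⟩ := IsStratifiedIso.exists_sigma hβs
  obtain ⟨κ, hκ, hκ_iso⟩ := IsStratifiedIso.exists_sigma hκs
  have hβmk : ∀ i (z : CotangentBundle (E i) (Q i)),
      β ⟨i, OrbitSpace.mk _ z⟩ = ⟨i, (A i).cotangentPoint (F i) z⟩ := fun i z => by
    rw [hβ, hβ']
  have hβC : ∀ f, f ∈ (StratData.sigma fun i =>
        weinsteinSpaceData EG (E i) (F i) G (Q i)).smoothFunctions ↔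
      f ∘ β ∈ (StratData.sigma fun i => cotangentQuotientData EG (E i) G (Q i)).smoothFunctions :=
    fun f => hβ_iso.smoothOn_iff univ f
  obtain ⟨brT, hbrT, hPoisson⟩ : ∃ brT : ((Σ i, CotangentQuotient EG (E i) G (Q i)) → ℝ) →
        ((Σ i, CotangentQuotient EG (E i) G (Q i)) → ℝ) →
        (Σ i, CotangentQuotient EG (E i) G (Q i)) → ℝ,
      (∀ f ∈ (StratData.sigma fun i => cotangentQuotientData EG (E i) G (Q i)).smoothFunctions,
        ∀ h ∈ (StratData.sigma fun i => cotangentQuotientData EG (E i) G (Q i)).smoothFunctions,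
        ∀ i, ∀ z : CotangentBundle (E i) (Q i),
          brT f h ⟨i, OrbitSpace.mk _ z⟩ =
            canonicalBracket (fun z' => f ⟨i, OrbitSpace.mk _ z'⟩)
              (fun z' => h ⟨i, OrbitSpace.mk _ z'⟩) z) ∧
      IsPoissonBracket
        (StratData.sigma fun i => cotangentQuotientData EG (E i) G (Q i)).smoothFunctions brT :=
    ⟨_, fun f hf h hh i z => quotientBracket_mk (f := fun x => f ⟨i, x⟩) (h := fun x => h ⟨i, x⟩)
      (hf i) (hh i) z, IsPoissonBracket.sigma fun i => isPoissonBracket_quotientBracket EG (E i) G (Q i)⟩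
  -- The bracket of W is defined by transport along β, which makes β Poisson at once. What has to be
  -- shown is that it comes from the bracket of 𝒲.
  refine ⟨α, β, κ, fun i x => by rw [hα, hα'], hα_iso, hβmk, hβ_iso,
    fun i z v => (A i).apply_horMap_projMap_add (hπ i) z.1 z.2 v,
    fun i w => by rw [hκ, hκ'], hκ_iso, brT, fun f h => brT (f ∘ β) (h ∘ β) ∘ β.symm, hbrT,
    fun f hf h hh i w => ?_, hPoisson, hPoisson.transport β.toEquiv hβC, fun f _ h _ => ?_⟩
  -- The inverse of β is induced by ψ, and pulling back along β and then to T*Q is pulling back to 𝒲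
  -- and then along the inverse of ψ. With both replaced, the two sides agree by the definition of
  -- `weinsteinBracket`.
  · have hw : β.symm ⟨i, weinsteinProj w⟩ = ⟨i, OrbitSpace.mk _ ((A i).weinsteinIso w)⟩ := by
      rw [β.symm_apply_eq, hβmk]
      exact congrArg (fun w => (⟨i, weinsteinProj w⟩ : Σ i, WeinsteinSpace EG (E i) (F i) G (Q i)))
        ((A i).weinsteinIsoInv_weinsteinIso (hπ i) w).symm
    have hpull : ∀ f : (Σ i, WeinsteinSpace EG (E i) (F i) G (Q i)) → ℝ,
        (fun z => (f ∘ β) ⟨i, OrbitSpace.mk (cotangentAction EG (E i) (G := G) (Q := Q i)) z⟩) =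
        (fun w => f ⟨i, weinsteinProj w⟩) ∘ (A i).weinsteinIsoInv (F i) := by
      intro f
      funext z
      exact congrArg f (hβmk i z)
    change brT (f ∘ β) (h ∘ β) (β.symm ⟨i, weinsteinProj w⟩) = _
    rw [hw, hbrT _ ((hβC f).1 hf) _ ((hβC h).1 hh), hpull, hpull]
    rfl
  · funext x
    simp
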